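/- For $d\ge 1$ let $\{-d^{-1/2},d^{-1/2}\}^d$ be the velocity space, and let $x^d_t=(\xi^d_t,v^d_t)$, $t\ge 0$, be the Zig-Zag sampler for the standard normal distribution on $\mathbb{R}^d$, that is, a càdlàg process with values in $\mathbb{R}^d\times\{-d^{-1/2},d^{-1/2}\}^d$ satisfying, almost surely for all $t\ge 0$ and $i=1,\dots,d$, $$\xi^d_t=\xi^d_0+\int_0^t v^d_s\,\mathrm{d}s,\qquad v^d_{i,t}=v^d_{i,0}-2\int_{[0,t]\times\mathbb{R}_+} v^d_{i,s-}\,1_{\{z\le (\xi^d_{i,s-}v^d_{i,s-})^+\}}\,N^i(\mathrm{d}s,\mathrm{d}z),$$ where $N^1,\dots,N^d$ are independent Poisson random measures on $\mathbb{R}_+\times\mathbb{R}_+$ with intensity $\mathrm{d}s\,\mathrm{d}z$, jointly independent of the initial state $x^d_0$. Suppose that the process is started from its stationary distribution: $\xi^d_0\sim\mathcal{N}(0,I_d)$, and $v^d_0$ is independent of $\xi^d_0$ and uniform on $\{-d^{-1/2},d^{-1/2}\}^d$. Let $S^d_t=\langle \xi^d_{d^{1/2}t},v^d_{d^{1/2}t}\rangle$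 be the (time-scaled) angular momentum process, and $\Delta S^d_t=S^d_t-S^d_{t-}$ with $S^d_{0-}=S^d_0$. Then for every $T>0$ the number of switches $\sum_{0\le t\le T}1_{\{\Delta S^d_t\ne 0\}}$ is almost surely finite for every $d\ge1$, and $$d^{-1}\sum_{0\le t\le T}1_{\{\Delta S^d_t\neq 0\}}\longrightarrow \frac{T}{\sqrt{2\pi}}\quad\text{in probability as } d\to\infty.$$ -/

import Mathlib

open MeasureTheory ProbabilityTheory Filter Topology
open scoped NNReal ENNReal

noncomputable section

namespace ZigZag

/-- Lebesgue measure on `[0, ∞)`. -/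
def lebesgue : Measure ℝ≥0 := (volume : Measure ℝ).comap ((↑) : ℝ≥0 → ℝ)

/-- A Poisson random measure on `E` with intensity measure `μ`: a random counting measure whose
value on each measurable set of finite intensity is Poisson distributed with that intensity as its
mean, and whose values on finitely many pairwise disjoint measurable sets are independent. -/
structure IsPoissonRandomMeasure {Ω E : Type*} [MeasurableSpace Ω] [MeasurableSpace E]
    (N : Ω → Measure E) (μ : Measure E) (P : Measure Ω) : Prop where
  measurable : Measurable N
  counting : ∀ᵐ ω ∂P, ∀ B : Set E, MeasurableSet B → ∃ n : ℕ∞, N ω B = (n : ℝ≥0∞)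
  poisson : ∀ B : Set E, MeasurableSet B → μ B ≠ ∞ →
    HasLaw (fun ω => N ω B)
      ((poissonMeasure (μ B).toNNReal).map (fun n : ℕ => (n : ℝ≥0∞))) P
  indep : ∀ (k : ℕ) (B : Fin k → Set E), (∀ j, MeasurableSet (B j)) →
    Pairwise (fun j l => Disjoint (B j) (B l)) →
    iIndepFun (fun j ω => N ω (B j)) P

/-- A path on `[0, ∞)` that is right continuous with left limits. -/
def IsCadlag {X : Type*} [TopologicalSpace X] (f : ℝ≥0 → X) : Prop :=
  ∀ t, ContinuousWithinAt f (Set.Ici t) t ∧ ∃ l, Tendsto f (𝓝[<] t) (𝓝 l)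

/-- The set of times `t` with `0 ≤ t ≤ T` and `Δ f t = f t - f (t-) ≠ 0`, where `f (0-) = f 0`. -/
def jumpTimes (f : ℝ≥0 → ℝ) (T : ℝ≥0) : Set ℝ≥0 :=
  {t | t ≤ T ∧ f t - Function.leftLim f t ≠ 0}

/-- The velocity space `{-d^{-1/2}, d^{-1/2}}^d`. -/
def velocities (d : ℕ) : Set (EuclideanSpace ℝ (Fin d)) :=
  {v | ∀ i, v i = -(√(d : ℝ))⁻¹ ∨ v i = (√(d : ℝ))⁻¹}

/-- The Zig-Zag sampler with jump rates `rate i`: a process `x t = (ξ t, v t)` with values in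
`ℝ^d × {-d^{-1/2}, d^{-1/2}}^d`, càdlàg, driven by independent Poisson random measures `N i` on
`[0, ∞) × [0, ∞)` with Lebesgue intensity that are independent of the initial state, and solving
`ξ t = ξ 0 + ∫_0^t v s ds`,
`v_i t = v_i 0 - 2 ∫_{[0,t] × [0,∞)} v_i (s-) 1{z ≤ rate i (x (s-))} N i (ds, dz)`.
For paths on `[0, ∞)` the left limit at `0` is by convention the value at `0`. -/
structure IsZigZagProcess {Ω : Type*} [MeasurableSpace Ω] (P : Measure Ω) (d : ℕ)
    (rate : Fin d → EuclideanSpace ℝ (Fin d) × EuclideanSpace ℝ (Fin d) → ℝ)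
    (N : Fin d → Ω → Measure (ℝ≥0 × ℝ≥0))
    (x : ℝ≥0 → Ω → EuclideanSpace ℝ (Fin d) × EuclideanSpace ℝ (Fin d)) : Prop where
  poisson : ∀ i, IsPoissonRandomMeasure (N i) (lebesgue.prod lebesgue) P
  indep : iIndepFun N P
  indep_init : IndepFun (x 0) (fun ω i => N i ω) P
  measurable : ∀ t, Measurable (x t)
  cadlag : ∀ᵐ ω ∂P, IsCadlag (fun t => x t ω)
  velocity_mem : ∀ᵐ ω ∂P, ∀ t, (x t ω).2 ∈ velocities d
  position_eq : ∀ᵐ ω ∂P, ∀ t, (x t ω).1 = (x 0 ω).1 + ∫ s in Set.Icc 0 t, (x s ω).2 ∂lebesgue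
  velocity_eq : ∀ᵐ ω ∂P, ∀ t i, (x t ω).2 i = (x 0 ω).2 i -
    2 * ∫ p in Set.Icc 0 t ×ˢ Set.univ,
      (let xm := Function.leftLim (fun u => x u ω) p.1
       xm.2 i * Set.indicator {z : ℝ≥0 | (z : ℝ) ≤ rate i xm} 1 p.2) ∂(N i ω)

/-- The jump rate `(ξ_i v_i)^+` for the standard normal target. -/
def gaussianRate {d : ℕ} (i : Fin d)
    (x : EuclideanSpace ℝ (Fin d) × EuclideanSpace ℝ (Fin d)) : ℝ :=
  max (x.1 i * x.2 i) 0

/-- The stationary distribution: standard normal position, independent uniform velocity. -/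
def stationaryLaw (d : ℕ) : Measure (EuclideanSpace ℝ (Fin d) × EuclideanSpace ℝ (Fin d)) :=
  (stdGaussian (EuclideanSpace ℝ (Fin d))).prod (uniformOn (velocities d))

/-- The angular momentum path `t ↦ ⟨ξ_{d^{1/2} t}, v_{d^{1/2} t}⟩`. -/
def angularMomentum {d : ℕ}
    (x : ℝ≥0 → EuclideanSpace ℝ (Fin d) × EuclideanSpace ℝ (Fin d)) (t : ℝ≥0) : ℝ :=
  inner ℝ (x (NNReal.sqrt d * t)).1 (x (NNReal.sqrt d * t)).2

end ZigZag

end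

/-! In rescaled time the coordinates decouple. Each one becomes a one-dimensional zig-zag of unit
speed (`IsZigZagPath.isUnitPath`), driven by its own Poisson measure and started from its own
standard normal momentum, and these inputs are independent over the coordinates
(`IsZigZagProcess.iIndepFun_input`). The momentum r of a coordinate grows at unit speed and is sent
to -r at rate r⁺. Since N(0,1) is stationary for it, the mean number of switches up to T is T E[r⁺]
= T/√(2π), and the claim is a weak law of large numbers for d independent counts of bounded
variance.

Generators and invariance in continuous time are avoided by discretisation. The interval [0,T] is
cut into n steps of length h = T/n, and each momentum is replaced by a `chain` that allows at most
one switch per step. Four facts carry the argument.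

(1) One step of the chain preserves N(0,1) up to an error h³ (`lintegral_transition_le`), so all n
steps together drift by at most n h³. As a step fires with stationary probability h/√(2π) + O(h²),
the mean count is T/√(2π) + O(h).

(2) The second moment of the count is bounded uniformly in n
(`IsStationaryInput.lintegral_switchCount_sq_le`), because up to time T the switching rate is at
most |x| + T, where x is the initial momentum.

(3) The chain is the exact skeleton of the process if every `corner` is free of points: after a
switch the momentum is negative, hence below h until the end of the step, and a second switch would
need a point in the corner. If moreover no two coordinates fire in the same step, the number of
jumps is the sum of the counts (`IsZigZagPath.ncard_jumpTimes`).

(4) The event excluded in (3) has probability O(d²/n) (`measure_crowded_le_div`).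

For fixed d, letting n tend to infinity gives the finiteness. For the limit n = d³ is taken: the
excluded event and the variance of the average are then both O(1/d), and Chebyshev's inequality
concludes. -/

noncomputable section

namespace ZigZag

/-! ### Poisson random measures: independence on disjoint sets, images, void probabilities -/

section PoissonRandomMeasure

variable {Ω E F : Type*} [MeasurableSpace Ω] [MeasurableSpace E] [MeasurableSpace F]
  {N : Ω → Measure E} {μ : Measure E} {P : Measure Ω}

omit [MeasurableSpace Ω] in
theorem comap_measure_eq_iSup (N : Ω → Measure E) :
    MeasurableSpace.comap N inferInstance =
      ⨆ s : {s : Set E // MeasurableSet s},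
        MeasurableSpace.comap (fun ω => N ω s) inferInstance := by
  have h : (Measure.instMeasurableSpace : MeasurableSpace (Measure E)) =
      ⨆ s : {s : Set E // MeasurableSet s},
        MeasurableSpace.comap (fun ν : Measure E => ν s) inferInstance := by
    rw [iSup_subtype]
    rfl
  rw [h, MeasurableSpace.comap_iSup]
  simp only [MeasurableSpace.comap_comp]
  rfl

theorem measurable_restrict {U : Set E} (hU : MeasurableSet U) :
    Measurable fun ν : Measure E => ν.restrict U := by
  refine Measure.measurable_of_measurable_coe _ fun s hs => ?_
  simp only [Measure.restrict_apply hs]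
  exact Measure.measurable_coe (hs.inter hU)

/-- The atoms cut out by a family of sets. -/
def atom {ι : Type*} (B : ι → Set E) (a : ι → Bool) : Set E :=
  {e | ∀ j, e ∈ B j ↔ a j = true}

theorem measurableSet_atom {ι : Type*} [Finite ι] {B : ι → Set E}
    (hB : ∀ j, MeasurableSet (B j)) (a : ι → Bool) : MeasurableSet (atom B a) := by
  have : atom B a = ⋂ j, {e | e ∈ B j ↔ a j = true} := by
    ext e; simp [atom]
  rw [this]
  refine MeasurableSet.iInter fun j => ?_
  by_cases h : a j = true
  · simpa [h] using hB j
  · have h2 : {e | e ∈ B j ↔ a j = true} = (B j)ᶜ := by ext e; simp [h]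
    rw [h2]
    exact (hB j).compl

omit [MeasurableSpace E] in
theorem disjoint_atom {ι : Type*} (B : ι → Set E) {a b : ι → Bool} (hab : a ≠ b) :
    Disjoint (atom B a) (atom B b) := by
  rw [Set.disjoint_left]
  intro e ha hb
  apply hab
  funext j
  have h1 := ha j
  have h2 := hb j
  exact Bool.eq_iff_iff.2 (h1.symm.trans h2)

-- Overlapping sets are reduced to the disjoint atoms that they generate, since the definition of a
-- Poisson random measure gives independence only on disjoint sets.
open Classical in
theorem measure_inter_eq_sum_atom {ι : Type*} [Fintype ι] {B : ι → Set E}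
    (hB : ∀ j, MeasurableSet (B j)) {U : Set E} (hU : MeasurableSet U) (ν : Measure E) (j : ι) :
    ν (B j ∩ U) = ∑ a : ι → Bool with a j = true, ν (atom B a ∩ U) := by
  rw [← measure_biUnion_finset]
  · congr 1
    ext e
    simp only [Set.mem_inter_iff, Set.mem_iUnion, Finset.mem_filter, Finset.mem_univ, true_and,
      exists_prop]
    constructor
    · rintro ⟨he, hu⟩
      exact ⟨fun i => decide (e ∈ B i), by simpa using he, fun i => by simp, hu⟩
    · rintro ⟨a, haj, ha, hu⟩
      exact ⟨(ha j).2 haj, hu⟩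
  · intro a _ b _ hab
    exact (disjoint_atom B hab).mono Set.inter_subset_left Set.inter_subset_left
  · intro a _
    exact (measurableSet_atom hB a).inter hU

theorem IsPoissonRandomMeasure.iIndepFun_fintype (h : IsPoissonRandomMeasure N μ P)
    {κ : Type*} [Fintype κ] (B : κ → Set E) (hB : ∀ j, MeasurableSet (B j))
    (hd : Pairwise fun j l => Disjoint (B j) (B l)) :
    iIndepFun (fun j ω => N ω (B j)) P := by
  have e := Fintype.equivFin κ
  have := h.indep _ (fun i => B (e.symm i)) (fun i => hB _)
    (fun i j hij => hd (e.symm.injective.ne hij))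
  have h2 := this.precomp e.injective
  simpa using h2

/-- A Poisson random measure restricted to disjoint sets gives independent random measures. -/
theorem IsPoissonRandomMeasure.indepFun_restrict [IsProbabilityMeasure P]
    (h : IsPoissonRandomMeasure N μ P)
    {U V : Set E} (hU : MeasurableSet U) (hV : MeasurableSet V) (hUV : Disjoint U V) :
    IndepFun (fun ω => (N ω).restrict U) (fun ω => (N ω).restrict V) P := by
  classical
  have hmeas : ∀ {U : Set E}, MeasurableSet U → Measurable fun ω => (N ω).restrict U :=
    fun hU => (measurable_restrict hU).comp h.measurable
  rw [IndepFun_iff_Indep, comap_measure_eq_iSup, comap_measure_eq_iSup,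
    ← iSup_univ (f := fun s : {s : Set E // MeasurableSet s} =>
        MeasurableSpace.comap (fun ω => (N ω).restrict U s) inferInstance),
    ← iSup_univ (f := fun s : {s : Set E // MeasurableSet s} =>
        MeasurableSpace.comap (fun ω => (N ω).restrict V s) inferInstance),
    ← generateFrom_piiUnionInter_measurableSet _ Set.univ,
    ← generateFrom_piiUnionInter_measurableSet (fun s : {s : Set E // MeasurableSet s} =>
        MeasurableSpace.comap (fun ω => (N ω).restrict V s) inferInstance) Set.univ]
  have key : ∀ {U : Set E}, MeasurableSet U → ∀ s : {s : Set E // MeasurableSet s},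
      Measurable fun ω => (N ω).restrict U s :=
    fun hU s => (Measure.measurable_coe s.2).comp (hmeas hU)
  -- Finite intersections of events about single evaluations form generating π-systems, so
  -- independence need only be checked on them.
  refine IndepSets.indep' ?_ ?_ ?_ ?_ ?_
  · rintro t ⟨S, -, f, hf, rfl⟩
    exact S.measurableSet_biInter fun s hs => (key hU s).comap_le _ (hf s hs)
  · rintro t ⟨S, -, f, hf, rfl⟩
    exact S.measurableSet_biInter fun s hs => (key hV s).comap_le _ (hf s hs)
  · exact isPiSystem_piiUnionInter _ (fun _ => @MeasurableSpace.isPiSystem_measurableSet Ω (_)) _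
  · exact isPiSystem_piiUnionInter _ (fun _ => @MeasurableSpace.isPiSystem_measurableSet Ω (_)) _
  rw [IndepSets_iff]
  rintro t₁ t₂ ⟨S, -, f, hf, rfl⟩ ⟨S', -, f', hf', rfl⟩
  choose! A hA hfA using hf
  choose! A' hA' hfA' using hf'
  let BS : S → Set E := fun s => s.1
  let BS' : S' → Set E := fun s => s.1
  have hBS : ∀ j, MeasurableSet (BS j) := fun j => j.1.2
  have hBS' : ∀ j, MeasurableSet (BS' j) := fun j => j.1.2
  -- The atoms on both sides, cut with `U` and with `V`, form one disjoint family. The evaluations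
  -- on each side are sums over its own half of this family (`gU`, `gV`).
  let C : (S → Bool) ⊕ (S' → Bool) → Set E :=
    Sum.elim (fun a => atom BS a ∩ U) (fun a => atom BS' a ∩ V)
  have hC : ∀ j, MeasurableSet (C j) := by
    rintro (a | a)
    · exact (measurableSet_atom hBS a).inter hU
    · exact (measurableSet_atom hBS' a).inter hV
  have hCd : Pairwise fun j l => Disjoint (C j) (C l) := by
    rintro (a | a) (b | b) hab
    · exact (disjoint_atom BS (fun h => hab (by rw [h]))).mono
        Set.inter_subset_left Set.inter_subset_left
    · exact hUV.mono Set.inter_subset_right Set.inter_subset_right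
    · exact hUV.symm.mono Set.inter_subset_right Set.inter_subset_right
    · exact (disjoint_atom BS' (fun h => hab (by rw [h]))).mono
        Set.inter_subset_left Set.inter_subset_left
  have hind := h.iIndepFun_fintype C hC hCd
  have hm : ∀ j, Measurable fun ω => N ω (C j) := fun j =>
    (Measure.measurable_coe (hC j)).comp h.measurable
  have hfin := hind.indepFun_finset (Finset.univ.map Function.Embedding.inl)
    (Finset.univ.map Function.Embedding.inr) (by
      rw [Finset.disjoint_left]; intro x hx hx'; simp at hx hx'
      obtain ⟨a, rfl⟩ := hx; obtain ⟨b, hb⟩ := hx'; cases hb) hm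
  let gU : ((Finset.univ.map (Function.Embedding.inl (α := S → Bool) (β := S' → Bool))) → ℝ≥0∞) →
      S → ℝ≥0∞ := fun v j => ∑ a : {a : S → Bool // a j = true}, v ⟨Sum.inl a, by simp⟩
  let gV : ((Finset.univ.map (Function.Embedding.inr (α := S → Bool) (β := S' → Bool))) → ℝ≥0∞) →
      S' → ℝ≥0∞ := fun v j => ∑ a : {a : S' → Bool // a j = true}, v ⟨Sum.inr a, by simp⟩
  have hgU : Measurable gU := by fun_prop
  have hgV : Measurable gV := by fun_prop
  have hcomp := hfin.comp hgU hgV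
  have eU : ∀ ω (j : S), gU (fun i => N ω (C i)) j = (N ω).restrict U j.1 := by
    intro ω j
    rw [Measure.restrict_apply j.1.2]
    have := measure_inter_eq_sum_atom hBS hU (N ω) j
    rw [Finset.sum_subtype (p := fun a : S → Bool => a j = true) _ (by simp)] at this
    exact this.symm
  have eV : ∀ ω (j : S'), gV (fun i => N ω (C i)) j = (N ω).restrict V j.1 := by
    intro ω j
    rw [Measure.restrict_apply j.1.2]
    have := measure_inter_eq_sum_atom hBS' hV (N ω) j
    rw [Finset.sum_subtype (p := fun a : S' → Bool => a j = true) _ (by simp)] at this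
    exact this.symm
  have := hcomp.measure_inter_preimage_eq_mul (Set.univ.pi fun j : S => A j.1)
    (Set.univ.pi fun j : S' => A' j.1)
    (MeasurableSet.univ_pi fun j => hA _ j.2) (MeasurableSet.univ_pi fun j => hA' _ j.2)
  have s1 : (⋂ s ∈ S, f s) = (gU ∘ fun ω (i : (Finset.univ.map
      (Function.Embedding.inl (α := S → Bool) (β := S' → Bool)))) => N ω (C i)) ⁻¹'
      (Set.univ.pi fun j : S => A j.1) := by
    ext ω
    simp only [Set.mem_iInter, Set.mem_preimage, Set.mem_pi, Set.mem_univ, true_imp_iff,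
      Function.comp, eU]
    constructor
    · intro hh j; have := hh j.1 j.2; rw [← hfA _ j.2] at this; exact this
    · intro hh s hs; rw [← hfA _ hs]; exact hh ⟨s, hs⟩
  have s2 : (⋂ s ∈ S', f' s) = (gV ∘ fun ω (i : (Finset.univ.map
      (Function.Embedding.inr (α := S → Bool) (β := S' → Bool)))) => N ω (C i)) ⁻¹'
      (Set.univ.pi fun j : S' => A' j.1) := by
    ext ω
    simp only [Set.mem_iInter, Set.mem_preimage, Set.mem_pi, Set.mem_univ, true_imp_iff,
      Function.comp, eV]
    constructor
    · intro hh j; have := hh j.1 j.2; rw [← hfA' _ j.2] at this; exact this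
    · intro hh s hs; rw [← hfA' _ hs]; exact hh ⟨s, hs⟩
  rw [s1, s2]
  exact this

theorem IsPoissonRandomMeasure.map (h : IsPoissonRandomMeasure N μ P) {g : E → F}
    (hg : Measurable g) : IsPoissonRandomMeasure (fun ω => (N ω).map g) (μ.map g) P where
  measurable := (Measure.measurable_map g hg).comp h.measurable
  counting := by
    filter_upwards [h.counting] with ω hω B hB
    rw [Measure.map_apply hg hB]
    exact hω _ (hg hB)
  poisson B hB hfin := by
    simp only [Measure.map_apply hg hB] at hfin ⊢
    exact h.poisson _ (hg hB) hfin
  indep k B hB hd := by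
    simp only [Measure.map_apply hg (hB _)]
    exact h.indep k _ (fun j => hg (hB j)) (fun i j hij => (hd hij).preimage g)

theorem IsPoissonRandomMeasure.measure_eq_zero (h : IsPoissonRandomMeasure N μ P) {B : Set E}
    (hB : MeasurableSet B) (hfin : μ B ≠ ∞) :
    P {ω | N ω B = 0} = ENNReal.ofReal (Real.exp (-(μ B).toReal)) := by
  have h1 := (h.poisson B hB hfin).measure_eq (p := fun y => y = 0) (measurableSet_singleton 0)
  rw [Set.ofPred_eq_eq_singleton] at h1
  rw [h1, Measure.map_apply (measurable_of_countable _) (measurableSet_singleton 0)]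
  have : ((fun n : ℕ => (n : ℝ≥0∞)) ⁻¹' {0}) = {0} := by ext n; simp
  rw [this, poissonMeasure_singleton]
  simp [ENNReal.coe_toNNReal_eq_toReal]

/-- Almost surely the values are integers or infinite, so this is the complement of the void event.
-/
theorem IsPoissonRandomMeasure.measure_one_le [IsProbabilityMeasure P]
    (h : IsPoissonRandomMeasure N μ P) {B : Set E}
    (hB : MeasurableSet B) (hfin : μ B ≠ ∞) :
    P {ω | 1 ≤ N ω B} = ENNReal.ofReal (1 - Real.exp (-(μ B).toReal)) := by
  have hm : Measurable fun ω => N ω B := (Measure.measurable_coe hB).comp h.measurable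
  have h0 : {ω | 1 ≤ N ω B} =ᵐ[P] ((fun ω => N ω B) ⁻¹' {0})ᶜ := by
    filter_upwards [h.counting] with ω hω
    obtain ⟨n, hn⟩ := hω B hB
    apply propext
    change 1 ≤ N ω B ↔ ¬ N ω B = 0
    rw [hn]
    cases n with
    | top => simp
    | coe n => 
      norm_cast
      omega
  have h1 : P ((fun ω => N ω B) ⁻¹' {0}) = _ := h.measure_eq_zero hB hfin
  have h2 := prob_compl_eq_one_sub (μ := P) (hm (measurableSet_singleton 0))
  refine (measure_congr h0).trans (h2.trans ?_)
  rw [h1, ENNReal.ofReal_sub _ (Real.exp_pos _).le, ENNReal.ofReal_one]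

theorem IsPoissonRandomMeasure.ae_lt_top [IsProbabilityMeasure P]
    (h : IsPoissonRandomMeasure N μ P) {B : Set E}
    (hB : MeasurableSet B) (hfin : μ B ≠ ∞) : ∀ᵐ ω ∂P, N ω B < ∞ := by
  have h1 := (h.poisson B hB hfin).measure_eq (p := fun y => y = ∞) (measurableSet_singleton ∞)
  rw [Set.ofPred_eq_eq_singleton,
    Measure.map_apply (measurable_of_countable _) (measurableSet_singleton ∞)] at h1
  have : ((fun n : ℕ => (n : ℝ≥0∞)) ⁻¹' {∞}) = ∅ := by ext n; simp
  rw [this, measure_empty] at h1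
  rw [ae_iff]
  simpa using h1

end PoissonRandomMeasure

/-! ### One time step: switching hazard, transition operator, near-invariance of N(0,1) -/

section OneStep

/-- The primitive `(w⁺)² / 2` of the positive part. -/
def halfSqPos (w : ℝ) : ℝ := (max w 0) ^ 2 / 2

theorem hasDerivAt_halfSqPos (w : ℝ) : HasDerivAt halfSqPos (max w 0) w := by
  rcases lt_trichotomy w 0 with h | h | h
  · rw [max_eq_right h.le]
    refine (hasDerivAt_const w (0 : ℝ)).congr_of_eventuallyEq ?_
    filter_upwards [Iio_mem_nhds h] with y hy
    simp [halfSqPos, max_eq_right (Set.mem_Iio.1 hy).le]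
  · subst h
    rw [hasDerivAt_iff_isLittleO_nhds_zero]
    simp only [halfSqPos, zero_add, max_self, smul_zero, sub_zero, ne_eq, OfNat.ofNat_ne_zero,
      not_false_eq_true, zero_pow, zero_div]
    refine Asymptotics.IsBigO.trans_isLittleO (g := fun h : ℝ => h ^ 2) ?_ ?_
    · refine Asymptotics.IsBigO.of_bound 1 (Eventually.of_forall fun y => ?_)
      rw [Real.norm_of_nonneg (by positivity), Real.norm_of_nonneg (by positivity)]
      rcases le_total y 0 with hy | hy
      · rw [max_eq_right hy]; nlinarith [sq_nonneg y]
      · rw [max_eq_left hy]; nlinarith [sq_nonneg y]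
    · simpa using Asymptotics.isLittleO_pow_pow (𝕜 := ℝ) (m := 1) (n := 2) (by norm_num)
  · rw [max_eq_left h.le]
    have h2 : HasDerivAt (fun y : ℝ => y ^ 2 / 2) w w := by
      have := (hasDerivAt_pow 2 w).div_const 2
      simpa using this
    refine h2.congr_of_eventuallyEq ?_
    filter_upwards [Ioi_mem_nhds h] with y hy
    simp [halfSqPos, max_eq_left (Set.mem_Ioi.1 hy).le]

theorem continuous_halfSqPos : Continuous halfSqPos := by
  unfold halfSqPos; fun_prop

theorem monotone_halfSqPos : Monotone halfSqPos := by
  intro a b hab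
  unfold halfSqPos
  have : max a 0 ≤ max b 0 := max_le_max_right 0 hab
  have h0 : 0 ≤ max a 0 := le_max_right _ _
  nlinarith

/-- The integrated jump rate `∫ s in 0..u, (x + s)⁺`. -/
def hazard (x u : ℝ) : ℝ := halfSqPos (x + u) - halfSqPos x

@[simp] theorem hazard_zero (x : ℝ) : hazard x 0 = 0 := by simp [hazard]

theorem hazard_nonneg {x u : ℝ} (hu : 0 ≤ u) : 0 ≤ hazard x u :=
  sub_nonneg.2 (monotone_halfSqPos (by linarith))

theorem continuous_hazard : Continuous fun p : ℝ × ℝ => hazard p.1 p.2 := by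
  have := continuous_halfSqPos
  unfold hazard; fun_prop

theorem hasDerivAt_hazard (x u : ℝ) : HasDerivAt (hazard x) (max (x + u) 0) u := by
  unfold hazard
  have h := (hasDerivAt_halfSqPos (x + u)).comp u ((hasDerivAt_id u).const_add x)
  simpa [Function.comp_def] using h.sub_const (halfSqPos x)

/-- The rate (x + s)⁺ is nondecreasing in s, so its value at the right endpoint bounds the integral;
`le_hazard` uses the left endpoint. -/
theorem hazard_le {x u : ℝ} (hu : 0 ≤ u) : hazard x u ≤ u * max (x + u) 0 := by
  unfold hazard halfSqPos
  have h1 : max (x + u) 0 - u ≤ max x 0 := by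
    rcases le_total (x + u) 0 with h | h
    · rw [max_eq_right h]; linarith [le_max_right x 0]
    · rw [max_eq_left h]; linarith [le_max_left x 0]
  have h2 : max x 0 ≤ max (x + u) 0 := max_le_max_right 0 (by linarith)
  nlinarith [le_max_right x 0]

theorem le_hazard {x u : ℝ} (hu : 0 ≤ u) : u * max x 0 ≤ hazard x u := by
  unfold hazard halfSqPos
  rcases le_total x 0 with h | h
  · rw [max_eq_right h]; nlinarith [sq_nonneg (max (x + u) 0)]
  · rw [max_eq_left h, max_eq_left (by linarith)]; nlinarith

theorem lintegral_Ioc_ofReal_deriv {G g : ℝ → ℝ} {a b : ℝ} (hab : a ≤ b)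
    (hG : ∀ u, HasDerivAt G (g u) u) (hg : Continuous g) (h0 : ∀ u, 0 ≤ g u) :
    ∫⁻ u in Set.Ioc a b, ENNReal.ofReal (g u) = ENNReal.ofReal (G b - G a) := by
  rw [← ofReal_integral_eq_lintegral_ofReal, ← intervalIntegral.integral_of_le hab,
    intervalIntegral.integral_eq_sub_of_hasDerivAt (fun u _ => hG u)
      (hg.intervalIntegrable _ _)]
  · exact (hg.integrableOn_Icc (a := a) (b := b)).mono_set Set.Ioc_subset_Icc_self
  · exact Eventually.of_forall h0

/-- The standard normal density. -/
def normalPDF (x : ℝ) : ℝ := (√(2 * Real.pi))⁻¹ * Real.exp (-x ^ 2 / 2)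

theorem normalPDF_nonneg (x : ℝ) : 0 ≤ normalPDF x := by unfold normalPDF; positivity

theorem continuous_normalPDF : Continuous normalPDF := by unfold normalPDF; fun_prop

theorem gaussianReal_eq_withDensity :
    gaussianReal 0 1 = volume.withDensity fun x => ENNReal.ofReal (normalPDF x) := by
  rw [gaussianReal_of_var_ne_zero 0 one_ne_zero]
  congr 1
  funext x
  simp [gaussianPDF, gaussianPDFReal, normalPDF]

theorem lintegral_gaussianReal {f : ℝ → ℝ≥0∞} (hf : Measurable f) :
    ∫⁻ x, f x ∂(gaussianReal 0 1) = ∫⁻ x, ENNReal.ofReal (normalPDF x) * f x := by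
  rw [gaussianReal_eq_withDensity, lintegral_withDensity_eq_lintegral_mul _
    continuous_normalPDF.measurable.ennreal_ofReal hf]
  rfl

theorem inv_sqrt_two_pi_le_one : (√(2 * Real.pi))⁻¹ ≤ 1 := by
  apply inv_le_one_of_one_le₀
  rw [Real.one_le_sqrt]
  linarith [Real.pi_gt_three]

/-- The transition operator of the zig-zag angular momentum over a time step `h`, with at most one
switch per step. -/
def transition (h : ℝ) (f : ℝ → ℝ≥0∞) (x : ℝ) : ℝ≥0∞ :=
  f (x + h) * ENNReal.ofReal (Real.exp (-hazard x h)) +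
    ∫⁻ u in Set.Ioc 0 h,
      f (h - 2 * u - x) * ENNReal.ofReal (max (x + u) 0 * Real.exp (-hazard x u))

theorem measurable_jump_integrand {h : ℝ} {f : ℝ → ℝ≥0∞} (hf : Measurable f) :
    Measurable fun p : ℝ × ℝ =>
      f (h - 2 * p.2 - p.1) * ENNReal.ofReal (max (p.1 + p.2) 0 * Real.exp (-hazard p.1 p.2)) := by
  have := continuous_hazard.measurable
  fun_prop

theorem measurable_transition {h : ℝ} {f : ℝ → ℝ≥0∞} (hf : Measurable f) :
    Measurable (transition h f) := by
  have h1 : Measurable fun x : ℝ => hazard x h := by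
    have := continuous_hazard
    exact (this.comp (continuous_id.prodMk continuous_const)).measurable
  unfold transition
  refine Measurable.add (by fun_prop) ?_
  exact (measurable_jump_integrand hf).lintegral_prod_right'

theorem hasDerivAt_neg_exp_neg_hazard (x u : ℝ) :
    HasDerivAt (fun u => -Real.exp (-hazard x u))
      (max (x + u) 0 * Real.exp (-hazard x u)) u := by
  have := ((hasDerivAt_hazard x u).fun_neg.exp).fun_neg
  refine this.congr_deriv ?_
  ring

theorem lintegral_jump_density (x : ℝ) {h : ℝ} (hh : 0 ≤ h) :
    ∫⁻ u in Set.Ioc 0 h, ENNReal.ofReal (max (x + u) 0 * Real.exp (-hazard x u)) =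
      ENNReal.ofReal (1 - Real.exp (-hazard x h)) := by
  rw [lintegral_Ioc_ofReal_deriv hh (hasDerivAt_neg_exp_neg_hazard x)]
  · congr 1; simp; ring
  · have : Continuous fun u => hazard x u := continuous_hazard.comp (by fun_prop : Continuous fun u : ℝ => (x, u))
    fun_prop
  · intro u; positivity

/-- The survival probability and the mass of the first-switch density add up to one. This keeps test
functions bounded by one when `transition` is iterated. -/
theorem transition_one (x : ℝ) {h : ℝ} (hh : 0 ≤ h) : transition h (fun _ => 1) x = 1 := by
  unfold transition
  simp only [one_mul]
  rw [lintegral_jump_density x hh, ← ENNReal.ofReal_add (Real.exp_pos _).le]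
  · simp
  · have := hazard_nonneg (x := x) hh
    simp [this]

theorem transition_mono {h : ℝ} {f g : ℝ → ℝ≥0∞} (hfg : ∀ x, f x ≤ g x) (x : ℝ) :
    transition h f x ≤ transition h g x := by
  unfold transition
  gcongr <;> apply hfg

/-- Since (x⁺)² ≤ x², the two exponents combine to at most -((x + u)⁺)²/2, with equality for x ≥ 0.
The resulting bound depends on x + u alone. -/
theorem normalPDF_mul_jump_density_le (x u : ℝ) :
    normalPDF x * (max (x + u) 0 * Real.exp (-hazard x u)) ≤
      max (x + u) 0 * normalPDF (max (x + u) 0) := by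
  have h1 : Real.exp (-x ^ 2 / 2) * Real.exp (-hazard x u) ≤
      Real.exp (-(max (x + u) 0) ^ 2 / 2) := by
    rw [← Real.exp_add]
    apply Real.exp_le_exp.2
    unfold hazard halfSqPos
    have : (max x 0) ^ 2 ≤ x ^ 2 := by
      rcases le_total x 0 with h | h
      · rw [max_eq_right h]; nlinarith
      · rw [max_eq_left h]
    linarith
  unfold normalPDF
  have h2 : 0 ≤ max (x + u) 0 := le_max_right _ _
  have h3 : 0 ≤ (√(2 * Real.pi))⁻¹ := by positivity
  calc _ = (√(2 * Real.pi))⁻¹ * max (x + u) 0 *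
        (Real.exp (-x ^ 2 / 2) * Real.exp (-hazard x u)) := by ring
    _ ≤ (√(2 * Real.pi))⁻¹ * max (x + u) 0 * Real.exp (-(max (x + u) 0) ^ 2 / 2) := by gcongr
    _ = _ := by ring

/-- Makes the switching part of the density after a step an exact derivative in the switching time,
so that integrating over this time gives a difference of two normal densities. -/
theorem hasDerivAt_normalPDF_pos (c u : ℝ) :
    HasDerivAt (fun u => normalPDF (max (c - u) 0))
      (max (c - u) 0 * normalPDF (max (c - u) 0)) u := by
  have h1 : (fun u => normalPDF (max (c - u) 0)) =
      fun u => (√(2 * Real.pi))⁻¹ * Real.exp (-halfSqPos (c - u)) := by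
    funext u; unfold normalPDF halfSqPos; congr 2; ring
  have h2 := (hasDerivAt_halfSqPos (c - u)).comp u ((hasDerivAt_id u).const_sub c)
  have h3 := (h2.fun_neg.exp).const_mul (√(2 * Real.pi))⁻¹
  rw [h1]
  refine h3.congr_deriv ?_
  unfold normalPDF halfSqPos
  simp only [Function.comp]
  have : -(max (c - u) 0) ^ 2 / 2 = -((max (c - u) 0) ^ 2 / 2) := by ring
  simp only [this]
  ring

/-- The left side bounds the density at y after one step from N(0,1): arrival from y - h without a
switch, plus arrival after a switch. For y outside [0, h] the terms cancel to exactly the normal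
density. On [0, h] the excess is (2π)^(-1/2) (1 - e^(-(y-h)²/2)) (1 - e^(-y²/2)), where the last
factor is at most y²/2. -/
theorem density_bound {h : ℝ} (hh : 0 ≤ h) (y : ℝ) :
    normalPDF (y - h) * Real.exp (-hazard (y - h) h) +
      (normalPDF (max (h - y - h) 0) - normalPDF (max (h - y - 0) 0)) ≤
    normalPDF y + (Set.Icc 0 h).indicator (fun _ => h ^ 2) y := by
  unfold normalPDF hazard halfSqPos
  have hc0 : 0 ≤ (√(2 * Real.pi))⁻¹ := by positivity
  have hc1 := inv_sqrt_two_pi_le_one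
  set c := (√(2 * Real.pi))⁻¹
  rw [sub_add_cancel, sub_zero]
  have e1 : h - y - h = -y := by ring
  rw [e1]
  rcases lt_or_ge y 0 with hy | hy
  · rw [max_eq_right hy.le, max_eq_right (by linarith : y - h ≤ 0),
      max_eq_left (by linarith : 0 ≤ -y), max_eq_left (by linarith : 0 ≤ h - y),
      Set.indicator_of_notMem (by simp [hy])]
    have e2 : -(h - y) ^ 2 / 2 = -(y - h) ^ 2 / 2 := by ring
    rw [e2]
    simp
  · rw [max_eq_left hy, max_eq_right (by linarith : -y ≤ 0)]
    rcases le_or_gt y h with hyh | hyh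
    · rw [max_eq_right (by linarith : y - h ≤ 0), max_eq_left (by linarith : 0 ≤ h - y),
        Set.indicator_of_mem (Set.mem_Icc.2 ⟨hy, hyh⟩)]
      have e2 : -(h - y) ^ 2 / 2 = -(y - h) ^ 2 / 2 := by ring
      have e3 : -(y ^ 2 / 2 - 0 ^ 2 / 2) = -y ^ 2 / 2 := by ring
      rw [e2, e3]
      have h1 : Real.exp (-(y - h) ^ 2 / 2) ≤ 1 := Real.exp_le_one_iff.2 (by nlinarith [sq_nonneg (y-h)])
      have h2 : 1 - y ^ 2 / 2 ≤ Real.exp (-y ^ 2 / 2) := by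
        have := Real.add_one_le_exp (-y ^ 2 / 2); linarith
      have h3 : y ^ 2 ≤ h ^ 2 := by nlinarith
      have h4 : Real.exp (-y ^ 2 / 2) ≤ 1 := Real.exp_le_one_iff.2 (by nlinarith [sq_nonneg y])
      have h5 := Real.exp_pos (-(y - h) ^ 2 / 2)
      have e5 : Real.exp (-(0:ℝ) ^ 2 / 2) = 1 := by simp
      rw [e5]
      have key : (1 - Real.exp (-(y - h) ^ 2 / 2)) * (1 - Real.exp (-y ^ 2 / 2)) ≤ h ^ 2 := by
        nlinarith
      nlinarith
    · rw [max_eq_left (by linarith : 0 ≤ y - h), max_eq_right (by linarith : h - y ≤ 0),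
        Set.indicator_of_notMem (by simp [hyh])]
      have : c * Real.exp (-(y - h) ^ 2 / 2) * Real.exp (-(y ^ 2 / 2 - (y - h) ^ 2 / 2)) =
          c * Real.exp (-y ^ 2 / 2) := by
        rw [mul_assoc, ← Real.exp_add]; congr 2; ring
      rw [this]; simp

/-- The standard normal law is invariant under `transition h`, up to an error of order `h ^ 3`. -/
theorem lintegral_transition_le {h : ℝ} (hh : 0 ≤ h) {f : ℝ → ℝ≥0∞} (hf : Measurable f)
    (hf1 : ∀ x, f x ≤ 1) :
    ∫⁻ x, transition h f x ∂(gaussianReal 0 1) ≤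
      ∫⁻ x, f x ∂(gaussianReal 0 1) + ENNReal.ofReal (h ^ 3) := by
  have hφm : Measurable fun x => ENNReal.ofReal (normalPDF x) :=
    continuous_normalPDF.measurable.ennreal_ofReal
  have hφm' := continuous_normalPDF.measurable
  have hz := continuous_hazard.measurable
  have hz1 : Measurable fun x : ℝ => hazard x h :=
    (continuous_hazard.comp (continuous_id.prodMk continuous_const)).measurable
  have t1 : ∫⁻ x, ENNReal.ofReal (normalPDF x) *
      (f (x + h) * ENNReal.ofReal (Real.exp (-hazard x h))) =
      ∫⁻ y, f y * ENNReal.ofReal (normalPDF (y - h) * Real.exp (-hazard (y - h) h)) := by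
    -- Translation by h, so that the integration variable is the state after the step.
    rw [← lintegral_add_right_eq_self
      (fun y => f y * ENNReal.ofReal (normalPDF (y - h) * Real.exp (-hazard (y - h) h))) h]
    refine lintegral_congr fun x => ?_
    rw [add_sub_cancel_right, ENNReal.ofReal_mul (normalPDF_nonneg x)]
    ring
  have t2 : ∫⁻ x, ENNReal.ofReal (normalPDF x) * (∫⁻ u in Set.Ioc 0 h,
      f (h - 2 * u - x) * ENNReal.ofReal (max (x + u) 0 * Real.exp (-hazard x u))) ≤
      ∫⁻ y, f y * ENNReal.ofReal (normalPDF (max (h - y - h) 0) - normalPDF (max (h - y - 0) 0)) := by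
    calc _ ≤ ∫⁻ x, ∫⁻ u in Set.Ioc 0 h, f (h - 2 * u - x) *
          ENNReal.ofReal (max (x + u) 0 * normalPDF (max (x + u) 0)) := by
          refine lintegral_mono fun x => ?_
          rw [← lintegral_const_mul']
          swap; · exact ENNReal.ofReal_ne_top
          refine lintegral_mono fun u => ?_
          rw [mul_left_comm, ← ENNReal.ofReal_mul (normalPDF_nonneg x)]
          refine mul_le_mul_right (ENNReal.ofReal_le_ofReal ?_) _
          exact normalPDF_mul_jump_density_le x u
      _ = ∫⁻ u in Set.Ioc 0 h, ∫⁻ x, f (h - 2 * u - x) *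
          ENNReal.ofReal (max (x + u) 0 * normalPDF (max (x + u) 0)) := by
          refine lintegral_lintegral_swap ?_
          apply Measurable.aemeasurable
          simp only [Function.uncurry_def]
          fun_prop
      _ = ∫⁻ u in Set.Ioc 0 h, ∫⁻ y, f y *
          ENNReal.ofReal (max (h - y - u) 0 * normalPDF (max (h - y - u) 0)) := by
          refine lintegral_congr fun u => ?_
          -- Reflection to the state y = h - 2u - x after the step; the momentum x + u just before
          -- the switch becomes h - y - u.
          rw [← lintegral_sub_left_eq_self _ (h - 2 * u)]
          refine lintegral_congr fun x => ?_
          have e1 : h - 2 * u - (h - 2 * u - x) = x := by ring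
          have e2 : h - 2 * u - x + u = h - x - u := by ring
          rw [e1, e2]
      _ = ∫⁻ y, ∫⁻ u in Set.Ioc 0 h, f y *
          ENNReal.ofReal (max (h - y - u) 0 * normalPDF (max (h - y - u) 0)) := by
          refine lintegral_lintegral_swap ?_
          apply Measurable.aemeasurable
          simp only [Function.uncurry_def]
          fun_prop
      _ = _ := by
          refine lintegral_congr fun y => ?_
          rw [lintegral_const_mul _ (by fun_prop)]
          rw [lintegral_Ioc_ofReal_deriv hh (hasDerivAt_normalPDF_pos (h - y))]
          · have := continuous_normalPDF
            fun_prop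
          · intro u
            exact mul_nonneg (le_max_right _ _) (normalPDF_nonneg _)
  rw [lintegral_gaussianReal (measurable_transition hf), lintegral_gaussianReal hf]
  unfold transition
  simp_rw [mul_add]
  rw [lintegral_add_left (by fun_prop), t1]
  refine (add_le_add_right t2 _).trans ?_
  rw [← lintegral_add_left (by fun_prop)]
  calc _ ≤ ∫⁻ y, (ENNReal.ofReal (normalPDF y) * f y +
        (Set.Icc 0 h).indicator (fun _ => ENNReal.ofReal (h ^ 2)) y) := by
        refine lintegral_mono fun y => ?_
        have hn : 0 ≤ normalPDF (max (h - y - h) 0) - normalPDF (max (h - y - 0) 0) := by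
          rw [sub_nonneg]
          unfold normalPDF
          have : max (h - y - h) 0 ≤ max (h - y - 0) 0 := max_le_max_right 0 (by linarith)
          have h0 : 0 ≤ max (h - y - h) 0 := le_max_right _ _
          gcongr
        rw [← mul_add, ← ENNReal.ofReal_add
          (mul_nonneg (normalPDF_nonneg _) (Real.exp_pos _).le) hn]
        calc _ ≤ f y * ENNReal.ofReal
              (normalPDF y + (Set.Icc 0 h).indicator (fun _ => h ^ 2) y) := by
              exact mul_le_mul_right (ENNReal.ofReal_le_ofReal (density_bound hh y)) _
          _ = ENNReal.ofReal (normalPDF y) * f y +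
              f y * (Set.Icc 0 h).indicator (fun _ => ENNReal.ofReal (h ^ 2)) y := by
              rw [ENNReal.ofReal_add (normalPDF_nonneg _)
                (Set.indicator_nonneg (fun _ _ => sq_nonneg h) _), mul_add,
                mul_comm (f y) (ENNReal.ofReal (normalPDF y))]
              congr 2
              by_cases hy : y ∈ Set.Icc 0 h <;> simp [hy]
          _ ≤ _ := by
              gcongr
              exact mul_le_of_le_one_left' (hf1 y)
    _ = _ := by
        rw [lintegral_add_left (by fun_prop), lintegral_indicator measurableSet_Icc,
          setLIntegral_const, Real.volume_Icc, sub_zero, ← ENNReal.ofReal_mul (by positivity)]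
        congr 2

end OneStep

/-! ### The first switch in a time step, read off from the Poisson points -/

section FirstSwitch

/-- Lebesgue measure on the quadrant `[0, ∞) × [0, ∞)`, as a measure on the plane. -/
def quadrant : Measure (ℝ × ℝ) :=
  (volume.restrict (Set.Ici 0)).prod (volume.restrict (Set.Ici 0))

/-- The points with time in `(t, t + u]` below the line of slope one through `(t, x)`. -/
def wedge (t x u : ℝ) : Set (ℝ × ℝ) := {p | t < p.1 ∧ p.1 ≤ t + u ∧ p.2 ≤ x + (p.1 - t)}

theorem measurableSet_wedge (t x u : ℝ) : MeasurableSet (wedge t x u) := by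
  unfold wedge
  have h1 : MeasurableSet {p : ℝ × ℝ | t < p.1} := measurableSet_lt (by fun_prop) (by fun_prop)
  have h2 : MeasurableSet {p : ℝ × ℝ | p.1 ≤ t + u} :=
    measurableSet_le (by fun_prop) (by fun_prop)
  have h3 : MeasurableSet {p : ℝ × ℝ | p.2 ≤ x + (p.1 - t)} :=
    measurableSet_le (by fun_prop) (by fun_prop)
  exact h1.inter (h2.inter h3)

theorem wedge_mono (t : ℝ) {x y u v : ℝ} (hxy : x ≤ y) (huv : u ≤ v) :
    wedge t x u ⊆ wedge t y v := by
  rintro p ⟨h1, h2, h3⟩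
  exact ⟨h1, by linarith, by linarith⟩

theorem wedge_zero (t x : ℝ) : wedge t x 0 = ∅ := by
  ext p
  simp only [wedge, add_zero, Set.mem_ofPred_eq, Set.mem_empty_iff_false, iff_false]
  rintro ⟨h1, h2, -⟩
  linarith

/-- The vertical section at time s has length (x + s - t)⁺, the switching rate, and integrating it
over (t, t + u] gives the hazard. -/
theorem quadrant_wedge {t u : ℝ} (ht : 0 ≤ t) (hu : 0 ≤ u) (x : ℝ) :
    quadrant (wedge t x u) = ENNReal.ofReal (hazard x u) := by
  rw [quadrant, Measure.prod_apply (measurableSet_wedge t x u)]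
  have h1 : ∀ s : ℝ, volume.restrict (Set.Ici (0 : ℝ)) (Prod.mk s ⁻¹' wedge t x u) =
      (Set.Ioc t (t + u)).indicator (fun s => ENNReal.ofReal (max (x + (s - t)) 0)) s := by
    intro s
    by_cases hs : s ∈ Set.Ioc t (t + u)
    · rw [Set.indicator_of_mem hs]
      have : Prod.mk s ⁻¹' wedge t x u = Set.Iic (x + (s - t)) := by
        ext z
        simp only [wedge, Set.mem_preimage, Set.mem_ofPred_eq, Set.mem_Iic]
        exact ⟨fun h => h.2.2, fun h => ⟨hs.1, hs.2, h⟩⟩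
      rw [this, Measure.restrict_apply measurableSet_Iic, Set.inter_comm, Set.Ici_inter_Iic,
        Real.volume_Icc, sub_zero]
      rcases le_total (x + (s - t)) 0 with h | h
      · rw [max_eq_right h, ENNReal.ofReal_of_nonpos h, ENNReal.ofReal_zero]
      · rw [max_eq_left h]
    · rw [Set.indicator_of_notMem hs]
      have : Prod.mk s ⁻¹' wedge t x u = ∅ := by
        ext z
        simp only [wedge, Set.mem_preimage, Set.mem_ofPred_eq, Set.mem_empty_iff_false, iff_false]
        exact fun h => hs ⟨h.1, h.2.1⟩
      rw [this, measure_empty]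
  simp_rw [h1]
  rw [lintegral_indicator measurableSet_Ioc, Measure.restrict_restrict measurableSet_Ioc]
  have h2 : Set.Ioc t (t + u) ∩ Set.Ici 0 = Set.Ioc t (t + u) := by
    apply Set.inter_eq_left.2
    intro s hs
    exact ht.trans hs.1.le
  rw [h2, lintegral_Ioc_ofReal_deriv (G := fun s => halfSqPos (x + (s - t))) (by linarith)]
  · unfold hazard; simp
  · intro s
    have h := (hasDerivAt_halfSqPos (x + (s - t))).comp s
      (((hasDerivAt_id s).sub_const t).const_add x)
    simpa [Function.comp_def] using h
  · fun_prop
  · intro s; exact le_max_right _ _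

/-- There is a point of `ν` in `wedge t x u` (in the form of a right limit in `x`, which makes the
joint measurability evident). -/
def Fires (t x u : ℝ) (ν : Measure (ℝ × ℝ)) : Prop := ∀ q : ℚ, x < q → 1 ≤ ν (wedge t q u)

theorem Fires.mono {t x y u v : ℝ} {ν : Measure (ℝ × ℝ)} (h : Fires t x u ν) (hxy : x ≤ y)
    (huv : u ≤ v) : Fires t y v ν := fun q hq =>
  (h q (hxy.trans_lt hq)).trans (measure_mono (wedge_mono t le_rfl huv))

theorem fires_of_one_le {t x u : ℝ} {ν : Measure (ℝ × ℝ)} (h : 1 ≤ ν (wedge t x u)) :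
    Fires t x u ν := fun _ hq => h.trans (measure_mono (wedge_mono t hq.le le_rfl))

theorem not_fires_zero (t x : ℝ) (ν : Measure (ℝ × ℝ)) : ¬ Fires t x 0 ν := by
  intro h
  obtain ⟨q, hq⟩ := exists_rat_gt x
  have := h q hq
  rw [wedge_zero, measure_empty] at this
  exact absurd this (by simp)

theorem Fires.pos {t x u : ℝ} {ν : Measure (ℝ × ℝ)} (h : Fires t x u ν) : 0 < u := by
  by_contra hu
  exact not_fires_zero t x ν (h.mono le_rfl (not_lt.1 hu))

theorem measurableSet_fires (t u : ℝ) :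
    MeasurableSet {p : ℝ × Measure (ℝ × ℝ) | Fires t p.1 u p.2} := by
  have : {p : ℝ × Measure (ℝ × ℝ) | Fires t p.1 u p.2} =
      ⋂ q : ℚ, ({p | (q : ℝ) ≤ p.1} ∪ {p | 1 ≤ p.2 (wedge t q u)}) := by
    ext p
    simp only [Fires, Set.mem_ofPred_eq, Set.mem_iInter, Set.mem_union, or_iff_not_imp_left, not_le]
  rw [this]
  refine MeasurableSet.iInter fun q => (measurableSet_le (by fun_prop) (by fun_prop)).union ?_
  exact measurableSet_le measurable_const
    ((Measure.measurable_coe (measurableSet_wedge t q u)).comp measurable_snd)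

/-- The time from `t` until the first switch, capped at `h`. -/
def delay (t x h : ℝ) (ν : Measure (ℝ × ℝ)) : ℝ := sInf (insert h {u | 0 < u ∧ Fires t x u ν})

theorem bddBelow_delay_set {t x h : ℝ} (hh : 0 ≤ h) {ν : Measure (ℝ × ℝ)} :
    BddBelow (insert h {u | 0 < u ∧ Fires t x u ν}) := by
  refine ⟨0, ?_⟩
  rintro u (rfl | hu)
  · exact hh
  · exact hu.1.le

theorem delay_nonneg {t x h : ℝ} (hh : 0 ≤ h) (ν : Measure (ℝ × ℝ)) : 0 ≤ delay t x h ν := by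
  refine le_csInf (Set.insert_nonempty _ _) ?_
  rintro u (rfl | hu)
  · exact hh
  · exact hu.1.le

theorem delay_le {t x h : ℝ} (hh : 0 ≤ h) (ν : Measure (ℝ × ℝ)) : delay t x h ν ≤ h :=
  csInf_le (bddBelow_delay_set hh) (Set.mem_insert _ _)

theorem Fires.delay_le {t x h u : ℝ} (hh : 0 ≤ h) {ν : Measure (ℝ × ℝ)} (hu : Fires t x u ν) :
    delay t x h ν ≤ u :=
  csInf_le (bddBelow_delay_set hh) (Set.mem_insert_of_mem _ ⟨hu.pos, hu⟩)

/-- `Fires` is monotone in the time span, so strict bounds on the infimum can be tested at rational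
times. No attainment is needed, and measurability follows. -/
theorem delay_lt_iff {t x h b : ℝ} (hh : 0 ≤ h) {ν : Measure (ℝ × ℝ)} :
    delay t x h ν < b ↔ h < b ∨ ∃ q : ℚ, (q : ℝ) < b ∧ Fires t x q ν := by
  rw [delay, csInf_lt_iff (bddBelow_delay_set hh) (Set.insert_nonempty _ _)]
  constructor
  · rintro ⟨u, rfl | ⟨h0, hu⟩, hub⟩
    · exact Or.inl hub
    · obtain ⟨q, hq1, hq2⟩ := exists_rat_btwn hub
      exact Or.inr ⟨q, hq2, hu.mono le_rfl hq1.le⟩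
  · rintro (hb | ⟨q, hqb, hq⟩)
    · exact ⟨h, Set.mem_insert _ _, hb⟩
    · exact ⟨q, Set.mem_insert_of_mem _ ⟨hq.pos, hq⟩, hqb⟩

theorem measurable_delay (t : ℝ) {h : ℝ} (hh : 0 ≤ h) :
    Measurable fun p : ℝ × Measure (ℝ × ℝ) => delay t p.1 h p.2 := by
  refine measurable_of_Iio fun b => ?_
  have : (fun p : ℝ × Measure (ℝ × ℝ) => delay t p.1 h p.2) ⁻¹' Set.Iio b =
      {_p | h < b} ∪ ⋃ q : ℚ, ⋃ _ : (q : ℝ) < b, {p | Fires t p.1 q p.2} := by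
    ext p
    simp only [Set.mem_preimage, Set.mem_Iio, delay_lt_iff hh, Set.mem_union, Set.mem_ofPred_eq,
      Set.mem_iUnion, exists_prop]
  rw [this]
  exact (MeasurableSet.const _).union (MeasurableSet.iUnion fun q => MeasurableSet.iUnion fun _ =>
    measurableSet_fires t q)

variable {Ω : Type*} [MeasurableSpace Ω] {P : Measure Ω} [IsProbabilityMeasure P]
  {N : Ω → Measure (ℝ × ℝ)}

theorem measurableSet_fires_comp {X : Ω → ℝ} (hX : Measurable X) (hN : Measurable N) (t u : ℝ) :
    MeasurableSet {ω | Fires t (X ω) u (N ω)} :=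
  (hX.prodMk hN) (measurableSet_fires t u)

/-- A void probability of the wedge; the right limit built into `Fires` changes nothing because the
hazard is continuous in x. -/
theorem measure_fires (hN : IsPoissonRandomMeasure N quadrant P) {t u : ℝ} (ht : 0 ≤ t)
    (hu : 0 ≤ u) (x : ℝ) :
    P {ω | Fires t x u (N ω)} = ENNReal.ofReal (1 - Real.exp (-hazard x u)) := by
  have hw : ∀ y, P {ω | 1 ≤ N ω (wedge t y u)} =
      ENNReal.ofReal (1 - Real.exp (-hazard y u)) := by
    intro y
    rw [hN.measure_one_le (measurableSet_wedge t y u), quadrant_wedge ht hu,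
      ENNReal.toReal_ofReal (hazard_nonneg hu)]
    rw [quadrant_wedge ht hu]
    exact ENNReal.ofReal_ne_top
  apply le_antisymm
  · have hcont : Continuous fun y => ENNReal.ofReal (1 - Real.exp (-hazard y u)) := by
      have : Continuous fun y => hazard y u :=
        continuous_hazard.comp (continuous_id.prodMk continuous_const)
      exact ENNReal.continuous_ofReal.comp (by fun_prop)
    refine ge_of_tendsto (hcont.continuousWithinAt (s := Set.Ioi x) (x := x)) ?_
    filter_upwards [self_mem_nhdsWithin] with y hy
    obtain ⟨q, hq1, hq2⟩ := exists_rat_btwn (Set.mem_Ioi.1 hy)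
    refine le_trans (measure_mono fun ω hω => ?_) (hw y).le
    exact (hω q hq1).trans (measure_mono (wedge_mono t hq2.le le_rfl))
  · rw [← hw x]
    exact measure_mono fun ω hω => fires_of_one_le hω

/-- It suffices to compare half-lines. For 0 ≤ b < h, a delay of at most b is implied by firing
within b and implies firing within every y > b, and the probabilities of the latter are continuous
in y. -/
theorem map_delay (hN : IsPoissonRandomMeasure N quadrant P) {t h : ℝ} (ht : 0 ≤ t)
    (hh : 0 ≤ h) (x : ℝ) :
    (P.restrict {ω | Fires t x h (N ω)}).map (fun ω => delay t x h (N ω)) =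
      (volume.restrict (Set.Ioc 0 h)).withDensity
        fun u => ENNReal.ofReal (max (x + u) 0 * Real.exp (-hazard x u)) := by
  have hmd : Measurable fun ω => delay t x h (N ω) :=
    (measurable_delay t hh).comp (measurable_const.prodMk hN.measurable)
  have hz : Continuous fun u => hazard x u :=
    continuous_hazard.comp (continuous_const.prodMk continuous_id)
  have hA : MeasurableSet {ω | Fires t x h (N ω)} :=
    measurableSet_fires_comp measurable_const hN.measurable t h
  refine Measure.ext_of_Iic _ _ fun b => ?_
  rw [Measure.map_apply hmd measurableSet_Iic, Measure.restrict_apply (hmd measurableSet_Iic),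
    withDensity_apply _ measurableSet_Iic, Measure.restrict_restrict measurableSet_Iic,
    Set.inter_comm (Set.Iic b), Set.Ioc_inter_Iic]
  rcases lt_or_ge b 0 with hb | hb
  · have h1 : (fun ω => delay t x h (N ω)) ⁻¹' Set.Iic b ∩ {ω | Fires t x h (N ω)} = ∅ := by
      ext ω
      simp only [Set.mem_inter_iff, Set.mem_preimage, Set.mem_Iic, Set.mem_empty_iff_false,
        iff_false, not_and]
      intro h2
      linarith [delay_nonneg (t := t) (x := x) hh (N ω)]
    rw [h1, Set.Ioc_eq_empty (by simp [hb.le])]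
    simp
  rw [lintegral_jump_density x (le_min hh hb)]
  rcases le_or_gt h b with hhb | hhb
  · rw [min_eq_left hhb, ← measure_fires hN ht hh x]
    congr 1
    ext ω
    simp only [Set.mem_inter_iff, Set.mem_preimage, Set.mem_Iic, and_iff_right_iff_imp]
    exact fun _ => (delay_le hh _).trans hhb
  · rw [min_eq_right hhb.le]
    apply le_antisymm
    · have hcont : Continuous fun y => ENNReal.ofReal (1 - Real.exp (-hazard x y)) :=
        ENNReal.continuous_ofReal.comp (by fun_prop)
      refine ge_of_tendsto (hcont.continuousWithinAt (s := Set.Ioi b) (x := b)) ?_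
      have hm : Set.Ioo b h ∈ 𝓝[>] b := Ioo_mem_nhdsGT hhb
      filter_upwards [hm] with y hy
      rw [← measure_fires hN ht (hb.trans hy.1.le) x]
      refine measure_mono fun ω hω => ?_
      have h1 : delay t x h (N ω) < y := lt_of_le_of_lt hω.1 hy.1
      rcases (delay_lt_iff hh).1 h1 with h2 | ⟨q, hq1, hq2⟩
      · exact absurd h2 (not_lt.2 hy.2.le)
      · exact hq2.mono le_rfl hq1.le
    · rw [← measure_fires hN ht hb x]
      refine measure_mono fun ω hω => ⟨?_, ?_⟩
      · exact Fires.delay_le hh hω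
      · exact Fires.mono hω le_rfl hhb.le

open Classical in
/-- The value at time `t + h` of the angular momentum process started in `x` at time `t` and driven
by `ν`, if it switches at most once. -/
def step (h t x : ℝ) (ν : Measure (ℝ × ℝ)) : ℝ :=
  if Fires t x h ν then h - 2 * delay t x h ν - x else x + h

theorem step_of_fires {h t x : ℝ} {ν : Measure (ℝ × ℝ)} (hf : Fires t x h ν) :
    step h t x ν = h - 2 * delay t x h ν - x := if_pos hf

theorem step_of_not_fires {h t x : ℝ} {ν : Measure (ℝ × ℝ)} (hf : ¬ Fires t x h ν) :
    step h t x ν = x + h := if_neg hf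

theorem measurable_step {h : ℝ} (hh : 0 ≤ h) (t : ℝ) :
    Measurable fun p : ℝ × Measure (ℝ × ℝ) => step h t p.1 p.2 := by
  have := measurable_delay t hh
  exact Measurable.ite (measurableSet_fires t h) (by fun_prop) (by fun_prop)

theorem abs_step_le {h : ℝ} (hh : 0 ≤ h) (t x : ℝ) (ν : Measure (ℝ × ℝ)) :
    |step h t x ν| ≤ |x| + h := by
  unfold step
  have h1 := delay_nonneg (t := t) (x := x) hh ν
  have h2 := delay_le (t := t) (x := x) hh ν
  have h3 := neg_abs_le x
  have h4 := le_abs_self x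
  split_ifs <;> rw [abs_le] <;> constructor <;> linarith

/-- Without a firing the new state is deterministic; on the firing event `map_delay` supplies the
law of the delay. These are the two summands of `transition`. -/
theorem lintegral_step (hN : IsPoissonRandomMeasure N quadrant P) {t h : ℝ} (ht : 0 ≤ t)
    (hh : 0 ≤ h) (x : ℝ) {f : ℝ → ℝ≥0∞} (hf : Measurable f) :
    ∫⁻ ω, f (step h t x (N ω)) ∂P = transition h f x := by
  have hA : MeasurableSet {ω | Fires t x h (N ω)} :=
    measurableSet_fires_comp measurable_const hN.measurable t h
  have hmd : Measurable fun ω => delay t x h (N ω) :=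
    (measurable_delay t hh).comp (measurable_const.prodMk hN.measurable)
  have hz : Measurable fun u => hazard x u :=
    (continuous_hazard.comp (continuous_const.prodMk continuous_id)).measurable
  rw [← lintegral_add_compl _ hA, add_comm]
  unfold transition
  congr 1
  · rw [setLIntegral_congr_fun (g := fun _ => f (x + h)) hA.compl (fun ω hω => by
      simp only [step_of_not_fires (show ¬ Fires t x h (N ω) from hω)])]
    rw [setLIntegral_const, prob_compl_eq_one_sub hA, measure_fires hN ht hh,
      ENNReal.ofReal_sub _ (Real.exp_pos _).le, ENNReal.ofReal_one, ENNReal.sub_sub_cancel]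
    · simp
    · rw [ENNReal.ofReal_le_one, Real.exp_le_one_iff]
      linarith [hazard_nonneg (x := x) hh]
  · rw [setLIntegral_congr_fun (g := fun ω => f (h - 2 * delay t x h (N ω) - x)) hA (fun ω hω => by
      simp only [step_of_fires (show Fires t x h (N ω) from hω)])]
    have := lintegral_map (μ := P.restrict {ω | Fires t x h (N ω)})
      (f := fun u => f (h - 2 * u - x)) (by fun_prop) hmd
    rw [← this, map_delay hN ht hh, lintegral_withDensity_eq_lintegral_mul _ (by fun_prop)
      (by fun_prop)]
    refine lintegral_congr fun u => ?_
    simp only [Pi.mul_apply]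
    ring

end FirstSwitch

/-! ### The discretised momentum chain and its Markov property -/

section Chain

/-- The points with time at most `s`. -/
def timesLE (s : ℝ) : Set (ℝ × ℝ) := {p | p.1 ≤ s}

/-- The points with time greater than `s`. -/
def timesGT (s : ℝ) : Set (ℝ × ℝ) := {p | s < p.1}

theorem measurableSet_timesLE (s : ℝ) : MeasurableSet (timesLE s) :=
  measurableSet_le measurable_fst measurable_const

theorem measurableSet_timesGT (s : ℝ) : MeasurableSet (timesGT s) :=
  measurableSet_lt measurable_const measurable_fst

theorem disjoint_timesLE_timesGT (s : ℝ) : Disjoint (timesLE s) (timesGT s) :=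
  Set.disjoint_left.2 fun p (h1 : p.1 ≤ s) (h2 : s < p.1) => not_lt.2 h1 h2

/-- The restriction lemmas localise the dependence on the driving measure: a step uses only points
in (t, t + h], so `chain` at index k sees only the past of time k h and the next step only the
future. -/
theorem fires_restrict {t x u : ℝ} {U : Set (ℝ × ℝ)} (hU : ∀ y, wedge t y u ⊆ U)
    (ν : Measure (ℝ × ℝ)) : Fires t x u (ν.restrict U) ↔ Fires t x u ν := by
  unfold Fires
  simp only [Measure.restrict_eq_self _ (hU _)]

theorem delay_restrict {t x h : ℝ} (hh : 0 ≤ h) {U : Set (ℝ × ℝ)} (hU : ∀ y, wedge t y h ⊆ U)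
    (ν : Measure (ℝ × ℝ)) : delay t x h (ν.restrict U) = delay t x h ν := by
  refine eq_of_forall_gt_iff fun b => ?_
  rw [delay_lt_iff hh, delay_lt_iff hh]
  refine or_congr_right' fun hb => exists_congr fun q => and_congr_right fun hq => ?_
  exact fires_restrict (fun y => (wedge_mono t le_rfl (hq.le.trans (not_lt.1 hb))).trans (hU y)) ν

open Classical in
theorem step_restrict {t x h : ℝ} (hh : 0 ≤ h) {U : Set (ℝ × ℝ)} (hU : ∀ y, wedge t y h ⊆ U)
    (ν : Measure (ℝ × ℝ)) : step h t x (ν.restrict U) = step h t x ν := by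
  unfold step
  rw [delay_restrict hh hU]
  simp only [fires_restrict hU]

theorem wedge_subset_timesLE {t u s : ℝ} (h : t + u ≤ s) (y : ℝ) : wedge t y u ⊆ timesLE s :=
  fun _ hp => hp.2.1.trans h

theorem wedge_subset_timesGT (t y u : ℝ) : wedge t y u ⊆ timesGT t := fun _ hp => hp.1

/-- The skeleton at the times `k * h` of the angular momentum process with at most one switch per
time step. -/
def chain (h x : ℝ) (ν : Measure (ℝ × ℝ)) : ℕ → ℝ
  | 0 => x
  | k + 1 => step h (k * h) (chain h x ν k) ν

open Classical in
/-- The number of the first `n` time steps in which `chain` switches. -/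
def switchCount (h x : ℝ) (ν : Measure (ℝ × ℝ)) (n : ℕ) : ℕ :=
  ∑ k ∈ Finset.range n, if Fires (k * h) (chain h x ν k) h ν then 1 else 0

theorem chain_restrict {h : ℝ} (hh : 0 ≤ h) (x : ℝ) (ν : Measure (ℝ × ℝ)) {s : ℝ} {k : ℕ}
    (hk : k * h ≤ s) : chain h x (ν.restrict (timesLE s)) k = chain h x ν k := by
  induction k with
  | zero => rfl
  | succ k ih =>
    push_cast at hk
    have hk' : k * h + h ≤ s := by linarith
    rw [chain, chain, ih (by linarith), step_restrict hh (wedge_subset_timesLE hk')]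

open Classical in
theorem switchCount_restrict {h : ℝ} (hh : 0 ≤ h) (x : ℝ) (ν : Measure (ℝ × ℝ)) {s : ℝ} {n : ℕ}
    (hn : n * h ≤ s) :
    switchCount h x (ν.restrict (timesLE s)) n = switchCount h x ν n := by
  refine Finset.sum_congr rfl fun k hk => ?_
  have h1 : (k : ℝ) + 1 ≤ n := by exact_mod_cast Finset.mem_range.1 hk
  have h2 : k * h + h ≤ s := by nlinarith
  rw [chain_restrict hh x ν (by linarith : k * h ≤ s)]
  simp only [fires_restrict (wedge_subset_timesLE h2)]

theorem measurable_chain {h : ℝ} (hh : 0 ≤ h) (k : ℕ) :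
    Measurable fun p : ℝ × Measure (ℝ × ℝ) => chain h p.1 p.2 k := by
  induction k with
  | zero => exact measurable_fst
  | succ k ih => exact (measurable_step hh (k * h)).comp (ih.prodMk measurable_snd)

theorem measurableSet_fires_chain {h : ℝ} (hh : 0 ≤ h) (k : ℕ) :
    MeasurableSet {p : ℝ × Measure (ℝ × ℝ) | Fires (k * h) (chain h p.1 p.2 k) h p.2} :=
  ((measurable_chain hh k).prodMk measurable_snd) (measurableSet_fires (k * h) h)

theorem measurable_switchCount {h : ℝ} (hh : 0 ≤ h) (n : ℕ) :
    Measurable fun p : ℝ × Measure (ℝ × ℝ) => switchCount h p.1 p.2 n :=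
  Finset.measurable_fun_sum _ fun k _ =>
    Measurable.ite (measurableSet_fires_chain hh k) measurable_const measurable_const

theorem abs_chain_le {h : ℝ} (hh : 0 ≤ h) (x : ℝ) (ν : Measure (ℝ × ℝ)) (k : ℕ) :
    |chain h x ν k| ≤ |x| + k * h := by
  induction k with
  | zero => simp [chain]
  | succ k ih =>
    rw [chain]
    push_cast
    linarith [abs_step_le hh (k * h) (chain h x ν k) ν]

theorem switchCount_le (h x : ℝ) (ν : Measure (ℝ × ℝ)) (n : ℕ) : switchCount h x ν n ≤ n := by
  calc switchCount h x ν n ≤ ∑ k ∈ Finset.range n, 1 :=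
        Finset.sum_le_sum fun k _ => by split_ifs <;> simp
    _ = n := by simp

variable {Ω : Type*} [MeasurableSpace Ω]

/-- A standard normal starting point with an independent driving Poisson random measure. -/
structure IsStationaryInput (P : Measure Ω) (X : Ω → ℝ) (N : Ω → Measure (ℝ × ℝ)) : Prop where
  measurable : Measurable X
  map_eq : P.map X = gaussianReal 0 1
  poisson : IsPoissonRandomMeasure N quadrant P
  indep : IndepFun X N P

variable {P : Measure Ω} [IsProbabilityMeasure P] {X : Ω → ℝ} {N : Ω → Measure (ℝ × ℝ)}

omit [IsProbabilityMeasure P] in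
theorem IsStationaryInput.measurable_prod (hI : IsStationaryInput P X N) :
    Measurable fun ω => (X ω, N ω) := hI.measurable.prodMk hI.poisson.measurable

/-- The law of the triple is a product of three measures, which may be reassociated. -/
theorem IndepFun.prodMk_of_indepFun {α β γ : Type*} [MeasurableSpace α] [MeasurableSpace β]
    [MeasurableSpace γ] {A : Ω → α} {B : Ω → β} {C : Ω → γ} (hA : Measurable A)
    (hB : Measurable B) (hC : Measurable C) (h : IndepFun A (fun ω => (B ω, C ω)) P)
    (hBC : IndepFun B C P) : IndepFun (fun ω => (A ω, B ω)) C P := by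
  have hAB : IndepFun A B P := h.comp measurable_id measurable_fst
  have : IsProbabilityMeasure (P.map A) := Measure.isProbabilityMeasure_map hA.aemeasurable
  have : IsProbabilityMeasure (P.map B) := Measure.isProbabilityMeasure_map hB.aemeasurable
  have : IsProbabilityMeasure (P.map C) := Measure.isProbabilityMeasure_map hC.aemeasurable
  rw [indepFun_iff_map_prod_eq_prod_map_map (by fun_prop) (by fun_prop)] at *
  rw [hBC] at h
  rw [hAB]
  apply MeasurableEquiv.prodAssoc.map_measurableEquiv_injective
  rw [Measure.prodAssoc_prod, ← h, Measure.map_map (by fun_prop) (by fun_prop)]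
  rfl

/-- The past up to time `s` and the future after time `s` of the input are independent. -/
theorem IsStationaryInput.lintegral_past_mul_future (hI : IsStationaryInput P X N) {s : ℝ}
    {z : ℝ × Measure (ℝ × ℝ) → ℝ≥0∞} (hz : Measurable z)
    (hz' : ∀ x ν, z (x, ν.restrict (timesLE s)) = z (x, ν))
    {y : ℝ × Measure (ℝ × ℝ) → ℝ} (hy : Measurable y)
    (hy' : ∀ x ν, y (x, ν.restrict (timesLE s)) = y (x, ν))
    {Φ : ℝ × Measure (ℝ × ℝ) → ℝ≥0∞} (hΦ : Measurable Φ)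
    (hΦ' : ∀ x ν, Φ (x, ν.restrict (timesGT s)) = Φ (x, ν)) :
    ∫⁻ ω, z (X ω, N ω) * Φ (y (X ω, N ω), N ω) ∂P =
      ∫⁻ ω, z (X ω, N ω) * ∫⁻ ω', Φ (y (X ω, N ω), N ω') ∂P ∂P := by
  have hX := hI.measurable
  have hN := hI.poisson.measurable
  have hL : Measurable fun ω => (N ω).restrict (timesLE s) :=
    (measurable_restrict (measurableSet_timesLE s)).comp hN
  have hG : Measurable fun ω => (N ω).restrict (timesGT s) :=
    (measurable_restrict (measurableSet_timesGT s)).comp hN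
  have hA : Measurable fun ω => (X ω, (N ω).restrict (timesLE s)) := hX.prodMk hL
  -- `X` is independent of the whole of `N`, and the two parts of `N` are independent of each other.
  have hind : IndepFun (fun ω => (X ω, (N ω).restrict (timesLE s)))
      (fun ω => (N ω).restrict (timesGT s)) P := by
    refine IndepFun.prodMk_of_indepFun hX hL hG ?_ (hI.poisson.indepFun_restrict
      (measurableSet_timesLE s) (measurableSet_timesGT s) (disjoint_timesLE_timesGT s))
    exact hI.indep.comp (φ := id)
      (ψ := fun ν : Measure (ℝ × ℝ) => (ν.restrict (timesLE s), ν.restrict (timesGT s)))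
      measurable_id ((measurable_restrict (measurableSet_timesLE s)).prodMk
        (measurable_restrict (measurableSet_timesGT s)))
  have : IsProbabilityMeasure (P.map fun ω => (N ω).restrict (timesGT s)) :=
    Measure.isProbabilityMeasure_map hG.aemeasurable
  have : IsProbabilityMeasure (P.map fun ω => (X ω, (N ω).restrict (timesLE s))) :=
    Measure.isProbabilityMeasure_map hA.aemeasurable
  have hH : Measurable fun p : (ℝ × Measure (ℝ × ℝ)) × Measure (ℝ × ℝ) =>
      z p.1 * Φ (y p.1, p.2) := by fun_prop
  calc _ = ∫⁻ ω, z (X ω, (N ω).restrict (timesLE s)) *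
        Φ (y (X ω, (N ω).restrict (timesLE s)), (N ω).restrict (timesGT s)) ∂P := by
        simp only [hz', hy', hΦ']
    _ = ∫⁻ p, z p.1 * Φ (y p.1, p.2) ∂(P.map fun ω =>
        ((X ω, (N ω).restrict (timesLE s)), (N ω).restrict (timesGT s))) := by
        rw [lintegral_map hH (hA.prodMk hG)]
    _ = ∫⁻ a, ∫⁻ b, z a * Φ (y a, b) ∂(P.map fun ω => (N ω).restrict (timesGT s))
        ∂(P.map fun ω => (X ω, (N ω).restrict (timesLE s))) := by
        rw [(indepFun_iff_map_prod_eq_prod_map_map hA.aemeasurable hG.aemeasurable).1 hind,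
          lintegral_prod _ hH.aemeasurable]
    _ = ∫⁻ ω, ∫⁻ ω', z (X ω, (N ω).restrict (timesLE s)) *
        Φ (y (X ω, (N ω).restrict (timesLE s)), (N ω').restrict (timesGT s)) ∂P ∂P := by
        rw [lintegral_map hH.lintegral_prod_right' hA]
        refine lintegral_congr fun ω => ?_
        rw [lintegral_map (by fun_prop) hG]
    _ = _ := by
        simp only [hz', hy', hΦ']
        refine lintegral_congr fun ω => ?_
        rw [lintegral_const_mul _ (by fun_prop)]

/-- Markov property at time k h. -/
theorem IsStationaryInput.lintegral_chain_succ (hI : IsStationaryInput P X N) {h : ℝ}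
    (hh : 0 ≤ h) (k : ℕ) {f : ℝ → ℝ≥0∞} (hf : Measurable f) :
    ∫⁻ ω, f (chain h (X ω) (N ω) (k + 1)) ∂P =
      ∫⁻ ω, transition h f (chain h (X ω) (N ω) k) ∂P := by
  have := hI.lintegral_past_mul_future (s := k * h) (z := fun _ => 1) measurable_const
    (fun _ _ => rfl) (y := fun p => chain h p.1 p.2 k) (measurable_chain hh k)
    (fun x ν => chain_restrict hh x ν le_rfl) (Φ := fun p => f (step h (k * h) p.1 p.2))
    (hf.comp (measurable_step hh (k * h)))
    (fun x ν => by rw [step_restrict hh (fun y => wedge_subset_timesGT _ y h)])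
  simp only [one_mul] at this
  refine this.trans (lintegral_congr fun ω => ?_)
  exact lintegral_step hI.poisson (by positivity) hh _ hf

/-- The errors h³ of the single steps add up. The induction moves the last step onto the test
function, which remains bounded by one. -/
theorem IsStationaryInput.lintegral_chain_le (hI : IsStationaryInput P X N) {h : ℝ}
    (hh : 0 ≤ h) (k : ℕ) {f : ℝ → ℝ≥0∞} (hf : Measurable f) (hf1 : ∀ x, f x ≤ 1) :
    ∫⁻ ω, f (chain h (X ω) (N ω) k) ∂P ≤
      ∫⁻ x, f x ∂(gaussianReal 0 1) + k * ENNReal.ofReal (h ^ 3) := by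
  induction k generalizing f with
  | zero =>
    rw [← hI.map_eq, lintegral_map hf hI.measurable]
    simp [chain]
  | succ k ih =>
    rw [hI.lintegral_chain_succ hh k hf]
    have h1 : ∀ x, transition h f x ≤ 1 := fun x =>
      (transition_mono hf1 x).trans (transition_one x hh).le
    refine (ih (measurable_transition hf) h1).trans ?_
    refine (add_le_add_left (lintegral_transition_le hh hf hf1) _).trans (le_of_eq ?_)
    push_cast
    ring

/-- The skeleton stays close to its stationary distribution in total variation. -/
theorem IsStationaryInput.integral_chain_le (hI : IsStationaryInput P X N) {h : ℝ}
    (hh : 0 ≤ h) (k : ℕ) {f : ℝ → ℝ} (hf : Measurable f) (hf0 : ∀ x, 0 ≤ f x)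
    (hf1 : ∀ x, f x ≤ 1) :
    ∫ ω, f (chain h (X ω) (N ω) k) ∂P ≤ ∫ x, f x ∂(gaussianReal 0 1) + k * h ^ 3 := by
  have hm : Measurable fun ω => chain h (X ω) (N ω) k :=
    (measurable_chain hh k).comp hI.measurable_prod
  have key := hI.lintegral_chain_le hh k hf.ennreal_ofReal
    (fun x => ENNReal.ofReal_le_one.2 (hf1 x))
  have hint : Integrable f (gaussianReal 0 1) :=
    Integrable.of_bound hf.aestronglyMeasurable 1
      (Eventually.of_forall fun x => by rw [Real.norm_of_nonneg (hf0 x)]; exact hf1 x)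
  have hint' : Integrable (fun ω => f (chain h (X ω) (N ω) k)) P :=
    Integrable.of_bound (hf.comp hm).aestronglyMeasurable 1
      (Eventually.of_forall fun x => by rw [Real.norm_of_nonneg (hf0 _)]; exact hf1 _)
  rw [← ofReal_integral_eq_lintegral_ofReal hint' (Eventually.of_forall fun _ => hf0 _),
    ← ofReal_integral_eq_lintegral_ofReal hint (Eventually.of_forall hf0),
    ← ENNReal.ofReal_natCast, ← ENNReal.ofReal_mul (by positivity),
    ← ENNReal.ofReal_add (integral_nonneg fun x => hf0 x) (by positivity)] at key
  exact (ENNReal.ofReal_le_ofReal_iff (by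
    have : 0 ≤ ∫ x, f x ∂(gaussianReal 0 1) := integral_nonneg fun x => hf0 x
    positivity)).1 key

theorem IsStationaryInput.abs_integral_chain_sub_le (hI : IsStationaryInput P X N) {h : ℝ}
    (hh : 0 ≤ h) (k : ℕ) {f : ℝ → ℝ} (hf : Measurable f) (hf0 : ∀ x, 0 ≤ f x)
    (hf1 : ∀ x, f x ≤ 1) :
    |∫ ω, f (chain h (X ω) (N ω) k) ∂P - ∫ x, f x ∂(gaussianReal 0 1)| ≤ k * h ^ 3 := by
  have hm : Measurable fun ω => chain h (X ω) (N ω) k :=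
    (measurable_chain hh k).comp hI.measurable_prod
  have hint : Integrable f (gaussianReal 0 1) :=
    Integrable.of_bound hf.aestronglyMeasurable 1
      (Eventually.of_forall fun x => by rw [Real.norm_of_nonneg (hf0 x)]; exact hf1 x)
  have hint' : Integrable (fun ω => f (chain h (X ω) (N ω) k)) P :=
    Integrable.of_bound (hf.comp hm).aestronglyMeasurable 1
      (Eventually.of_forall fun x => by rw [Real.norm_of_nonneg (hf0 _)]; exact hf1 _)
  have h1 := hI.integral_chain_le hh k hf hf0 hf1
  -- Both laws have mass one, so the upper bound for 1 - f is the lower bound for f.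
  have h2 := hI.integral_chain_le hh k (f := fun x => 1 - f x) (hf.const_sub 1)
    (fun x => sub_nonneg.2 (hf1 x)) (fun x => by linarith [hf0 x])
  rw [integral_sub (integrable_const _) hint, integral_sub (integrable_const _) hint'] at h2
  simp only [integral_const, probReal_univ, smul_eq_mul, one_mul] at h2
  rw [abs_le]
  constructor <;> linarith

/-- The probability of a switch in a time step of length `h`. -/
def switchProb (h x : ℝ) : ℝ := 1 - Real.exp (-hazard x h)

theorem measurable_switchProb (h : ℝ) : Measurable (switchProb h) := by
  have : Measurable fun x => hazard x h :=
    (continuous_hazard.comp (continuous_id.prodMk continuous_const)).measurable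
  unfold switchProb
  fun_prop

theorem switchProb_nonneg {h : ℝ} (hh : 0 ≤ h) (x : ℝ) : 0 ≤ switchProb h x := by
  rw [switchProb, sub_nonneg, Real.exp_le_one_iff]
  linarith [hazard_nonneg (x := x) hh]

theorem switchProb_le_one (h x : ℝ) : switchProb h x ≤ 1 := by
  rw [switchProb]; linarith [Real.exp_pos (-hazard x h)]

theorem switchProb_le_hazard (h x : ℝ) : switchProb h x ≤ hazard x h := by
  rw [switchProb]; linarith [Real.add_one_le_exp (-hazard x h)]

-- Given the past, step k fires with probability `switchProb` at the current state; z is an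
-- arbitrary weight known at time k h.
open Classical in
theorem IsStationaryInput.lintegral_mul_fires (hI : IsStationaryInput P X N) {h : ℝ}
    (hh : 0 ≤ h) (k : ℕ) {z : ℝ × Measure (ℝ × ℝ) → ℝ≥0∞} (hz : Measurable z)
    (hz' : ∀ x ν, z (x, ν.restrict (timesLE (k * h))) = z (x, ν)) :
    ∫⁻ ω, z (X ω, N ω) * (if Fires (k * h) (chain h (X ω) (N ω) k) h (N ω) then 1 else 0) ∂P =
      ∫⁻ ω, z (X ω, N ω) * ENNReal.ofReal (switchProb h (chain h (X ω) (N ω) k)) ∂P := by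
  have := hI.lintegral_past_mul_future (s := k * h) hz hz'
    (y := fun p => chain h p.1 p.2 k) (measurable_chain hh k)
    (fun x ν => chain_restrict hh x ν le_rfl)
    (Φ := fun p => if Fires (k * h) p.1 h p.2 then 1 else 0)
    (Measurable.ite (measurableSet_fires _ _) measurable_const measurable_const)
    (fun x ν => by simp only [fires_restrict (fun y => wedge_subset_timesGT _ y h)])
  refine this.trans (lintegral_congr fun ω => ?_)
  congr 1
  rw [switchProb, ← measure_fires hI.poisson (t := k * h) (by positivity) hh, ← lintegral_indicator_one
    (measurableSet_fires_comp measurable_const hI.poisson.measurable _ _)]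
  refine lintegral_congr fun ω' => ?_
  simp [Set.indicator_apply]

end Chain

/-! ### Mean and second moment of the number of switches -/

section Moments

theorem integrable_abs_add_sq (T : ℝ) :
    Integrable (fun x : ℝ => (|x| + T) ^ 2) (gaussianReal 0 1) := by
  have h1 : MemLp (fun x : ℝ => x) 2 (gaussianReal 0 1) := memLp_id_gaussianReal 2
  have h2 : MemLp (fun x : ℝ => |x| + T) 2 (gaussianReal 0 1) :=
    (h1.norm).add (memLp_const T)
  exact h2.integrable_sq

/-- The normal density φ satisfies φ'(x) = -x φ(x), so the integral over the half-line is φ(0). This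
is the constant of the limit. -/
theorem integral_max_gaussianReal :
    ∫ x, max x 0 ∂(gaussianReal 0 1) = (√(2 * Real.pi))⁻¹ := by
  rw [integral_eq_lintegral_of_nonneg_ae (Eventually.of_forall fun x => le_max_right x 0)
    (by fun_prop), lintegral_gaussianReal (by fun_prop)]
  have h1 : ∀ x : ℝ, ENNReal.ofReal (normalPDF x) * ENNReal.ofReal (max x 0) =
      (Set.Ioi 0).indicator (fun x => ENNReal.ofReal (x * normalPDF x)) x := by
    intro x
    rw [← ENNReal.ofReal_mul (normalPDF_nonneg x)]
    rcases le_or_gt x 0 with hx | hx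
    · simp [hx]
    · rw [max_eq_left hx.le, Set.indicator_of_mem (Set.mem_Ioi.2 hx), mul_comm]
  simp_rw [h1]
  rw [lintegral_indicator measurableSet_Ioi]
  have hd : ∀ x ∈ Set.Ici (0 : ℝ), HasDerivAt (fun x => -normalPDF x) (x * normalPDF x) x := by
    intro x _
    unfold normalPDF
    have h2 : HasDerivAt (fun x : ℝ => -x ^ 2 / 2) (-x) x := by
      have := ((hasDerivAt_pow 2 x).fun_neg).div_const 2
      refine this.congr_deriv ?_
      push_cast
      ring
    refine ((h2.exp.const_mul (√(2 * Real.pi))⁻¹).fun_neg).congr_deriv ?_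
    ring
  have hlim : Tendsto (fun x => -normalPDF x) atTop (𝓝 0) := by
    have h3 : Tendsto (fun x : ℝ => -x ^ 2 / 2) atTop atBot := by
      have := (tendsto_pow_atTop (α := ℝ) two_ne_zero).atTop_div_const (zero_lt_two)
      refine (tendsto_neg_atTop_atBot.comp this).congr fun x => ?_
      simp only [Function.comp]
      ring
    have := ((Real.tendsto_exp_atBot.comp h3).const_mul (√(2 * Real.pi))⁻¹).neg
    simpa [normalPDF, Function.comp_def] using this
  have hnn : ∀ x ∈ Set.Ioi (0 : ℝ), 0 ≤ x * normalPDF x := fun x hx =>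
    mul_nonneg (le_of_lt (Set.mem_Ioi.1 hx)) (normalPDF_nonneg x)
  have hint : IntegrableOn (fun x => x * normalPDF x) (Set.Ioi 0) :=
    integrableOn_Ioi_deriv_of_nonneg' hd hnn hlim
  rw [← ofReal_integral_eq_lintegral_ofReal hint
    ((ae_restrict_iff' measurableSet_Ioi).2 (Eventually.of_forall hnn)),
    integral_Ioi_of_hasDerivAt_of_tendsto' hd hint hlim, ENNReal.toReal_ofReal]
  · simp [normalPDF]
  · simp [normalPDF]

/-- Two errors of order h²: the hazard A satisfies A - A² ≤ 1 - e^(-A) ≤ A, and A lies between h x⁺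
and h (x + h)⁺. -/
theorem abs_switchProb_sub_le {h : ℝ} (hh : 0 ≤ h) (h1 : h ≤ 1) (x : ℝ) :
    |switchProb h x - h * max x 0| ≤ (|x| + 1) ^ 2 * h ^ 2 := by
  have hA0 := hazard_nonneg (x := x) hh
  have hA1 := hazard_le (x := x) hh
  have hA2 := le_hazard (x := x) hh
  have hu := switchProb_le_hazard h x
  have hm : max (x + h) 0 ≤ max x 0 + h := by
    refine max_le ?_ ?_
    · linarith [le_max_left x 0]
    · linarith [le_max_right x 0]
  have hm0 : max x 0 ≤ |x| := max_le (le_abs_self x) (abs_nonneg x)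
  have hx0 := abs_nonneg x
  have hAle : hazard x h ≤ h * (|x| + 1) := by nlinarith
  have hl : hazard x h - hazard x h ^ 2 ≤ switchProb h x := by
    rcases le_or_gt (hazard x h) 1 with hA | hA
    · have := Real.abs_exp_sub_one_sub_id_le (x := -hazard x h) (by rwa [abs_neg, abs_of_nonneg hA0])
      rw [abs_le] at this
      unfold switchProb
      nlinarith [this.2]
    -- For a hazard above 1 the left side is negative.
    · nlinarith [switchProb_nonneg hh x]
  have hsq : hazard x h ^ 2 ≤ (|x| + 1) ^ 2 * h ^ 2 := by
    rw [← mul_pow, mul_comm]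
    gcongr
  rw [abs_le]
  constructor
  · nlinarith
  · nlinarith [sq_nonneg h, mul_nonneg hx0 (sq_nonneg h), mul_nonneg (mul_nonneg hx0 hx0) (sq_nonneg h)]

/-- The mean number of switches per short time step is `h / √(2π) + O(h²)`. -/
theorem abs_integral_switchProb_sub_le {h : ℝ} (hh : 0 ≤ h) (h1 : h ≤ 1) :
    |∫ x, switchProb h x ∂(gaussianReal 0 1) - h * (√(2 * Real.pi))⁻¹| ≤
      (∫ x, (|x| + 1) ^ 2 ∂(gaussianReal 0 1)) * h ^ 2 := by
  have hi1 : Integrable (switchProb h) (gaussianReal 0 1) :=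
    Integrable.of_bound (measurable_switchProb h).aestronglyMeasurable 1
      (Eventually.of_forall fun x => by
        rw [Real.norm_of_nonneg (switchProb_nonneg hh x)]; exact switchProb_le_one h x)
  have hid : Integrable (fun x : ℝ => x) (gaussianReal 0 1) :=
    (memLp_id_gaussianReal 1).integrable (by simp)
  have hi2 : Integrable (fun x : ℝ => h * max x 0) (gaussianReal 0 1) :=
    hid.pos_part.const_mul h
  rw [← integral_max_gaussianReal, ← integral_const_mul, ← integral_sub hi1 hi2,
    ← integral_mul_const]
  refine (abs_integral_le_integral_abs).trans ?_
  exact integral_mono (hi1.sub hi2).abs ((integrable_abs_add_sq 1).mul_const _)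
    (fun x => abs_switchProb_sub_le hh h1 x)

variable {Ω : Type*} [MeasurableSpace Ω]
  {P : Measure Ω} [IsProbabilityMeasure P] {X : Ω → ℝ} {N : Ω → Measure (ℝ × ℝ)}

omit [IsProbabilityMeasure P] in
theorem IsStationaryInput.measurableSet_fires_chain (hI : IsStationaryInput P X N) {h : ℝ}
    (hh : 0 ≤ h) (k : ℕ) :
    MeasurableSet {ω | Fires (k * h) (chain h (X ω) (N ω) k) h (N ω)} :=
  hI.measurable_prod (ZigZag.measurableSet_fires_chain hh k)

theorem IsStationaryInput.measure_fires_chain (hI : IsStationaryInput P X N) {h : ℝ}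
    (hh : 0 ≤ h) (k : ℕ) :
    P {ω | Fires (k * h) (chain h (X ω) (N ω) k) h (N ω)} =
      ∫⁻ ω, ENNReal.ofReal (switchProb h (chain h (X ω) (N ω) k)) ∂P := by
  classical
  have := hI.lintegral_mul_fires hh k (z := fun _ => 1) measurable_const (fun _ _ => rfl)
  simp only [one_mul] at this
  rw [← this, ← lintegral_indicator_one (hI.measurableSet_fires_chain hh k)]
  simp [Set.indicator_apply]

omit [IsProbabilityMeasure P] in
theorem IsStationaryInput.measurable_switchCount (hI : IsStationaryInput P X N) {h : ℝ}
    (hh : 0 ≤ h) (n : ℕ) : Measurable fun ω => switchCount h (X ω) (N ω) n :=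
  (ZigZag.measurable_switchCount hh n).comp hI.measurable_prod

/-- Step k fires with the mean of `switchProb` under the law of the chain at k, and this mean is
within k h³ ≤ n h³ of the stationary one. -/
theorem IsStationaryInput.abs_integral_switchCount_sub_le (hI : IsStationaryInput P X N) {h : ℝ}
    (hh : 0 ≤ h) (n : ℕ) :
    |∫ ω, (switchCount h (X ω) (N ω) n : ℝ) ∂P - n * ∫ x, switchProb h x ∂(gaussianReal 0 1)| ≤
      n * (n * h ^ 3) := by
  classical
  have h1 : ∀ k : ℕ, ∫ ω, (if Fires (k * h) (chain h (X ω) (N ω) k) h (N ω) then (1 : ℝ) else 0) ∂P =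
      ∫ ω, switchProb h (chain h (X ω) (N ω) k) ∂P := by
    intro k
    have hm : Measurable fun ω => chain h (X ω) (N ω) k :=
      (measurable_chain hh k).comp hI.measurable_prod
    rw [integral_eq_lintegral_of_nonneg_ae (f := fun ω => switchProb h (chain h (X ω) (N ω) k))
      (Eventually.of_forall fun _ => switchProb_nonneg hh _)
      ((measurable_switchProb h).comp hm).aestronglyMeasurable,
      ← hI.measure_fires_chain hh k, ← Measure.real,
      ← integral_indicator_one (hI.measurableSet_fires_chain hh k)]
    simp [Set.indicator_apply]
  have h2 : ∫ ω, (switchCount h (X ω) (N ω) n : ℝ) ∂P =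
      ∑ k ∈ Finset.range n, ∫ ω, switchProb h (chain h (X ω) (N ω) k) ∂P := by
    simp only [switchCount, Nat.cast_sum, Nat.cast_ite, Nat.cast_one, Nat.cast_zero]
    rw [integral_finsetSum]
    · exact Finset.sum_congr rfl fun k _ => h1 k
    · intro k _
      refine Integrable.of_bound (Measurable.ite (hI.measurableSet_fires_chain hh k)
        measurable_const measurable_const).aestronglyMeasurable 1
        (Eventually.of_forall fun ω => ?_)
      split_ifs <;> simp
  have h3 : (n : ℝ) * ∫ x, switchProb h x ∂(gaussianReal 0 1) =
      ∑ k ∈ Finset.range n, ∫ x, switchProb h x ∂(gaussianReal 0 1) := by simp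
  rw [h2, h3, ← Finset.sum_sub_distrib]
  refine (Finset.abs_sum_le_sum_abs _ _).trans ?_
  calc _ ≤ ∑ k ∈ Finset.range n, (n * h ^ 3 : ℝ) := by
        refine Finset.sum_le_sum fun k hk => ?_
        refine (hI.abs_integral_chain_sub_le hh k (measurable_switchProb h) (switchProb_nonneg hh)
          (switchProb_le_one h)).trans ?_
        have : (k : ℝ) ≤ n := by exact_mod_cast (Finset.mem_range.1 hk).le
        gcongr
    _ = _ := by simp

/-- The momentum grows in absolute value at most at unit speed, so up to time T the rate is at most
|x| + T. A bound through the initial value alone makes the moment estimates independent of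
near-stationarity. -/
theorem switchProb_chain_le {h T : ℝ} (hh : 0 ≤ h) {k : ℕ} (hk : (k + 1) * h ≤ T) (x : ℝ)
    (ν : Measure (ℝ × ℝ)) : switchProb h (chain h x ν k) ≤ h * (|x| + T) := by
  have h1 := switchProb_le_hazard h (chain h x ν k)
  have h2 := hazard_le (x := chain h x ν k) hh
  have h3 := abs_chain_le hh x ν k
  have h4 := le_abs_self (chain h x ν k)
  have h5 : max (chain h x ν k + h) 0 ≤ |x| + T :=
    max_le (by linarith) (by nlinarith [abs_nonneg x, abs_nonneg (chain h x ν k)])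
  calc _ ≤ h * max (chain h x ν k + h) 0 := h1.trans h2
    _ ≤ _ := by gcongr

/-- The `m`-th moment of `|x| + T` under the standard normal law. -/
def absMoment (T : ℝ) (m : ℕ) : ℝ≥0∞ := ∫⁻ x, ENNReal.ofReal (|x| + T) ^ m ∂(gaussianReal 0 1)

theorem absMoment_two_lt_top {T : ℝ} (hT : 0 ≤ T) : absMoment T 2 < ∞ := by
  have := (integrable_abs_add_sq T).lintegral_lt_top
  unfold absMoment
  refine lt_of_le_of_lt (lintegral_mono fun x => ?_) this
  rw [ENNReal.ofReal_pow (by positivity)]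

theorem absMoment_one_lt_top {T : ℝ} (hT : 0 ≤ T) : absMoment T 1 < ∞ := by
  have h2 := absMoment_two_lt_top hT
  unfold absMoment at *
  calc _ ≤ ∫⁻ x, (ENNReal.ofReal (|x| + T) ^ 2 + 1) ∂(gaussianReal 0 1) := by
        refine lintegral_mono fun x => ?_
        rw [pow_one]
        rcases le_total (ENNReal.ofReal (|x| + T)) 1 with h | h
        · exact h.trans le_add_self
        · refine le_add_right ?_
          calc _ = ENNReal.ofReal (|x| + T) * 1 := (mul_one _).symm
            _ ≤ ENNReal.ofReal (|x| + T) * ENNReal.ofReal (|x| + T) := by gcongr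
            _ = _ := (sq _).symm
    _ < ∞ := by
        rw [lintegral_add_right _ measurable_const]
        simp [h2]

omit [IsProbabilityMeasure P] in
theorem IsStationaryInput.lintegral_absMoment (hI : IsStationaryInput P X N) (T : ℝ) (m : ℕ) :
    ∫⁻ ω, ENNReal.ofReal (|X ω| + T) ^ m ∂P = absMoment T m := by
  have := lintegral_map (μ := P) (f := fun x : ℝ => ENNReal.ofReal (|x| + T) ^ m) (by fun_prop)
    hI.measurable
  rw [absMoment, ← hI.map_eq, this]

theorem IsStationaryInput.measure_fires_chain_le (hI : IsStationaryInput P X N) {h T : ℝ}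
    (hh : 0 ≤ h) {k : ℕ} (hk : (k + 1) * h ≤ T) :
    P {ω | Fires (k * h) (chain h (X ω) (N ω) k) h (N ω)} ≤ ENNReal.ofReal h * absMoment T 1 := by
  rw [hI.measure_fires_chain hh k, ← hI.lintegral_absMoment,
    ← lintegral_const_mul' _ _ ENNReal.ofReal_ne_top]
  refine lintegral_mono fun ω => ?_
  rw [pow_one, ← ENNReal.ofReal_mul hh]
  exact ENNReal.ofReal_le_ofReal (switchProb_chain_le hh hk _ _)

open Classical in
theorem switchCount_succ (h x : ℝ) (ν : Measure (ℝ × ℝ)) (n : ℕ) :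
    switchCount h x ν (n + 1) = switchCount h x ν n +
      if Fires (n * h) (chain h x ν n) h ν then 1 else 0 :=
  Finset.sum_range_succ _ n

open Classical in
theorem IsStationaryInput.lintegral_mul_fires_le (hI : IsStationaryInput P X N) {h T : ℝ}
    (hh : 0 ≤ h) {k : ℕ} (hk : (k + 1) * h ≤ T)
    {z : ℝ × Measure (ℝ × ℝ) → ℝ≥0∞} (hz : Measurable z)
    (hz' : ∀ x ν, z (x, ν.restrict (timesLE (k * h))) = z (x, ν)) :
    ∫⁻ ω, z (X ω, N ω) * (if Fires (k * h) (chain h (X ω) (N ω) k) h (N ω) then 1 else 0) ∂P ≤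
      ENNReal.ofReal h * ∫⁻ ω, z (X ω, N ω) * ENNReal.ofReal (|X ω| + T) ∂P := by
  rw [hI.lintegral_mul_fires hh k hz hz', ← lintegral_const_mul' _ _ ENNReal.ofReal_ne_top]
  refine lintegral_mono fun ω => ?_
  rw [mul_left_comm, ← ENNReal.ofReal_mul hh]
  gcongr
  exact switchProb_chain_le hh hk _ _

/-- Each step adds at most h E(|X| + T)². The weighted form is needed for the second moment, where
the conditional firing probability brings in the factor |X| + T. -/
theorem IsStationaryInput.lintegral_switchCount_mul_le (hI : IsStationaryInput P X N) {h T : ℝ}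
    (hh : 0 ≤ h) {n : ℕ} (hn : n * h ≤ T) :
    ∫⁻ ω, (switchCount h (X ω) (N ω) n : ℝ≥0∞) * ENNReal.ofReal (|X ω| + T) ∂P ≤
      n * (ENNReal.ofReal h * absMoment T 2) := by
  classical
  have hX := hI.measurable
  induction n with
  | zero => simp [switchCount]
  | succ n ih =>
    push_cast at hn
    have hm := hI.measurable_switchCount hh n
    have h1 := hI.lintegral_mul_fires_le hh hn (z := fun p => ENNReal.ofReal (|p.1| + T))
      (by fun_prop) (fun _ _ => rfl)
    have h2 : ∀ ω, (switchCount h (X ω) (N ω) (n + 1) : ℝ≥0∞) * ENNReal.ofReal (|X ω| + T) =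
        (switchCount h (X ω) (N ω) n : ℝ≥0∞) * ENNReal.ofReal (|X ω| + T) +
        ENNReal.ofReal (|X ω| + T) *
          (if Fires (n * h) (chain h (X ω) (N ω) n) h (N ω) then 1 else 0) := by
      intro ω
      rw [switchCount_succ]
      push_cast
      ring
    simp_rw [h2]
    rw [lintegral_add_left (by fun_prop)]
    refine (add_le_add (ih (by linarith)) h1).trans (le_of_eq ?_)
    rw [← hI.lintegral_absMoment]
    simp only [sq]
    push_cast
    ring

/-- A bound, uniform in the time step, for the second moment of the number of switches. -/
theorem IsStationaryInput.lintegral_switchCount_sq_le (hI : IsStationaryInput P X N) {h T : ℝ}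
    (hh : 0 ≤ h) {n : ℕ} (hn : n * h ≤ T) :
    ∫⁻ ω, (switchCount h (X ω) (N ω) n : ℝ≥0∞) ^ 2 ∂P ≤
      n * (ENNReal.ofReal h * (2 * (ENNReal.ofReal T * absMoment T 2) + absMoment T 1)) := by
  classical
  have hX := hI.measurable
  induction n with
  | zero => simp [switchCount]
  | succ n ih =>
    push_cast at hn
    have hm := hI.measurable_switchCount hh n
    -- A firing raises K² by 2K + 1, a weight already known before the step.
    have h1 := hI.lintegral_mul_fires_le hh hn
      (z := fun p => 2 * (switchCount h p.1 p.2 n : ℝ≥0∞) + 1)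
      (by have := ZigZag.measurable_switchCount hh n; fun_prop)
      (fun x ν => by simp only [switchCount_restrict hh x ν (le_refl (n * h))])
    have h2 : ∀ ω, (switchCount h (X ω) (N ω) (n + 1) : ℝ≥0∞) ^ 2 =
        (switchCount h (X ω) (N ω) n : ℝ≥0∞) ^ 2 +
        (2 * (switchCount h (X ω) (N ω) n : ℝ≥0∞) + 1) *
          (if Fires (n * h) (chain h (X ω) (N ω) n) h (N ω) then 1 else 0) := by
      intro ω
      rw [switchCount_succ]
      split_ifs
      · push_cast; ring
      · simp
    simp_rw [h2]
    rw [lintegral_add_left (by fun_prop)]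
    have h3 := hI.lintegral_switchCount_mul_le hh (n := n) (T := T) (by linarith)
    have h4 : (n : ℝ≥0∞) * ENNReal.ofReal h ≤ ENNReal.ofReal T := by
      rw [← ENNReal.ofReal_natCast, ← ENNReal.ofReal_mul (by positivity)]
      exact ENNReal.ofReal_le_ofReal (by linarith)
    have h5 : ∫⁻ ω, (2 * (switchCount h (X ω) (N ω) n : ℝ≥0∞) + 1) *
        ENNReal.ofReal (|X ω| + T) ∂P ≤
        2 * (ENNReal.ofReal T * absMoment T 2) + absMoment T 1 := by
      simp_rw [add_mul, one_mul, mul_assoc]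
      rw [lintegral_add_left (by fun_prop), lintegral_const_mul _ (by fun_prop),
        ← hI.lintegral_absMoment T 1]
      simp only [pow_one]
      gcongr
      refine h3.trans ?_
      rw [← mul_assoc]
      gcongr
    calc _ ≤ n * (ENNReal.ofReal h * (2 * (ENNReal.ofReal T * absMoment T 2) + absMoment T 1)) +
          ENNReal.ofReal h * (2 * (ENNReal.ofReal T * absMoment T 2) + absMoment T 1) := by
          refine add_le_add (ih (by linarith)) (h1.trans ?_)
          gcongr
      _ = _ := by push_cast; ring

end Moments

/-! ### Deterministic unit-speed paths and their agreement with the chain -/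

section Path

/-- A path of a one-dimensional unit speed zig-zag process with position `Y` and velocity `Θ`,
driven by the point measure `ν`. -/
structure IsUnitPath (Y Θ : ℝ → ℝ) (ν : Measure (ℝ × ℝ)) : Prop where
  vals : ∀ t, Θ t = 1 ∨ Θ t = -1
  right : ∀ t, 0 ≤ t → ∃ ε > 0, ∀ s ∈ Set.Ico t (t + ε), Θ s = Θ t
  pos : ∀ t₁ t₂, 0 ≤ t₁ → t₁ ≤ t₂ → (∀ s ∈ Set.Ico t₁ t₂, Θ s = Θ t₁) →
    Y t₂ = Y t₁ + Θ t₁ * (t₂ - t₁)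
  vel : ∀ t₁ t₂, 0 ≤ t₁ → t₁ ≤ t₂ → (∀ s ∈ Set.Ico t₁ t₂, Θ s = Θ t₁) →
    Θ t₂ = Θ t₁ - 2 * (Θ t₁ * (ν (wedge t₁ (Θ t₁ * Y t₁) (t₂ - t₁))).toReal)
  finite : ∀ t x u, ν (wedge t x u) ≠ ∞
  axis : ν {p | p.2 ≤ 0} = 0
  counting : ∀ B, MeasurableSet B → ∃ n : ℕ∞, ν B = n

variable {Y Θ : ℝ → ℝ} {ν : Measure (ℝ × ℝ)}

theorem IsUnitPath.eq_zero_of_lt_one (hp : IsUnitPath Y Θ ν) {B : Set (ℝ × ℝ)}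
    (hB : MeasurableSet B) (h : ν B < 1) : ν B = 0 := by
  obtain ⟨n, hn⟩ := hp.counting B hB
  rw [hn] at h ⊢
  have : n < 1 := by exact_mod_cast h
  rw [Order.lt_one_iff] at this
  simp [this]

/-- Continuity from above of ν along shrinking wedges of finite measure removes the right limit in
`Fires`. -/
theorem IsUnitPath.fires_iff (hp : IsUnitPath Y Θ ν) {t x u : ℝ} :
    Fires t x u ν ↔ 1 ≤ ν (wedge t x u) := by
  refine ⟨fun h => ?_, fires_of_one_le⟩
  by_contra hlt
  rw [not_le] at hlt
  have hlim := tendsto_measure_biInter_gt (μ := ν) (s := fun y => wedge t y u) (a := x)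
    (fun r _ => (measurableSet_wedge t r u).nullMeasurableSet)
    (fun i j _ hij => wedge_mono t hij le_rfl) ⟨x + 1, by simp, hp.finite t (x + 1) u⟩
  have he : ⋂ r, ⋂ (_ : r > x), wedge t r u = wedge t x u := by
    ext p
    simp only [Set.mem_iInter, wedge, Set.mem_ofPred_eq]
    constructor
    · intro h
      have h1 := h (x + 1) (by simp)
      refine ⟨h1.1, h1.2.1, ?_⟩
      have : p.2 - (p.1 - t) ≤ x := le_of_forall_gt_imp_ge_of_dense fun r hr => by
        have := (h r hr).2.2
        linarith
      linarith
    · intro h r hr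
      exact ⟨h.1, h.2.1, by linarith [h.2.2]⟩
  rw [he] at hlim
  have hev := (hlim.eventually_lt_const hlt).and self_mem_nhdsWithin
  obtain ⟨r, hr1, hr2⟩ := hev.exists
  obtain ⟨q, hq1, hq2⟩ := exists_rat_btwn hr2
  have h1 := (h q hq1).trans (measure_mono (wedge_mono t hq2.le le_rfl))
  exact absurd hr1 (not_lt.2 h1)

theorem IsUnitPath.ne_zero (hp : IsUnitPath Y Θ ν) (t : ℝ) : Θ t ≠ 0 := by
  rcases hp.vals t with h | h <;> rw [h] <;> norm_num

theorem IsUnitPath.mul_self (hp : IsUnitPath Y Θ ν) (t : ℝ) : Θ t * Θ t = 1 := by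
  rcases hp.vals t with h | h <;> rw [h] <;> norm_num

/-- In the velocity equation an unchanged nonzero velocity forces the point count to vanish; a first
reversal forces it to be one (`measure_wedge_eq_one`). -/
theorem IsUnitPath.measure_wedge_eq_zero (hp : IsUnitPath Y Θ ν) {t s : ℝ} (ht : 0 ≤ t)
    (hs : t ≤ s) (hc : ∀ r ∈ Set.Icc t s, Θ r = Θ t) :
    ν (wedge t (Θ t * Y t) (s - t)) = 0 := by
  have h := hp.vel t s ht hs (fun r hr => hc r ⟨hr.1, hr.2.le⟩)
  rw [hc s ⟨hs, le_rfl⟩] at h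
  have h0 := hp.ne_zero t
  have : Θ t * (ν (wedge t (Θ t * Y t) (s - t))).toReal = 0 := by linarith
  rcases mul_eq_zero.1 this with h1 | h1
  · exact absurd h1 h0
  · rcases (ENNReal.toReal_eq_zero_iff _).1 h1 with h2 | h2
    · exact h2
    · exact absurd h2 (hp.finite _ _ _)

/-- Either the velocity is constant on `[t, s]`, or there is a first time in `(t, s]` at which it
has changed. -/
theorem IsUnitPath.const_or_first_switch (hp : IsUnitPath Y Θ ν) {t : ℝ} (ht : 0 ≤ t) (s : ℝ) :
    (∀ r ∈ Set.Icc t s, Θ r = Θ t) ∨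
      ∃ σ, t < σ ∧ σ ≤ s ∧ (∀ r ∈ Set.Ico t σ, Θ r = Θ t) ∧ Θ σ = -Θ t := by
  by_contra! hcon
  obtain ⟨⟨r, hr, hrne⟩, hσ⟩ := hcon
  let S : Set ℝ := {r | t ≤ r ∧ Θ r ≠ Θ t}
  have hbdd : BddBelow S := ⟨t, fun r hr => hr.1⟩
  have hne : S.Nonempty := ⟨r, hr.1, hrne⟩
  have h1 : t ≤ sInf S := le_csInf hne fun r hr => hr.1
  have hconst : ∀ r ∈ Set.Ico t (sInf S), Θ r = Θ t := fun r hr => by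
    by_contra hc
    exact absurd (csInf_le hbdd (show r ∈ S from ⟨hr.1, hc⟩)) (not_le.2 hr.2)
  -- By right continuity the infimum is itself a time at which the velocity has changed.
  have hσne : Θ (sInf S) ≠ Θ t := by
    intro heq
    obtain ⟨ε, hε, hright⟩ := hp.right (sInf S) (ht.trans h1)
    obtain ⟨r, hrS, hr⟩ := exists_lt_of_csInf_lt hne (lt_add_of_pos_right (sInf S) hε)
    exact hrS.2 ((hright r ⟨csInf_le hbdd hrS, hr⟩).trans heq)
  have hlt : t < sInf S := lt_of_le_of_ne h1 fun h => hσne (by rw [← h])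
  refine hσ (sInf S) hlt ((csInf_le hbdd (show r ∈ S from ⟨hr.1, hrne⟩)).trans hr.2) hconst ?_
  rcases hp.vals t with h | h <;> rcases hp.vals (sInf S) with h' | h'
  · exact absurd (h'.trans h.symm) hσne
  · rw [h, h']
  · rw [h, h', neg_neg]
  · exact absurd (h'.trans h.symm) hσne

theorem IsUnitPath.measure_wedge_eq_one (hp : IsUnitPath Y Θ ν) {t σ : ℝ} (ht : 0 ≤ t)
    (hσ : t < σ) (hc : ∀ r ∈ Set.Ico t σ, Θ r = Θ t) (hs : Θ σ = -Θ t) :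
    ν (wedge t (Θ t * Y t) (σ - t)) = 1 := by
  have h := hp.vel t σ ht hσ.le hc
  rw [hs] at h
  have h0 := hp.ne_zero t
  have : Θ t * (ν (wedge t (Θ t * Y t) (σ - t))).toReal = Θ t * 1 := by linarith
  have h1 := mul_left_cancel₀ h0 this
  rw [← ENNReal.ofReal_toReal (hp.finite t (Θ t * Y t) (σ - t)), h1, ENNReal.ofReal_one]

/-- Otherwise the wedge up to the first switch would have measure one inside a null wedge. -/
theorem IsUnitPath.const_of_measure_eq_zero (hp : IsUnitPath Y Θ ν) {t s : ℝ} (ht : 0 ≤ t)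
    (h0 : ν (wedge t (Θ t * Y t) (s - t)) = 0) : ∀ r ∈ Set.Icc t s, Θ r = Θ t := by
  rcases hp.const_or_first_switch ht s with h | ⟨σ, h1, h2, h3, h4⟩
  · exact h
  · have h5 := hp.measure_wedge_eq_one ht h1 h3 h4
    have h6 : ν (wedge t (Θ t * Y t) (σ - t)) ≤ ν (wedge t (Θ t * Y t) (s - t)) :=
      measure_mono (wedge_mono t le_rfl (by linarith))
    rw [h5, h0] at h6
    exact absurd h6 (by simp)

theorem IsUnitPath.const_of_not_fires (hp : IsUnitPath Y Θ ν) {t h : ℝ} (ht : 0 ≤ t)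
    (hf : ¬ Fires t (Θ t * Y t) h ν) : ∀ r ∈ Set.Icc t (t + h), Θ r = Θ t := by
  refine hp.const_of_measure_eq_zero ht ?_
  rw [hp.fires_iff, not_le] at hf
  rw [add_sub_cancel_left]
  exact hp.eq_zero_of_lt_one (measurableSet_wedge _ _ _) hf

/-- The points with time in `(t, t + h]` and height at most `h`; if there are none, then there is
at most one switch in this time interval. -/
def corner (t h : ℝ) : Set (ℝ × ℝ) := {p | t < p.1 ∧ p.1 ≤ t + h ∧ p.2 ≤ h}

/-- Before the first switch the momentum is positive, as points of height at most 0 are null.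
Afterwards it is negative and cannot reach h within the step, so every point that could cause a
second switch lies in the corner, which is empty. -/
theorem IsUnitPath.switch_of_fires (hp : IsUnitPath Y Θ ν) {t h : ℝ} (ht : 0 ≤ t) (hh : 0 ≤ h)
    (hbox : ν (corner t h) = 0) (hf : Fires t (Θ t * Y t) h ν) :
    0 < delay t (Θ t * Y t) h ν ∧ 0 < Θ t * Y t + delay t (Θ t * Y t) h ν ∧
    (∀ r ∈ Set.Ico t (t + delay t (Θ t * Y t) h ν), Θ r = Θ t) ∧
    (∀ r ∈ Set.Icc (t + delay t (Θ t * Y t) h ν) (t + h), Θ r = -Θ t) := by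
  have hf1 := hp.fires_iff.1 hf
  rcases hp.const_or_first_switch ht (t + h) with hc | ⟨σ, h1, h2, h3, h4⟩
  · have := hp.measure_wedge_eq_zero ht (by linarith) hc
    rw [add_sub_cancel_left] at this
    rw [this] at hf1
    exact absurd hf1 (by simp)
  have h5 := hp.measure_wedge_eq_one ht h1 h3 h4
  have hdelay : delay t (Θ t * Y t) h ν = σ - t := by
    apply le_antisymm
    · exact Fires.delay_le hh (fires_of_one_le h5.ge)
    · by_contra hlt
      rw [not_le, delay_lt_iff hh] at hlt
      rcases hlt with hlt | ⟨q, hq1, hq2⟩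
      · linarith
      · have hq0 := hq2.pos
        have := hp.measure_wedge_eq_zero (s := t + q) ht (by linarith)
          (fun r hr => h3 r ⟨hr.1, by linarith [hr.2]⟩)
        rw [add_sub_cancel_left] at this
        have h6 := hp.fires_iff.1 hq2
        rw [this] at h6
        exact absurd h6 (by simp)
  rw [hdelay, add_sub_cancel]
  have hpos : 0 < Θ t * Y t + (σ - t) := by
    by_contra hneg
    rw [not_lt] at hneg
    have hsub : wedge t (Θ t * Y t) (σ - t) ⊆ {p | p.2 ≤ 0} := by
      rintro p ⟨_, hp2, hp3⟩
      change p.2 ≤ 0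
      linarith
    have := measure_mono_null hsub hp.axis
    rw [h5] at this
    exact one_ne_zero this
  refine ⟨sub_pos.2 h1, hpos, h3, fun r hr => ?_⟩
  have hY := hp.pos t σ ht h1.le h3
  have hR : Θ σ * Y σ = -(Θ t * Y t + (σ - t)) := by
    rw [hY, h4]
    linear_combination (-(σ - t)) * hp.mul_self t
  have hnull : ν (wedge σ (Θ σ * Y σ) (t + h - σ)) = 0 := by
    refine measure_mono_null ?_ hbox
    rintro p ⟨hp1, hp2, hp3⟩
    exact ⟨by linarith, by linarith, by linarith⟩
  rw [hp.const_of_measure_eq_zero (ht.trans h1.le) hnull r hr, h4]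

theorem IsUnitPath.step_eq (hp : IsUnitPath Y Θ ν) {t h : ℝ} (ht : 0 ≤ t) (hh : 0 ≤ h)
    (hbox : ν (corner t h) = 0) :
    Θ (t + h) * Y (t + h) = step h t (Θ t * Y t) ν := by
  have hsq := hp.mul_self t
  by_cases hf : Fires t (Θ t * Y t) h ν
  · rw [step_of_fires hf]
    obtain ⟨h0, h1, h2, h3⟩ := hp.switch_of_fires ht hh hbox hf
    have hd := delay_le (t := t) (x := Θ t * Y t) hh ν
    set δ := delay t (Θ t * Y t) h ν
    have hσ : Θ (t + δ) = -Θ t := h3 _ ⟨le_rfl, by linarith⟩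
    have hY1 := hp.pos t (t + δ) ht (by linarith) h2
    have hY2 := hp.pos (t + δ) (t + h) (by linarith) (by linarith)
      (fun r hr => by rw [h3 r ⟨hr.1, hr.2.le⟩, hσ])
    rw [hY2, hY1, h3 _ ⟨by linarith, le_rfl⟩, hσ]
    linear_combination (h - 2 * δ) * hsq
  · rw [step_of_not_fires hf]
    have hc := hp.const_of_not_fires ht hf
    have hY := hp.pos t (t + h) ht (by linarith) (fun r hr => hc r ⟨hr.1, hr.2.le⟩)
    rw [hY, hc _ ⟨by linarith, le_rfl⟩]
    linear_combination h * hsq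

theorem IsUnitPath.chain_eq (hp : IsUnitPath Y Θ ν) {h : ℝ} (hh : 0 ≤ h) {n : ℕ}
    (hbox : ∀ k < n, ν (corner (k * h) h) = 0) {k : ℕ} (hk : k ≤ n) :
    chain h (Θ 0 * Y 0) ν k = Θ (k * h) * Y (k * h) := by
  induction k with
  | zero => simp [chain]
  | succ k ih =>
    rw [chain, ih (by omega), ← hp.step_eq (by positivity) hh (hbox k (by omega))]
    have : ((k + 1 : ℕ) : ℝ) * h = k * h + h := by push_cast; ring
    rw [this]

theorem IsUnitPath.tendsto_left (hp : IsUnitPath Y Θ ν) {a s : ℝ} (ha : 0 ≤ a) (has : a < s)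
    (hc : ∀ r ∈ Set.Ico a s, Θ r = Θ a) :
    Tendsto (fun r => Θ r * Y r) (𝓝[<] s) (𝓝 (Θ a * Y s)) := by
  have hY := hp.pos a s ha has.le hc
  have hcont : Tendsto (fun r => Θ a * (Y a + Θ a * (r - a))) (𝓝[<] s) (𝓝 (Θ a * Y s)) := by
    rw [hY]
    have : Continuous fun r => Θ a * (Y a + Θ a * (r - a)) := by fun_prop
    exact this.continuousWithinAt
  refine hcont.congr' ?_
  filter_upwards [Ico_mem_nhdsLT has] with r hr
  rw [hc r hr, hp.pos a r ha hr.1 (fun q hq => hc q ⟨hq.1, hq.2.trans hr.2⟩)]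

/-- The left limits of the angular momentum in a time interval with at most one switch. -/
theorem IsUnitPath.tendsto_left_of_corner (hp : IsUnitPath Y Θ ν) {t h : ℝ} (ht : 0 ≤ t)
    (hh : 0 ≤ h) (hbox : ν (corner t h) = 0) {s : ℝ} (hs : s ∈ Set.Ioc t (t + h)) :
    ∃ c : ℝ, 0 ≤ c ∧ Tendsto (fun r => Θ r * Y r) (𝓝[<] s) (𝓝 (Θ s * Y s + c)) ∧
      (0 < c ↔ Fires t (Θ t * Y t) h ν ∧ s = t + delay t (Θ t * Y t) h ν) := by
  by_cases hf : Fires t (Θ t * Y t) h ν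
  · obtain ⟨h0, h1, h2, h3⟩ := hp.switch_of_fires ht hh hbox hf
    have hd := delay_le (t := t) (x := Θ t * Y t) hh ν
    set δ := delay t (Θ t * Y t) h ν
    rcases lt_trichotomy s (t + δ) with hlt | heq | hgt
    · refine ⟨0, le_rfl, ?_, by simp [hlt.ne]⟩
      rw [add_zero, h2 s ⟨hs.1.le, hlt⟩]
      exact hp.tendsto_left ht hs.1 (fun r hr => h2 r ⟨hr.1, hr.2.trans hlt⟩)
    -- The switch sends the momentum r = Θ t * Y t + δ > 0 to -r, a fall by 2r.
    · refine ⟨2 * (Θ t * Y t + δ), by linarith, ?_, by simp [hf, heq, h1]⟩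
      have hl := hp.tendsto_left ht hs.1 (fun r hr => h2 r ⟨hr.1, by linarith [hr.2]⟩)
      convert hl using 2
      have hY := hp.pos t (t + δ) ht (by linarith) h2
      rw [heq, h3 _ ⟨le_rfl, by linarith⟩, hY]
      linear_combination (-2 * δ) * hp.mul_self t
    · refine ⟨0, le_rfl, ?_, by simp [hgt.ne']⟩
      have hσ : Θ (t + δ) = -Θ t := h3 _ ⟨le_rfl, by linarith⟩
      rw [add_zero, h3 s ⟨hgt.le, hs.2⟩, ← hσ]
      exact hp.tendsto_left (by linarith) hgt
        (fun r hr => by rw [hσ, h3 r ⟨hr.1, hr.2.le.trans hs.2⟩])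
  · refine ⟨0, le_rfl, ?_, by simp [hf]⟩
    have hc := hp.const_of_not_fires ht hf
    rw [add_zero, hc s ⟨hs.1.le, hs.2⟩]
    exact hp.tendsto_left ht hs.1 (fun r hr => hc r ⟨hr.1, hr.2.le.trans hs.2⟩)

end Path

/-! ### Jumps of the sum over the coordinates -/

section Superposition

theorem exists_mem_Ioc_mul {h : ℝ} (hh : 0 < h) {n : ℕ} {s : ℝ} (hs : s ∈ Set.Ioc 0 (n * h)) :
    ∃ k < n, s ∈ Set.Ioc (k * h) (k * h + h) := by
  have hpos : 0 < s / h := div_pos hs.1 hh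
  have h1 : 0 < ⌈s / h⌉₊ := Nat.ceil_pos.2 hpos
  have h2 : (⌈s / h⌉₊ : ℝ) < s / h + 1 := Nat.ceil_lt_add_one hpos.le
  have h3 : s / h ≤ ⌈s / h⌉₊ := Nat.le_ceil _
  have h4 : ⌈s / h⌉₊ ≤ n := Nat.ceil_le.2 ((div_le_iff₀ hh).2 hs.2)
  have h5 : ((⌈s / h⌉₊ - 1 : ℕ) : ℝ) = ⌈s / h⌉₊ - 1 := by
    rw [Nat.cast_sub h1, Nat.cast_one]
  have h6 : s / h * h = s := div_mul_cancel₀ s hh.ne'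
  refine ⟨⌈s / h⌉₊ - 1, by omega, ?_, ?_⟩
  · rw [h5]; nlinarith
  · rw [h5]; nlinarith

variable {d : ℕ} {Y Θ : Fin d → ℝ → ℝ} {ν : Fin d → Measure (ℝ × ℝ)}

open Classical in
/-- The pairs of a coordinate and a time step in which this coordinate switches. -/
def switches (h : ℝ) (n : ℕ) (X : Fin d → ℝ) (ν : Fin d → Measure (ℝ × ℝ)) :
    Finset (Fin d × ℕ) :=
  (Finset.univ ×ˢ Finset.range n).filter
    fun p => Fires (p.2 * h) (chain h (X p.1) (ν p.1) p.2) h (ν p.1)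

theorem card_switches (h : ℝ) (n : ℕ) (X : Fin d → ℝ) (ν : Fin d → Measure (ℝ × ℝ)) :
    (switches h n X ν).card = ∑ i, switchCount h (X i) (ν i) n := by
  classical
  rw [switches, Finset.card_filter, Finset.sum_product]
  rfl

/-- The switching times. -/
def switchTime (h : ℝ) (X : Fin d → ℝ) (ν : Fin d → Measure (ℝ × ℝ)) (p : Fin d × ℕ) : ℝ :=
  p.2 * h + delay (p.2 * h) (chain h (X p.1) (ν p.1) p.2) h (ν p.1)

theorem switches_spec (hp : ∀ i, IsUnitPath (Y i) (Θ i) (ν i)) {h : ℝ} (hh : 0 < h) {n : ℕ}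
    (hbox : ∀ i, ∀ k < n, ν i (corner (k * h) h) = 0) {p : Fin d × ℕ}
    (hmem : p ∈ switches h n (fun i => Θ i 0 * Y i 0) ν) :
    p.2 < n ∧ switchTime h (fun i => Θ i 0 * Y i 0) ν p ∈ Set.Ioc (p.2 * h) (p.2 * h + h) := by
  simp only [switches, Finset.mem_filter, Finset.mem_product, Finset.mem_univ, true_and,
    Finset.mem_range] at hmem
  obtain ⟨hk, hf⟩ := hmem
  refine ⟨hk, ?_⟩
  unfold switchTime
  rw [(hp p.1).chain_eq hh.le (hbox p.1) hk.le] at hf ⊢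
  have h1 := (hp p.1).switch_of_fires (by positivity) hh.le (hbox p.1 p.2 hk) hf
  have h2 := delay_le (t := p.2 * h) (x := Θ p.1 (p.2 * h) * Y p.1 (p.2 * h)) hh.le (ν p.1)
  exact ⟨by linarith [h1.1], by linarith⟩

theorem eq_of_mem_Ioc_mul {h : ℝ} (hh : 0 < h) {k l : ℕ} {s : ℝ}
    (hk : s ∈ Set.Ioc (k * h) (k * h + h)) (hl : s ∈ Set.Ioc (l * h) (l * h + h)) : k = l := by
  have h1 : (k : ℝ) < l + 1 := by
    by_contra hc
    nlinarith [hk.1, hl.2, not_lt.1 hc]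
  have h2 : (l : ℝ) < k + 1 := by
    by_contra hc
    nlinarith [hl.1, hk.2, not_lt.1 hc]
  have h3 : k < l + 1 := by exact_mod_cast h1
  have h4 : l < k + 1 := by exact_mod_cast h2
  omega

theorem injOn_switchTime (hp : ∀ i, IsUnitPath (Y i) (Θ i) (ν i)) {h : ℝ} (hh : 0 < h) {n : ℕ}
    (hbox : ∀ i, ∀ k < n, ν i (corner (k * h) h) = 0)
    (hsingle : ∀ i j, ∀ k < n, (i, k) ∈ switches h n (fun i => Θ i 0 * Y i 0) ν →
      (j, k) ∈ switches h n (fun i => Θ i 0 * Y i 0) ν → i = j) :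
    Set.InjOn (switchTime h (fun i => Θ i 0 * Y i 0) ν)
      (switches h n (fun i => Θ i 0 * Y i 0) ν) := by
  rintro ⟨i, k⟩ hi ⟨j, l⟩ hj hij
  have h1 := switches_spec hp hh hbox (Finset.mem_coe.1 hi)
  have h2 := switches_spec hp hh hbox (Finset.mem_coe.1 hj)
  rw [hij] at h1
  obtain rfl := eq_of_mem_Ioc_mul hh h1.2 h2.2
  rw [hsingle i j k h1.1 (Finset.mem_coe.1 hi) (Finset.mem_coe.1 hj)]

/-- The left limits of the total angular momentum differ from the values exactly at the switching
times. -/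
theorem tendsto_left_sum (hp : ∀ i, IsUnitPath (Y i) (Θ i) (ν i)) {h : ℝ} (hh : 0 < h) {n : ℕ}
    (hbox : ∀ i, ∀ k < n, ν i (corner (k * h) h) = 0) {s : ℝ} (hs : s ∈ Set.Ioc 0 (n * h)) :
    ∃ l, Tendsto (fun r => ∑ i, Θ i r * Y i r) (𝓝[<] s) (𝓝 l) ∧
      (l ≠ ∑ i, Θ i s * Y i s ↔ s ∈ switchTime h (fun i => Θ i 0 * Y i 0) ν ''
        (switches h n (fun i => Θ i 0 * Y i 0) ν)) := by
  obtain ⟨k, hk, hsk⟩ := exists_mem_Ioc_mul hh hs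
  choose c hc0 hlim hc using fun i =>
    (hp i).tendsto_left_of_corner (by positivity) hh.le (hbox i k hk) hsk
  refine ⟨∑ i, (Θ i s * Y i s + c i), tendsto_finsetSum _ fun i _ => hlim i, ?_⟩
  -- All jumps are downward, so simultaneous switches cannot cancel in the sum.
  have h1 : ∑ i, (Θ i s * Y i s + c i) ≠ ∑ i, Θ i s * Y i s ↔ ∃ i, 0 < c i := by
    rw [Finset.sum_add_distrib, ne_eq, add_eq_left, Finset.sum_eq_zero_iff_of_nonneg
      (fun i _ => hc0 i)]
    push Not
    simp only [Finset.mem_univ, true_and]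
    exact exists_congr fun i => ⟨fun h => lt_of_le_of_ne (hc0 i) h.symm, fun h => h.ne'⟩
  rw [h1]
  constructor
  · rintro ⟨i, hi⟩
    obtain ⟨hf, hst⟩ := (hc i).1 hi
    refine ⟨(i, k), ?_, ?_⟩
    · simp only [switches, Finset.coe_filter, Finset.mem_product, Finset.mem_univ, true_and,
        Finset.mem_range, Set.mem_ofPred_eq]
      refine ⟨hk, ?_⟩
      rwa [(hp i).chain_eq hh.le (hbox i) hk.le]
    · simp only [switchTime]
      rw [(hp i).chain_eq hh.le (hbox i) hk.le, hst]
  · rintro ⟨⟨i, l⟩, hmem, rfl⟩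
    have h2 := switches_spec hp hh hbox (Finset.mem_coe.1 hmem)
    obtain rfl := eq_of_mem_Ioc_mul hh hsk h2.2
    refine ⟨i, (hc i).2 ?_⟩
    simp only [switches, Finset.coe_filter, Finset.mem_product, Finset.mem_univ, true_and,
      Finset.mem_range, Set.mem_ofPred_eq] at hmem
    have h3 := hmem.2
    simp only [switchTime]
    rw [(hp i).chain_eq hh.le (hbox i) hk.le] at h3 ⊢
    exact ⟨h3, rfl⟩

end Superposition

/-! ### Lebesgue measure on the half-line and its rescaling -/

section Lebesgue

theorem measurableEmbedding_nnreal_coe : MeasurableEmbedding ((↑) : ℝ≥0 → ℝ) :=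
  MeasurableEmbedding.subtype_coe measurableSet_Ici

theorem map_coe_lebesgue :
    lebesgue.map ((↑) : ℝ≥0 → ℝ) = volume.restrict (Set.Ici 0) := by
  rw [lebesgue, measurableEmbedding_nnreal_coe.map_comap]
  congr 1
  exact NNReal.range_coe

theorem lebesgue_Ioc (a b : ℝ≥0) : lebesgue (Set.Ioc a b) = ENNReal.ofReal (b - a) := by
  have h : (Set.Ioc a b) = ((↑) : ℝ≥0 → ℝ) ⁻¹' (Set.Ioc a b) := by
    ext s; simp
  rw [h, ← Measure.map_apply measurable_coe_nnreal_real measurableSet_Ioc, map_coe_lebesgue,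
    Measure.restrict_apply measurableSet_Ioc, Set.inter_eq_left.2, Real.volume_Ioc]
  intro s hs
  exact a.2.trans hs.1.le

theorem lebesgue_singleton (a : ℝ≥0) : lebesgue {a} = 0 := by
  have h : ({a} : Set ℝ≥0) = ((↑) : ℝ≥0 → ℝ) ⁻¹' {(a : ℝ)} := by
    ext s; simp
  rw [h, ← Measure.map_apply measurable_coe_nnreal_real (measurableSet_singleton _),
    map_coe_lebesgue]
  exact measure_mono_null subset_rfl (by simp)

theorem lebesgue_Icc_zero_lt_top (b : ℝ≥0) : lebesgue (Set.Icc 0 b) < ∞ := by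
  have h : Set.Icc 0 b = {0} ∪ Set.Ioc 0 b := by
    rw [Set.union_comm, Set.Ioc_union_left zero_le]
  rw [h]
  refine (measure_union_le _ _).trans_lt ?_
  rw [lebesgue_singleton, lebesgue_Ioc, zero_add]
  exact ENNReal.ofReal_lt_top

instance : SigmaFinite lebesgue := by
  refine ⟨⟨⟨fun n => Set.Icc 0 n, fun _ => trivial, fun n => lebesgue_Icc_zero_lt_top n, ?_⟩⟩⟩
  rw [Set.eq_univ_iff_forall]
  intro s
  obtain ⟨n, hn⟩ := exists_nat_ge s
  exact Set.mem_iUnion.2 ⟨n, zero_le, hn⟩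

/-- The change of variables that turns the zig-zag process with speed `a⁻¹` into the one with unit
speed. -/
def rescale (a : ℝ) (p : ℝ≥0 × ℝ≥0) : ℝ × ℝ := (p.1 * a⁻¹, p.2 * a)

theorem measurable_rescale (a : ℝ) : Measurable (rescale a) := by
  unfold rescale; fun_prop

theorem map_mul_lebesgue {a : ℝ} (ha : 0 < a) :
    lebesgue.map (fun s : ℝ≥0 => (s : ℝ) * a) =
      ENNReal.ofReal a⁻¹ • volume.restrict (Set.Ici 0) := by
  have h1 : (fun s : ℝ≥0 => (s : ℝ) * a) = (fun s : ℝ => s * a) ∘ ((↑) : ℝ≥0 → ℝ) := rfl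
  have h2 : Set.Ici (0 : ℝ) = (fun s : ℝ => s * a) ⁻¹' Set.Ici 0 := by
    ext s; simp [ha]
  rw [h1, ← Measure.map_map (by fun_prop) (by fun_prop), map_coe_lebesgue]
  conv_lhs => rw [h2]
  rw [← Measure.restrict_map (by fun_prop) measurableSet_Ici, Real.map_volume_mul_right ha.ne',
    Measure.restrict_smul, abs_of_pos (inv_pos.2 ha)]

/-- Times are divided by a and heights multiplied by a, so the intensity is unchanged. -/
theorem map_rescale_lebesgue {a : ℝ} (ha : 0 < a) :
    (lebesgue.prod lebesgue).map (rescale a) = quadrant := by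
  have h : rescale a = Prod.map (fun s : ℝ≥0 => (s : ℝ) * a⁻¹) (fun s : ℝ≥0 => (s : ℝ) * a) := rfl
  rw [h, ← Measure.map_prod_map _ _ (by fun_prop) (by fun_prop), map_mul_lebesgue ha,
    map_mul_lebesgue (inv_pos.2 ha), Measure.prod_smul_left, Measure.prod_smul_right, smul_smul,
    ← ENNReal.ofReal_mul (by positivity), inv_inv, mul_inv_cancel₀ ha.ne', ENNReal.ofReal_one,
    one_smul, quadrant]

end Lebesgue

/-! ### Measurability of càdlàg paths and their left limits -/

section Cadlag

variable {X : Type*} [TopologicalSpace X] {f : ℝ≥0 → X}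

theorem IsCadlag.tendsto_leftLim [T2Space X] (hf : IsCadlag f) {s : ℝ≥0} :
    Tendsto f (𝓝[<] s) (𝓝 (Function.leftLim f s)) :=
  tendsto_leftLim_of_tendsto (hf s).2

theorem nhdsLT_nnreal_neBot {s : ℝ≥0} (hs : 0 < s) : (𝓝[<] s).NeBot :=
  nhdsLT_neBot_of_exists_lt ⟨0, hs⟩

variable [TopologicalSpace.PseudoMetrizableSpace X] [MeasurableSpace X] [BorelSpace X]

/-- Rounding time up to a grid makes the path factor through ℕ; right continuity recovers it in the
limit. -/
theorem IsCadlag.measurable (hf : IsCadlag f) : Measurable f := by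
  let r : ℕ → ℝ≥0 → ℝ≥0 := fun m s => (⌊(m + 1) * s⌋₊ + 1 : ℕ) / (m + 1)
  have h1 : ∀ m, Measurable fun s => f (r m s) := by
    intro m
    have h2 : Measurable fun s : ℝ≥0 => ⌊((m : ℝ≥0) + 1) * s⌋₊ := by fun_prop
    have h3 : Measurable fun j : ℕ => f ((j + 1 : ℕ) / (m + 1)) := measurable_of_countable _
    exact h3.comp h2
  have hgt : ∀ m s, s < r m s := by
    intro m s
    have := Nat.lt_floor_add_one (((m : ℝ≥0) + 1) * s)
    simp only [r]
    rw [lt_div_iff₀ (by positivity), mul_comm]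
    exact_mod_cast this
  have hle : ∀ m s, r m s ≤ s + 1 / (m + 1) := by
    intro m s
    have := Nat.floor_le (zero_le (a := ((m : ℝ≥0) + 1) * s))
    simp only [r]
    have he : (s + 1 / ((m : ℝ≥0) + 1)) * (m + 1) = (m + 1) * s + 1 := by
      field_simp
    rw [div_le_iff₀ (by positivity), he]
    push_cast
    gcongr
  refine measurable_of_tendsto_metrizable h1 ?_
  rw [tendsto_pi_nhds]
  intro s
  have hr : Tendsto (fun m => r m s) atTop (𝓝 s) := by
    have h4 : Tendsto (fun m : ℕ => s + 1 / ((m : ℝ≥0) + 1)) atTop (𝓝 (s + 0)) :=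
      tendsto_const_nhds.add tendsto_one_div_add_atTop_nhds_zero_nat
    rw [add_zero] at h4
    exact tendsto_of_tendsto_of_tendsto_of_le_of_le tendsto_const_nhds h4
      (fun m => (hgt m s).le) (fun m => hle m s)
  have hr' : Tendsto (fun m => r m s) atTop (𝓝[≥] s) :=
    tendsto_nhdsWithin_iff.2 ⟨hr, Eventually.of_forall fun m => (hgt m s).le⟩
  exact ((hf s).1.tendsto).comp hr'

/-- Evaluation at s (1 - 1/(m + 2)) approaches s > 0 strictly from below, and stays at 0 for s = 0,
in agreement with the convention there. -/
theorem IsCadlag.measurable_leftLim [T2Space X] (hf : IsCadlag f) :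
    Measurable (Function.leftLim f) := by
  let r : ℕ → ℝ≥0 → ℝ≥0 := fun m s => s * (1 - 1 / (m + 2))
  have h1 : ∀ m, Measurable fun s => f (r m s) := fun m =>
    hf.measurable.comp (by fun_prop)
  refine measurable_of_tendsto_metrizable h1 ?_
  rw [tendsto_pi_nhds]
  intro s
  rcases eq_zero_or_pos s with rfl | hs
  · have h2 : ∀ m, r m 0 = 0 := fun m => zero_mul _
    simp only [h2]
    rw [leftLim_eq_of_isBot fun b => zero_le (a := b)]
    exact tendsto_const_nhds
  · have hlt : ∀ m, r m s < s := by
      intro m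
      refine mul_lt_of_lt_one_right hs ?_
      exact tsub_lt_self one_pos (by positivity)
    have hr : Tendsto (fun m => r m s) atTop (𝓝 s) := by
      have h4 : Tendsto (fun m : ℕ => 1 / ((m : ℝ≥0) + 2)) atTop (𝓝 0) := by
        have := (tendsto_add_atTop_iff_nat 1).2 (tendsto_one_div_add_atTop_nhds_zero_nat (𝕜 := ℝ≥0))
        refine this.congr fun m => ?_
        push_cast
        rw [add_assoc, one_add_one_eq_two]
      have h5 := (tendsto_const_nhds (x := (1 : ℝ≥0))).sub h4
      have h6 := (tendsto_const_nhds (x := s)).mul h5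
      simpa [r] using h6
    have hr' : Tendsto (fun m => r m s) atTop (𝓝[<] s) :=
      tendsto_nhdsWithin_iff.2 ⟨hr, Eventually.of_forall fun m => hlt m⟩
    exact hf.tendsto_leftLim.comp hr'

end Cadlag

/-! ### From the zig-zag path in dimension d to unit-speed coordinate paths -/

section MultivariatePath

/-- The properties of a path of the zig-zag process that hold almost surely. -/
structure IsZigZagPath {d : ℕ}
    (w : ℝ≥0 → EuclideanSpace ℝ (Fin d) × EuclideanSpace ℝ (Fin d))
    (N : Fin d → Measure (ℝ≥0 × ℝ≥0)) : Prop where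
  cadlag : IsCadlag w
  velocity_mem : ∀ t, (w t).2 ∈ velocities d
  position_eq : ∀ t, (w t).1 = (w 0).1 + ∫ s in Set.Icc 0 t, (w s).2 ∂lebesgue
  velocity_eq : ∀ t i, (w t).2 i = (w 0).2 i -
    2 * ∫ p in Set.Icc 0 t ×ˢ Set.univ,
      (let xm := Function.leftLim w p.1
       xm.2 i * Set.indicator {z : ℝ≥0 | (z : ℝ) ≤ gaussianRate i xm} 1 p.2) ∂(N i)
  finite : ∀ i (m : ℕ), (N i).map (rescale √(d : ℝ)) (Set.Iic (m : ℝ) ×ˢ Set.Iic (m : ℝ)) ≠ ∞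
  axis : ∀ i, (N i).map (rescale √(d : ℝ)) {p | p.2 ≤ 0} = 0
  counting : ∀ i B, MeasurableSet B → ∃ n : ℕ∞, (N i).map (rescale √(d : ℝ)) B = n

variable {d : ℕ} {w : ℝ≥0 → EuclideanSpace ℝ (Fin d) × EuclideanSpace ℝ (Fin d)}
  {N : Fin d → Measure (ℝ≥0 × ℝ≥0)}

theorem abs_le_one_of_mem_velocities {v : EuclideanSpace ℝ (Fin d)} (hd : 1 ≤ d)
    (hv : v ∈ velocities d) (i : Fin d) : |v i| ≤ 1 := by
  have h1 : (√(d : ℝ))⁻¹ ≤ 1 := inv_le_one_of_one_le₀ (by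
    rw [Real.one_le_sqrt]; exact_mod_cast hd)
  have h0 : 0 ≤ (√(d : ℝ))⁻¹ := by positivity
  rcases hv i with h | h <;> rw [h] <;> simp [abs_of_nonneg h0, h1]

theorem mul_self_of_mem_velocities {v : EuclideanSpace ℝ (Fin d)}
    (hv : v ∈ velocities d) (i : Fin d) : v i * v i = (√(d : ℝ))⁻¹ * (√(d : ℝ))⁻¹ := by
  rcases hv i with h | h <;> simp [h]

theorem IsZigZagPath.position_sub (hw : IsZigZagPath w N) (hd : 1 ≤ d) (i : Fin d) {a b : ℝ≥0}
    (hab : a ≤ b) : (w b).1 i - (w a).1 i = ∫ s in Set.Ioc a b, (w s).2 i ∂lebesgue := by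
  have hm := hw.cadlag.measurable
  have hint : ∀ t, IntegrableOn (fun s => (w s).2) (Set.Icc 0 t) lebesgue := by
    intro t
    refine IntegrableOn.of_bound (lebesgue_Icc_zero_lt_top t) (by fun_prop) (√d)
      (Eventually.of_forall fun s => ?_)
    rw [EuclideanSpace.norm_eq]
    apply Real.sqrt_le_sqrt
    calc _ ≤ ∑ i : Fin d, (1 : ℝ) := by
          refine Finset.sum_le_sum fun j _ => ?_
          have := abs_le_one_of_mem_velocities hd (hw.velocity_mem s) j
          rw [Real.norm_eq_abs]
          exact pow_le_one₀ (abs_nonneg _) this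
      _ = d := by simp
  have hinti : ∀ t, IntegrableOn (fun s => (w s).2 i) (Set.Icc 0 t) lebesgue := fun t =>
    (EuclideanSpace.proj (𝕜 := ℝ) i).integrable_comp (hint t)
  have hpos : ∀ t, (w t).1 i = (w 0).1 i + ∫ s in Set.Icc 0 t, (w s).2 i ∂lebesgue := by
    intro t
    have h1 := (EuclideanSpace.proj (𝕜 := ℝ) i).integral_comp_comm (hint t)
    have h2 := congrArg (fun v : EuclideanSpace ℝ (Fin d) => v i) (hw.position_eq t)
    simp only [PiLp.add_apply] at h2
    rw [h2]
    congr 1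
    exact h1.symm
  have hsplit : Set.Icc 0 b = Set.Icc 0 a ∪ Set.Ioc a b :=
    (Set.Icc_union_Ioc_eq_Icc zero_le hab).symm
  have hdisj : Disjoint (Set.Icc 0 a) (Set.Ioc a b) :=
    Set.disjoint_left.2 fun s h1 h2 => not_lt.2 h1.2 h2.1
  rw [hpos b, hpos a, hsplit, setIntegral_union hdisj measurableSet_Ioc (hinti a)
    ((hinti b).mono_set (by rw [hsplit]; exact Set.subset_union_right))]
  ring

theorem IsZigZagPath.position_eq_of_const (hw : IsZigZagPath w N) (hd : 1 ≤ d) (i : Fin d)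
    {a b : ℝ≥0} (hab : a ≤ b) (hc : ∀ s ∈ Set.Ico a b, (w s).2 i = (w a).2 i) :
    (w b).1 i = (w a).1 i + (w a).2 i * (b - a) := by
  have h1 := hw.position_sub hd i hab
  have h2 : ∫ s in Set.Ioc a b, (w s).2 i ∂lebesgue = ∫ s in Set.Ioc a b, (w a).2 i ∂lebesgue := by
    refine setIntegral_congr_ae measurableSet_Ioc ?_
    -- Constancy is assumed only before b, while the domain of integration contains b.
    have : ∀ᵐ s ∂lebesgue, s ≠ b := by
      rw [ae_iff]; simpa using lebesgue_singleton b
    filter_upwards [this] with s hs hs'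
    exact hc s ⟨hs'.1.le, lt_of_le_of_ne hs'.2 hs⟩
  rw [h2, setIntegral_const, Measure.real, lebesgue_Ioc, ENNReal.toReal_ofReal
    (sub_nonneg.2 (by exact_mod_cast hab)), smul_eq_mul] at h1
  linarith

theorem IsZigZagPath.abs_position_le (hw : IsZigZagPath w N) (hd : 1 ≤ d) (i : Fin d) (b : ℝ≥0) :
    |(w b).1 i| ≤ |(w 0).1 i| + b := by
  have h1 := hw.position_sub hd i (zero_le (a := b))
  have h2 : ‖∫ s in Set.Ioc 0 b, (w s).2 i ∂lebesgue‖ ≤ 1 * lebesgue.real (Set.Ioc 0 b) := by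
    refine norm_setIntegral_le_of_norm_le_const ?_ fun s _ => ?_
    · rw [lebesgue_Ioc]; exact ENNReal.ofReal_lt_top
    · exact abs_le_one_of_mem_velocities hd (hw.velocity_mem s) i
  rw [← h1, Measure.real, lebesgue_Ioc, ENNReal.toReal_ofReal (by simp)] at h2
  simp only [NNReal.coe_zero, sub_zero, one_mul, Real.norm_eq_abs] at h2
  have := abs_sub_abs_le_abs_sub ((w b).1 i) ((w 0).1 i)
  linarith

/-- The integrand of the velocity equation. -/
def switchIntegrand (w : ℝ≥0 → EuclideanSpace ℝ (Fin d) × EuclideanSpace ℝ (Fin d)) (i : Fin d)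
    (p : ℝ≥0 × ℝ≥0) : ℝ :=
  (Function.leftLim w p.1).2 i * Set.indicator
    {z : ℝ≥0 | (z : ℝ) ≤ gaussianRate i (Function.leftLim w p.1)} 1 p.2

theorem IsCadlag.measurable_switchIntegrand (hw : IsCadlag w) (i : Fin d) :
    Measurable (switchIntegrand w i) := by
  have hm := hw.measurable_leftLim
  have h1 : Measurable fun p : ℝ≥0 × ℝ≥0 => (Function.leftLim w p.1).2 i := by fun_prop
  have h2 : MeasurableSet {p : ℝ≥0 × ℝ≥0 | (p.2 : ℝ) ≤ gaussianRate i (Function.leftLim w p.1)} := by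
    unfold gaussianRate
    exact measurableSet_le (by fun_prop) (by fun_prop)
  exact h1.mul ((measurable_const (a := (1 : ℝ))).indicator h2)

theorem IsZigZagPath.abs_leftLim_le (hw : IsZigZagPath w N) (hd : 1 ≤ d) (i : Fin d) (s : ℝ≥0) :
    |(Function.leftLim w s).2 i| ≤ 1 ∧
      |(Function.leftLim w s).1 i| ≤ |(w 0).1 i| + s := by
  rcases eq_zero_or_pos s with rfl | hs
  · rw [leftLim_eq_of_isBot fun b => zero_le (a := b)]
    exact ⟨abs_le_one_of_mem_velocities hd (hw.velocity_mem 0) i, by simp⟩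
  · have := nhdsLT_nnreal_neBot hs
    have hl := hw.cadlag.tendsto_leftLim (s := s)
    have hc1 : Continuous fun x : EuclideanSpace ℝ (Fin d) × EuclideanSpace ℝ (Fin d) =>
      |x.1 i| := by fun_prop
    have hc2 : Continuous fun x : EuclideanSpace ℝ (Fin d) × EuclideanSpace ℝ (Fin d) =>
      |x.2 i| := by fun_prop
    constructor
    · exact le_of_tendsto ((hc2.tendsto _).comp hl) (Eventually.of_forall fun r =>
        abs_le_one_of_mem_velocities hd (hw.velocity_mem r) i)
    · refine le_of_tendsto ((hc1.tendsto _).comp hl) ?_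
      filter_upwards [self_mem_nhdsWithin] with r hr
      refine (hw.abs_position_le hd i r).trans ?_
      gcongr
      exact (Set.mem_Iio.1 hr).le

theorem sqrt_dim_pos (hd : 1 ≤ d) : 0 < √(d : ℝ) :=
  Real.sqrt_pos.2 (by exact_mod_cast hd)

/-- The integrand is bounded, and it vanishes above height |ξ_i(0)| + b, which dominates the rate up
to time b; the remaining rectangle has finite measure. Integrability is what allows the velocity
equation to be split at an intermediate time. -/
theorem IsZigZagPath.integrableOn_switchIntegrand (hw : IsZigZagPath w N) (hd : 1 ≤ d) (i : Fin d)
    (b : ℝ≥0) : IntegrableOn (switchIntegrand w i) (Set.Icc 0 b ×ˢ Set.univ) (N i) := by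
  have ha := sqrt_dim_pos hd
  set a := √(d : ℝ)
  have hm := hw.cadlag.measurable_switchIntegrand i
  let C : ℝ≥0 := (|(w 0).1 i| + b).toNNReal
  have hC : (C : ℝ) = |(w 0).1 i| + b := Real.coe_toNNReal _ (by positivity)
  obtain ⟨m, hm'⟩ := exists_nat_ge (max (b * a⁻¹) (C * a))
  have hfin : N i (Set.Icc 0 b ×ˢ Set.Iic C) < ∞ := by
    have h1 := (hw.finite i m).lt_top
    rw [Measure.map_apply (measurable_rescale a) (measurableSet_Iic.prod measurableSet_Iic)] at h1
    refine lt_of_le_of_lt (measure_mono ?_) h1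
    rintro ⟨s, z⟩ ⟨hs, hz⟩
    have hs2 : (s : ℝ) ≤ b := by exact_mod_cast hs.2
    have hz2 : (z : ℝ) ≤ C := by exact_mod_cast (Set.mem_Iic.1 hz)
    refine ⟨?_, ?_⟩
    · change (s : ℝ) * a⁻¹ ≤ m
      exact le_trans (by gcongr) ((le_max_left _ _).trans hm')
    · change (z : ℝ) * a ≤ m
      exact le_trans (by gcongr) ((le_max_right _ _).trans hm')
  have hon : IntegrableOn (switchIntegrand w i) (Set.Icc 0 b ×ˢ Set.Iic C) (N i) := by
    refine IntegrableOn.of_bound hfin hm.aestronglyMeasurable 1 (Eventually.of_forall fun p => ?_)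
    unfold switchIntegrand
    rw [norm_mul]
    refine mul_le_one₀ (hw.abs_leftLim_le hd i p.1).1 (norm_nonneg _) ?_
    refine (norm_indicator_le_norm_self _ _).trans ?_
    simp
  refine hon.of_forall_sdiff_eq_zero (measurableSet_Icc.prod MeasurableSet.univ) ?_
  rintro ⟨s, z⟩ ⟨⟨hs, -⟩, hnot⟩
  have hz : ¬ z ≤ C := fun h => hnot ⟨hs, h⟩
  unfold switchIntegrand
  rw [Set.indicator_of_notMem, mul_zero]
  intro hmem
  apply hz
  have h1 : (z : ℝ) ≤ gaussianRate i (Function.leftLim w s) := hmem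
  have h2 := hw.abs_leftLim_le hd i s
  have hs2 : (s : ℝ) ≤ b := by exact_mod_cast hs.2
  have h3 : gaussianRate i (Function.leftLim w s) ≤ |(w 0).1 i| + b := by
    unfold gaussianRate
    refine max_le ?_ (by positivity)
    refine (le_abs_self _).trans ?_
    rw [abs_mul]
    calc _ ≤ (|(w 0).1 i| + s) * 1 := by
          gcongr
          · exact h2.2
          · exact h2.1
      _ ≤ _ := by linarith
  have : (z : ℝ) ≤ C := by rw [hC]; exact h1.trans h3
  exact_mod_cast this

/-- The left limit at the end of an interval on which a velocity component is constant. -/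
theorem IsZigZagPath.leftLim_eq_of_const (hw : IsZigZagPath w N) (hd : 1 ≤ d) (i : Fin d)
    {a s : ℝ≥0} (has : a < s) (hc : ∀ r ∈ Set.Ico a s, (w r).2 i = (w a).2 i) :
    (Function.leftLim w s).2 i = (w a).2 i ∧
      (Function.leftLim w s).1 i = (w a).1 i + (w a).2 i * (s - a) := by
  have := nhdsLT_nnreal_neBot (lt_of_le_of_lt zero_le has)
  have hl := hw.cadlag.tendsto_leftLim (s := s)
  have hc1 : Continuous fun x : EuclideanSpace ℝ (Fin d) × EuclideanSpace ℝ (Fin d) =>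
    x.1 i := by fun_prop
  have hc2 : Continuous fun x : EuclideanSpace ℝ (Fin d) × EuclideanSpace ℝ (Fin d) =>
    x.2 i := by fun_prop
  have hev : ∀ᶠ r in 𝓝[<] s, r ∈ Set.Ico a s := Ico_mem_nhdsLT has
  constructor
  · refine tendsto_nhds_unique ((hc2.tendsto _).comp hl) ?_
    refine tendsto_const_nhds.congr' ?_
    filter_upwards [hev] with r hr
    exact (hc r hr).symm
  · refine tendsto_nhds_unique ((hc1.tendsto _).comp hl) ?_
    have hcont : Continuous fun r : ℝ≥0 => (w a).1 i + (w a).2 i * ((r : ℝ) - a) := by fun_prop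
    refine (hcont.continuousWithinAt (s := Set.Iio s) (x := s)).tendsto.congr' ?_
    filter_upwards [hev] with r hr
    exact (hw.position_eq_of_const hd i hr.1 fun q hq => hc q ⟨hq.1, hq.2.trans hr.2⟩).symm

/-- Subtracting the velocity equations at a and b leaves the integral over (a, b]. There the left
limits are explicit, so the integrand is a constant on the region below the rate. -/
theorem IsZigZagPath.velocity_eq_of_const (hw : IsZigZagPath w N) (hd : 1 ≤ d) (i : Fin d)
    {a b : ℝ≥0} (hab : a ≤ b) (hc : ∀ s ∈ Set.Ico a b, (w s).2 i = (w a).2 i) :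
    (w b).2 i = (w a).2 i - 2 * ((w a).2 i * (N i {p | a < p.1 ∧ p.1 ≤ b ∧ (p.2 : ℝ) ≤
      max (((w a).1 i + (w a).2 i * (p.1 - a)) * (w a).2 i) 0}).toReal) := by
  set R : Set (ℝ≥0 × ℝ≥0) := {p | a < p.1 ∧ p.1 ≤ b ∧ (p.2 : ℝ) ≤
      max (((w a).1 i + (w a).2 i * (p.1 - a)) * (w a).2 i) 0} with hR
  have hRm : MeasurableSet R := by
    have h1 : MeasurableSet {p : ℝ≥0 × ℝ≥0 | a < p.1} :=
      measurableSet_lt measurable_const measurable_fst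
    have h2 : MeasurableSet {p : ℝ≥0 × ℝ≥0 | p.1 ≤ b} :=
      measurableSet_le measurable_fst measurable_const
    have h3 : MeasurableSet {p : ℝ≥0 × ℝ≥0 | (p.2 : ℝ) ≤
      max (((w a).1 i + (w a).2 i * (p.1 - a)) * (w a).2 i) 0} :=
      measurableSet_le (by fun_prop) (by fun_prop)
    exact h1.inter (h2.inter h3)
  have hb := hw.velocity_eq b i
  have ha := hw.velocity_eq a i
  change _ = _ - 2 * ∫ p in _, switchIntegrand w i p ∂(N i) at hb
  change _ = _ - 2 * ∫ p in _, switchIntegrand w i p ∂(N i) at ha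
  have hsplit : (Set.Icc 0 b ×ˢ (Set.univ : Set ℝ≥0)) =
      (Set.Icc 0 a ×ˢ Set.univ) ∪ (Set.Ioc a b ×ˢ Set.univ) := by
    rw [← Set.union_prod, Set.Icc_union_Ioc_eq_Icc zero_le hab]
  have hdisj : Disjoint (Set.Icc 0 a ×ˢ (Set.univ : Set ℝ≥0)) (Set.Ioc a b ×ˢ Set.univ) :=
    Set.disjoint_left.2 fun s h1 h2 => not_lt.2 h1.1.2 h2.1.1
  have hI := hw.integrableOn_switchIntegrand hd i b
  rw [hsplit, setIntegral_union hdisj (measurableSet_Ioc.prod MeasurableSet.univ)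
    (hw.integrableOn_switchIntegrand hd i a)
    (hI.mono_set (by rw [hsplit]; exact Set.subset_union_right))] at hb
  have hJ : ∫ p in Set.Ioc a b ×ˢ Set.univ, switchIntegrand w i p ∂(N i) =
      (w a).2 i * (N i R).toReal := by
    have h1 : ∫ p in Set.Ioc a b ×ˢ Set.univ, switchIntegrand w i p ∂(N i) =
        ∫ p in Set.Ioc a b ×ˢ Set.univ, R.indicator (fun _ => (w a).2 i) p ∂(N i) := by
      refine setIntegral_congr_fun (measurableSet_Ioc.prod MeasurableSet.univ) ?_
      rintro ⟨s, z⟩ ⟨hs, -⟩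
      obtain ⟨h2, h3⟩ := hw.leftLim_eq_of_const hd i hs.1
        (fun r hr => hc r ⟨hr.1, lt_of_lt_of_le hr.2 hs.2⟩)
      simp only [switchIntegrand, gaussianRate, h2, h3]
      by_cases hz : (z : ℝ) ≤ max (((w a).1 i + (w a).2 i * (s - a)) * (w a).2 i) 0
      · rw [Set.indicator_of_mem (by exact hz), Set.indicator_of_mem (by exact ⟨hs.1, hs.2, hz⟩)]
        simp
      · rw [Set.indicator_of_notMem (by exact hz),
          Set.indicator_of_notMem (by exact fun h => hz h.2.2)]
        simp
    have hsub : R ∩ Set.Ioc a b ×ˢ Set.univ = R :=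
      Set.inter_eq_left.2 fun p hp => ⟨⟨hp.1, hp.2.1⟩, trivial⟩
    rw [h1, integral_indicator_const _ hRm, Measure.real, Measure.restrict_apply hRm, hsub,
      smul_eq_mul, mul_comm]
  rw [hJ] at hb
  linarith

/-- Time rescaling as a map on the real line. -/
def rescaleTime (d : ℕ) (t : ℝ) : ℝ≥0 := NNReal.sqrt d * t.toNNReal

theorem coe_rescaleTime (d : ℕ) {t : ℝ} (ht : 0 ≤ t) : (rescaleTime d t : ℝ) = √(d : ℝ) * t := by
  simp [rescaleTime, Real.coe_toNNReal _ ht]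

/-- The position of the `i`-th coordinate in rescaled time. -/
def unitPosition (w : ℝ≥0 → EuclideanSpace ℝ (Fin d) × EuclideanSpace ℝ (Fin d)) (i : Fin d)
    (t : ℝ) : ℝ := (w (rescaleTime d t)).1 i

/-- The velocity of the `i`-th coordinate in rescaled time. -/
def unitVelocity (w : ℝ≥0 → EuclideanSpace ℝ (Fin d) × EuclideanSpace ℝ (Fin d)) (i : Fin d)
    (t : ℝ) : ℝ := √(d : ℝ) * (w (rescaleTime d t)).2 i

theorem monotone_rescaleTime (d : ℕ) : Monotone (rescaleTime d) := fun s t hst => by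
  unfold rescaleTime
  gcongr

theorem continuous_rescaleTime (d : ℕ) : Continuous (rescaleTime d) := by
  unfold rescaleTime
  fun_prop

theorem IsZigZagPath.unitVelocity_vals (hw : IsZigZagPath w N) (hd : 1 ≤ d) (i : Fin d) (t : ℝ) :
    unitVelocity w i t = 1 ∨ unitVelocity w i t = -1 := by
  have ha := (sqrt_dim_pos hd).ne'
  unfold unitVelocity
  rcases hw.velocity_mem (rescaleTime d t) i with h | h
  · right; rw [h, mul_neg, mul_inv_cancel₀ ha]
  · left; rw [h, mul_inv_cancel₀ ha]

theorem IsZigZagPath.const_of_unitVelocity (hd : 1 ≤ d) {i : Fin d} {s t : ℝ} (hs : 0 ≤ s)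
    (hst : s ≤ t) (hc : ∀ r ∈ Set.Ico s t, unitVelocity w i r = unitVelocity w i s) :
    ∀ r ∈ Set.Ico (rescaleTime d s) (rescaleTime d t), (w r).2 i = (w (rescaleTime d s)).2 i := by
  have ha := sqrt_dim_pos hd
  intro r hr
  have h1 : √(d : ℝ) * s ≤ r := by
    rw [← coe_rescaleTime d hs]; exact_mod_cast hr.1
  have h2 : (r : ℝ) < √(d : ℝ) * t := by
    rw [← coe_rescaleTime d (hs.trans hst)]; exact_mod_cast hr.2
  have hr' : rescaleTime d (r / √(d : ℝ)) = r := by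
    rw [← NNReal.coe_inj, coe_rescaleTime d (by positivity)]
    field_simp
  have h3 := hc (r / √(d : ℝ)) ⟨(le_div_iff₀ ha).2 (by linarith), (div_lt_iff₀ ha).2 (by linarith)⟩
  unfold unitVelocity at h3
  rw [hr'] at h3
  exact mul_left_cancel₀ ha.ne' h3

/-- In the time scale √d the velocity becomes ±1, and the rate ξ_i v_i multiplied by √d becomes the
unit-speed momentum, which increases with slope one between switches. -/
theorem IsZigZagPath.isUnitPath (hw : IsZigZagPath w N) (hd : 1 ≤ d) (i : Fin d) :
    IsUnitPath (unitPosition w i) (unitVelocity w i) ((N i).map (rescale √(d : ℝ))) where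
  vals := hw.unitVelocity_vals hd i
  right := by
    intro t ht
    have hcont : ContinuousWithinAt (unitVelocity w i) (Set.Ici t) t := by
      have h1 : ContinuousWithinAt (fun r => w (rescaleTime d r)) (Set.Ici t) t :=
        ((hw.cadlag (rescaleTime d t)).1).comp (continuous_rescaleTime d).continuousWithinAt
          fun r hr => monotone_rescaleTime d hr
      have h2 : Continuous fun x : EuclideanSpace ℝ (Fin d) × EuclideanSpace ℝ (Fin d) =>
        √(d : ℝ) * x.2 i := by fun_prop
      exact h2.continuousAt.comp_continuousWithinAt h1
    -- The values ±1 are at distance 2, so a distance below 1 means equality.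
    have hev := hcont.tendsto (Metric.ball_mem_nhds _ one_pos)
    obtain ⟨u, hu, hsub⟩ := mem_nhdsGE_iff_exists_Ico_subset.1 hev
    refine ⟨u - t, sub_pos.2 hu, fun s hs => ?_⟩
    rw [add_sub_cancel] at hs
    have h3 : dist (unitVelocity w i s) (unitVelocity w i t) < 1 := hsub hs
    rw [Real.dist_eq, abs_lt] at h3
    rcases hw.unitVelocity_vals hd i s with h | h <;>
      rcases hw.unitVelocity_vals hd i t with h' | h' <;> rw [h, h'] at h3 ⊢ <;> linarith [h3.1, h3.2]
  pos := by
    intro s t hs hst hc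
    have h := hw.position_eq_of_const hd i (monotone_rescaleTime d hst)
      (IsZigZagPath.const_of_unitVelocity hd hs hst hc)
    unfold unitPosition unitVelocity
    rw [h, coe_rescaleTime d hs, coe_rescaleTime d (hs.trans hst)]
    ring
  vel := by
    intro s t hs hst hc
    have ha := sqrt_dim_pos hd
    have h := hw.velocity_eq_of_const hd i (monotone_rescaleTime d hst)
      (IsZigZagPath.const_of_unitVelocity hd hs hst hc)
    have hv := mul_self_of_mem_velocities (hw.velocity_mem (rescaleTime d s)) i
    -- The rate carries a positive part and the wedge does not; the two regions differ only by
    -- points on the null axis.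
    have hm : N i {p | rescaleTime d s < p.1 ∧ p.1 ≤ rescaleTime d t ∧ (p.2 : ℝ) ≤
        max (((w (rescaleTime d s)).1 i + (w (rescaleTime d s)).2 i *
          (p.1 - rescaleTime d s)) * (w (rescaleTime d s)).2 i) 0} =
        (N i).map (rescale √(d : ℝ))
          (wedge s (unitVelocity w i s * unitPosition w i s) (t - s)) := by
      have hax := hw.axis i
      have haxm : MeasurableSet {p : ℝ × ℝ | p.2 ≤ 0} :=
        measurableSet_le measurable_snd measurable_const
      rw [Measure.map_apply (measurable_rescale _) haxm] at hax
      rw [Measure.map_apply (measurable_rescale _) (measurableSet_wedge _ _ _)]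
      set y := (w (rescaleTime d s)).1 i
      set v := (w (rescaleTime d s)).2 i
      have hiff : ∀ p : ℝ≥0 × ℝ≥0, rescale √(d : ℝ) p ∈
          wedge s (unitVelocity w i s * unitPosition w i s) (t - s) ↔
          rescaleTime d s < p.1 ∧ p.1 ≤ rescaleTime d t ∧
            (p.2 : ℝ) ≤ (y + v * (p.1 - rescaleTime d s)) * v := by
        intro p
        change (s < (p.1 : ℝ) * (√(d : ℝ))⁻¹ ∧ (p.1 : ℝ) * (√(d : ℝ))⁻¹ ≤ s + (t - s) ∧
          (p.2 : ℝ) * √(d : ℝ) ≤ √(d : ℝ) * v * y + ((p.1 : ℝ) * (√(d : ℝ))⁻¹ - s)) ↔ _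
        rw [← NNReal.coe_lt_coe, ← NNReal.coe_le_coe, coe_rescaleTime d hs,
          coe_rescaleTime d (hs.trans hst), add_sub_cancel, ← div_eq_mul_inv, lt_div_iff₀ ha,
          div_le_iff₀ ha, mul_comm s, mul_comm t, ← le_div_iff₀ ha]
        have he : (√(d : ℝ) * v * y + ((p.1 : ℝ) / √(d : ℝ) - s)) / √(d : ℝ) =
            (y + v * (p.1 - √(d : ℝ) * s)) * v := by
          have : (y + v * (p.1 - √(d : ℝ) * s)) * v =
            y * v + (√(d : ℝ))⁻¹ * (√(d : ℝ))⁻¹ * (p.1 - √(d : ℝ) * s) := by rw [← hv]; ring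
          rw [this]
          field_simp
        rw [he]
      apply le_antisymm
      · refine (measure_mono (t := rescale √(d : ℝ) ⁻¹'
          (wedge s (unitVelocity w i s * unitPosition w i s) (t - s)) ∪
          rescale √(d : ℝ) ⁻¹' {p | p.2 ≤ 0}) ?_).trans
          ((measure_union_le _ _).trans (by rw [hax, add_zero]))
        rintro p ⟨h1, h2, h3⟩
        rcases le_max_iff.1 h3 with h4 | h4
        · exact Or.inl ((hiff p).2 ⟨h1, h2, h4⟩)
        · right
          change (p.2 : ℝ) * √(d : ℝ) ≤ 0
          exact mul_nonpos_of_nonpos_of_nonneg h4 ha.le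
      · refine measure_mono fun p hp => ?_
        obtain ⟨h1, h2, h3⟩ := (hiff p).1 hp
        exact ⟨h1, h2, h3.trans (le_max_left _ _)⟩
    rw [hm] at h
    have h' : unitVelocity w i t = √(d : ℝ) * (w (rescaleTime d t)).2 i := rfl
    have h'' : unitVelocity w i s = √(d : ℝ) * (w (rescaleTime d s)).2 i := rfl
    rw [h', h]
    nth_rewrite 2 [h'']
    rw [h'']
    ring
  finite := by
    intro t x u
    obtain ⟨m, hm⟩ := exists_nat_ge (max (t + u) (x + u))
    refine ((measure_mono ?_).trans_lt (hw.finite i m).lt_top).ne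
    rintro p ⟨h1, h2, h3⟩
    refine ⟨?_, ?_⟩
    · exact h2.trans ((le_max_left _ _).trans hm)
    · exact le_trans (by linarith) ((le_max_right _ _).trans hm)
  axis := hw.axis i
  counting := hw.counting i

end MultivariatePath

/-! ### The law of the initial momenta -/

section StationaryLaw

theorem finite_velocities (d : ℕ) : (velocities d).Finite := by
  have h : velocities d = (WithLp.ofLp : EuclideanSpace ℝ (Fin d) → Fin d → ℝ) ⁻¹'
      (Set.univ.pi fun _ => {-(√(d : ℝ))⁻¹, (√(d : ℝ))⁻¹}) := by
    ext v
    simp [velocities]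
  rw [h]
  exact (Set.Finite.pi fun _ => Set.toFinite _).preimage (WithLp.ofLp_injective 2).injOn

theorem nonempty_velocities (d : ℕ) : (velocities d).Nonempty :=
  ⟨WithLp.toLp 2 fun _ => (√(d : ℝ))⁻¹, fun _ => Or.inr rfl⟩

/-- The initial angular momenta of the coordinates are independent standard normal. -/
theorem map_stationaryLaw {d : ℕ} (hd : 1 ≤ d) :
    (stationaryLaw d).map (fun x i => √(d : ℝ) * x.2 i * x.1 i) =
      Measure.pi fun _ : Fin d => gaussianReal 0 1 := by
  have ha := (sqrt_dim_pos hd).ne'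
  have : IsProbabilityMeasure (uniformOn (velocities d)) :=
    isProbabilityMeasure_uniformOn (finite_velocities d) (nonempty_velocities d)
  have hm : Measurable fun (x : EuclideanSpace ℝ (Fin d) × EuclideanSpace ℝ (Fin d)) (i : Fin d) =>
      √(d : ℝ) * x.2 i * x.1 i := by fun_prop
  -- For a fixed velocity √d v_i = ±1, and the Gaussian is invariant under sign changes of the
  -- coordinates, so the conditional law does not depend on v.
  have key : ∀ v ∈ velocities d, (stdGaussian (EuclideanSpace ℝ (Fin d))).map
      (fun ξ i => √(d : ℝ) * v i * ξ i) = Measure.pi fun _ : Fin d => gaussianReal 0 1 := by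
    intro v hv
    rw [← map_pi_eq_stdGaussian, Measure.map_map (by fun_prop) (by fun_prop)]
    have hmp : ∀ i, MeasurePreserving (fun y : ℝ => √(d : ℝ) * v i * y)
        (gaussianReal 0 1) (gaussianReal 0 1) := by
      intro i
      refine ⟨by fun_prop, ?_⟩
      rw [gaussianReal_map_const_mul]
      congr 1
      · simp
      · rw [← NNReal.coe_inj]
        rcases hv i with h | h <;> rw [h] <;> simp [ha]
    exact (measurePreserving_pi _ _ hmp).map_eq
  ext s hs
  rw [Measure.map_apply hm hs, stationaryLaw, Measure.prod_apply_symm (hm hs)]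
  have hae : ∀ᵐ v ∂(uniformOn (velocities d)), v ∈ velocities d :=
    ae_cond_mem (finite_velocities d).measurableSet
  rw [lintegral_congr_ae (g := fun _ => (Measure.pi fun _ : Fin d => gaussianReal 0 1) s)]
  · simp
  · filter_upwards [hae] with v hv
    rw [← key v hv, Measure.map_apply (by fun_prop) hs]
    rfl

end StationaryLaw

/-! ### Independent stationary inputs and almost sure path properties -/

section Input

variable {Ω : Type*} [MeasurableSpace Ω] {P : Measure Ω} [IsProbabilityMeasure P] {d : ℕ}
  {N : Fin d → Ω → Measure (ℝ≥0 × ℝ≥0)}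
  {x : ℝ≥0 → Ω → EuclideanSpace ℝ (Fin d) × EuclideanSpace ℝ (Fin d)}

/-- The initial angular momentum of the `i`-th coordinate. -/
def initialMomentum (x : ℝ≥0 → Ω → EuclideanSpace ℝ (Fin d) × EuclideanSpace ℝ (Fin d))
    (i : Fin d) (ω : Ω) : ℝ := √(d : ℝ) * (x 0 ω).2 i * (x 0 ω).1 i

/-- The driving random measure of the `i`-th coordinate in rescaled time. -/
def rescaledMeasure (N : Fin d → Ω → Measure (ℝ≥0 × ℝ≥0)) (i : Fin d) (ω : Ω) :
    Measure (ℝ × ℝ) := (N i ω).map (rescale √(d : ℝ))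

omit [MeasurableSpace Ω] in
theorem unitVelocity_mul_unitPosition_zero (i : Fin d) (ω : Ω) :
    unitVelocity (fun t => x t ω) i 0 * unitPosition (fun t => x t ω) i 0 =
      initialMomentum x i ω := by
  simp [unitVelocity, unitPosition, rescaleTime, initialMomentum]

omit [IsProbabilityMeasure P] in
theorem IsZigZagProcess.rescaledMeasure_poisson (hx : IsZigZagProcess P d gaussianRate N x)
    (hd : 1 ≤ d) (i : Fin d) : IsPoissonRandomMeasure (rescaledMeasure N i) quadrant P := by
  have := (hx.poisson i).map (measurable_rescale √(d : ℝ))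
  rwa [map_rescale_lebesgue (sqrt_dim_pos hd)] at this

omit [IsProbabilityMeasure P] in
theorem IsZigZagProcess.measurable_initialMomentum (hx : IsZigZagProcess P d gaussianRate N x)
    (i : Fin d) : Measurable (initialMomentum x i) := by
  have := hx.measurable 0
  unfold initialMomentum
  fun_prop

omit [IsProbabilityMeasure P] in
theorem IsZigZagProcess.map_initialMomentum (hx : IsZigZagProcess P d gaussianRate N x)
    (hd : 1 ≤ d) (hstat : HasLaw (x 0) (stationaryLaw d) P) :
    P.map (fun ω i => initialMomentum x i ω) = Measure.pi fun _ : Fin d => gaussianReal 0 1 := by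
  rw [← map_stationaryLaw hd, ← hstat.map_eq, Measure.map_map (by fun_prop) (hx.measurable 0)]
  rfl

omit [IsProbabilityMeasure P] in
theorem IsZigZagProcess.indepFun_initialMomentum (hx : IsZigZagProcess P d gaussianRate N x) :
    IndepFun (fun ω i => initialMomentum x i ω) (fun ω i => rescaledMeasure N i ω) P := by
  refine hx.indep_init.comp (φ := fun (y : EuclideanSpace ℝ (Fin d) × EuclideanSpace ℝ (Fin d))
    (i : Fin d) => √(d : ℝ) * y.2 i * y.1 i)
    (ψ := fun (n : Fin d → Measure (ℝ≥0 × ℝ≥0)) i => (n i).map (rescale √(d : ℝ)))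
    (by fun_prop) ?_
  exact measurable_pi_lambda _ fun i =>
    (Measure.measurable_map _ (measurable_rescale _)).comp (measurable_pi_apply i)

omit [IsProbabilityMeasure P] in
theorem IsZigZagProcess.isStationaryInput (hx : IsZigZagProcess P d gaussianRate N x)
    (hd : 1 ≤ d) (hstat : HasLaw (x 0) (stationaryLaw d) P) (i : Fin d) :
    IsStationaryInput P (initialMomentum x i) (rescaledMeasure N i) where
  measurable := hx.measurable_initialMomentum i
  map_eq := by
    have hm : Measurable fun ω i => initialMomentum x i ω :=
      measurable_pi_lambda _ hx.measurable_initialMomentum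
    have h := congrArg (Measure.map (Function.eval i)) (hx.map_initialMomentum hd hstat)
    rw [Measure.map_map (measurable_pi_apply i) hm,
      (measurePreserving_eval (fun _ : Fin d => gaussianReal 0 1) i).map_eq] at h
    exact h
  poisson := hx.rescaledMeasure_poisson hd i
  indep := hx.indepFun_initialMomentum.comp (measurable_pi_apply i) (measurable_pi_apply i)

/-- The inputs of the different coordinates are independent. -/
theorem IsZigZagProcess.iIndepFun_input (hx : IsZigZagProcess P d gaussianRate N x)
    (hd : 1 ≤ d) (hstat : HasLaw (x 0) (stationaryLaw d) P) :
    iIndepFun (fun i ω => (initialMomentum x i ω, rescaledMeasure N i ω)) P := by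
  have hI := hx.isStationaryInput hd hstat
  have hR : ∀ i, Measurable (initialMomentum x i) := fun i => (hI i).measurable
  have hν : ∀ i, Measurable (rescaledMeasure N i) := fun i => (hI i).poisson.measurable
  have hprob : ∀ i, IsProbabilityMeasure (P.map (rescaledMeasure N i)) := fun i =>
    Measure.isProbabilityMeasure_map (hν i).aemeasurable
  have hRv : Measurable fun ω i => initialMomentum x i ω := measurable_pi_lambda _ hR
  have hνv : Measurable fun ω i => rescaledMeasure N i ω := measurable_pi_lambda _ hν
  have hindν : iIndepFun (rescaledMeasure N) P :=
    hx.indep.comp (fun _ n => n.map (rescale √(d : ℝ)))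
      fun _ => Measure.measurable_map _ (measurable_rescale _)
  rw [iIndepFun_iff_map_fun_eq_pi_map fun i => ((hR i).prodMk (hν i)).aemeasurable]
  have h1 : ∀ i, P.map (fun ω => (initialMomentum x i ω, rescaledMeasure N i ω)) =
      (gaussianReal 0 1).prod (P.map (rescaledMeasure N i)) := fun i => by
    rw [(indepFun_iff_map_prod_eq_prod_map_map (hR i).aemeasurable (hν i).aemeasurable).1
      (hI i).indep, (hI i).map_eq]
  simp_rw [h1]
  -- Regrouped as a pair of arrays, the joint law factors: the initial momenta are independent of
  -- the driving measures, and each array has a product law.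
  apply (MeasurableEquiv.arrowProdEquivProdArrow ℝ (Measure (ℝ × ℝ))
    (Fin d)).map_measurableEquiv_injective
  rw [(measurePreserving_arrowProdEquivProdArrow ℝ (Measure (ℝ × ℝ)) (Fin d)
    (fun _ => gaussianReal 0 1) (fun i => P.map (rescaledMeasure N i))).map_eq,
    ← hx.map_initialMomentum hd hstat,
    ← (iIndepFun_iff_map_fun_eq_pi_map fun i => (hν i).aemeasurable).1 hindν,
    ← (indepFun_iff_map_prod_eq_prod_map_map hRv.aemeasurable hνv.aemeasurable).1
      hx.indepFun_initialMomentum,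
    Measure.map_map (MeasurableEquiv.measurable _)
      (measurable_pi_lambda _ fun i => (hR i).prodMk (hν i))]
  rfl

theorem IsZigZagProcess.ae_isZigZagPath (hx : IsZigZagProcess P d gaussianRate N x)
    (hd : 1 ≤ d) : ∀ᵐ ω ∂P, IsZigZagPath (fun t => x t ω) (fun i => N i ω) := by
  have hp := hx.rescaledMeasure_poisson hd
  have hfin : ∀ᵐ ω ∂P, ∀ i (m : ℕ),
      rescaledMeasure N i ω (Set.Iic (m : ℝ) ×ˢ Set.Iic (m : ℝ)) ≠ ∞ := by
    rw [ae_all_iff]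
    intro i
    rw [ae_all_iff]
    intro m
    have hq : quadrant (Set.Iic (m : ℝ) ×ˢ Set.Iic (m : ℝ)) ≠ ∞ := by
      rw [quadrant, Measure.prod_prod, Measure.restrict_apply measurableSet_Iic, Set.inter_comm,
        Set.Ici_inter_Iic, Real.volume_Icc]
      exact (ENNReal.mul_lt_top ENNReal.ofReal_lt_top ENNReal.ofReal_lt_top).ne
    filter_upwards [(hp i).ae_lt_top (measurableSet_Iic.prod measurableSet_Iic) hq] with ω hω
    exact hω.ne
  have hax : ∀ᵐ ω ∂P, ∀ i, rescaledMeasure N i ω {p | p.2 ≤ 0} = 0 := by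
    rw [ae_all_iff]
    intro i
    have hm : MeasurableSet {p : ℝ × ℝ | p.2 ≤ 0} :=
      measurableSet_le measurable_snd measurable_const
    have hq : quadrant {p : ℝ × ℝ | p.2 ≤ 0} = 0 := by
      have h1 : {p : ℝ × ℝ | p.2 ≤ 0} = Set.univ ×ˢ Set.Iic 0 := by ext p; simp
      rw [h1, quadrant, Measure.prod_prod, Measure.restrict_apply measurableSet_Iic, Set.inter_comm,
        Set.Ici_inter_Iic, Real.volume_Icc]
      simp
    have h2 := (hp i).measure_eq_zero hm (by rw [hq]; simp)
    rw [hq] at h2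
    simp only [ENNReal.toReal_zero, neg_zero, Real.exp_zero, ENNReal.ofReal_one] at h2
    have hm' : MeasurableSet {ω | rescaledMeasure N i ω {p | p.2 ≤ 0} = 0} :=
      ((Measure.measurable_coe hm).comp (hp i).measurable) (measurableSet_singleton 0)
    exact (prob_compl_eq_zero_iff hm').2 h2
  have hcount : ∀ᵐ ω ∂P, ∀ i, ∀ B : Set (ℝ × ℝ), MeasurableSet B →
      ∃ n : ℕ∞, rescaledMeasure N i ω B = n := by
    rw [ae_all_iff]
    exact fun i => (hp i).counting
  filter_upwards [hx.cadlag, hx.velocity_mem, hx.position_eq, hx.velocity_eq, hfin, hax, hcount]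
    with ω h1 h2 h3 h4 h5 h6 h7
  exact ⟨h1, h2, h3, h4, h5, h6, h7⟩

end Input

/-! ### Jump times of the angular momentum as switching times -/

section JumpTimes

variable {d : ℕ} {w : ℝ≥0 → EuclideanSpace ℝ (Fin d) × EuclideanSpace ℝ (Fin d)}
  {N : Fin d → Measure (ℝ≥0 × ℝ≥0)}

theorem angularMomentum_eq_sum (hd : 1 ≤ d)
    (w : ℝ≥0 → EuclideanSpace ℝ (Fin d) × EuclideanSpace ℝ (Fin d)) (t : ℝ≥0) :
    angularMomentum w t = (√(d : ℝ))⁻¹ * ∑ i, unitVelocity w i t * unitPosition w i t := by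
  have ha := (sqrt_dim_pos hd).ne'
  simp only [angularMomentum, unitVelocity, unitPosition, rescaleTime, Real.toNNReal_coe,
    PiLp.inner_apply, Finset.mul_sum]
  refine Finset.sum_congr rfl fun i _ => ?_
  simp only [RCLike.inner_apply, conj_trivial]
  field_simp

/-- The jump times of the angular momentum are the switching times of the coordinates. -/
theorem IsZigZagPath.image_coe_jumpTimes (hw : IsZigZagPath w N) (hd : 1 ≤ d) {T : ℝ≥0} {h : ℝ}
    (hh : 0 < h) {n : ℕ} (hn : n * h = T)
    (hbox : ∀ i, ∀ k < n, (N i).map (rescale √(d : ℝ)) (corner (k * h) h) = 0) :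
    ((↑) : ℝ≥0 → ℝ) '' jumpTimes (angularMomentum w) T =
      switchTime h (fun i => unitVelocity w i 0 * unitPosition w i 0)
        (fun i => (N i).map (rescale √(d : ℝ))) ''
        (switches h n (fun i => unitVelocity w i 0 * unitPosition w i 0)
          fun i => (N i).map (rescale √(d : ℝ))) := by
  have ha := sqrt_dim_pos hd
  have hp := hw.isUnitPath hd
  have hiff : ∀ t : ℝ≥0, 0 < t → t ≤ T →
      (angularMomentum w t - Function.leftLim (angularMomentum w) t ≠ 0 ↔
        (t : ℝ) ∈ switchTime h (fun i => unitVelocity w i 0 * unitPosition w i 0)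
          (fun i => (N i).map (rescale √(d : ℝ))) ''
          (switches h n (fun i => unitVelocity w i 0 * unitPosition w i 0)
            fun i => (N i).map (rescale √(d : ℝ)))) := by
    intro t ht htT
    have hs : (t : ℝ) ∈ Set.Ioc 0 ((n : ℝ) * h) := by
      rw [hn]
      exact ⟨by exact_mod_cast ht, by exact_mod_cast htT⟩
    obtain ⟨l, hl, hiff⟩ := tendsto_left_sum hp hh hbox hs
    rw [← hiff]
    have hcoe : Tendsto ((↑) : ℝ≥0 → ℝ) (𝓝[<] t) (𝓝[<] (t : ℝ)) :=
      tendsto_nhdsWithin_of_tendsto_nhds_of_eventually_within _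
        (NNReal.continuous_coe.continuousWithinAt) (by
          filter_upwards [self_mem_nhdsWithin] with r hr
          exact_mod_cast hr)
    have hlim : Tendsto (angularMomentum w) (𝓝[<] t) (𝓝 ((√(d : ℝ))⁻¹ * l)) := by
      refine ((hl.comp hcoe).const_mul _).congr fun r => ?_
      rw [angularMomentum_eq_sum hd]
      rfl
    have := nhdsLT_nnreal_neBot ht
    rw [leftLim_eq_of_tendsto hlim, angularMomentum_eq_sum hd, ← mul_sub, ne_eq, ne_eq,
      mul_eq_zero, not_iff_not, sub_eq_zero, or_iff_right (inv_ne_zero ha.ne'), eq_comm]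
  ext s
  constructor
  · rintro ⟨t, ⟨htT, hne⟩, rfl⟩
    rcases eq_or_ne t 0 with rfl | ht
    · refine absurd ?_ hne
      rw [leftLim_eq_of_eq_bot, sub_self]
      have : Set.Iio (0 : ℝ≥0) = ∅ := by ext; simp
      rw [this, nhdsWithin_empty]
    · exact (hiff t (pos_iff_ne_zero.2 ht) htT).1 hne
  · intro hs
    obtain ⟨p, hp', hps⟩ := id hs
    obtain ⟨hk, h1, h2⟩ := switches_spec hp hh hbox (Finset.mem_coe.1 hp')
    rw [hps] at h1 h2
    have h3 : (p.2 : ℝ) + 1 ≤ n := by exact_mod_cast hk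
    have hs0 : 0 < s := lt_of_le_of_lt (by positivity) h1
    have hsT : s ≤ T := by rw [← hn]; nlinarith
    lift s to ℝ≥0 using hs0.le
    have h4 : 0 < s := by exact_mod_cast hs0
    have h5 : s ≤ T := by exact_mod_cast hsT
    exact ⟨s, ⟨h5, (hiff s h4 h5).2 hs⟩, rfl⟩

theorem IsZigZagPath.finite_jumpTimes (hw : IsZigZagPath w N) (hd : 1 ≤ d) {T : ℝ≥0} {h : ℝ}
    (hh : 0 < h) {n : ℕ} (hn : n * h = T)
    (hbox : ∀ i, ∀ k < n, (N i).map (rescale √(d : ℝ)) (corner (k * h) h) = 0) :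
    (jumpTimes (angularMomentum w) T).Finite := by
  apply Set.Finite.of_finite_image _ (NNReal.coe_injective.injOn)
  rw [hw.image_coe_jumpTimes hd hh hn hbox]
  exact (Finset.finite_toSet _).image _

/-- With at most one switching coordinate per step, distinct switches occur at distinct times. -/
theorem IsZigZagPath.ncard_jumpTimes (hw : IsZigZagPath w N) (hd : 1 ≤ d) {T : ℝ≥0} {h : ℝ}
    (hh : 0 < h) {n : ℕ} (hn : n * h = T)
    (hbox : ∀ i, ∀ k < n, (N i).map (rescale √(d : ℝ)) (corner (k * h) h) = 0)
    (hsingle : ∀ i j, ∀ k < n,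
      (i, k) ∈ switches h n (fun i => unitVelocity w i 0 * unitPosition w i 0)
        (fun i => (N i).map (rescale √(d : ℝ))) →
      (j, k) ∈ switches h n (fun i => unitVelocity w i 0 * unitPosition w i 0)
        (fun i => (N i).map (rescale √(d : ℝ))) → i = j) :
    (jumpTimes (angularMomentum w) T).ncard =
      ∑ i, switchCount h (unitVelocity w i 0 * unitPosition w i 0)
        ((N i).map (rescale √(d : ℝ))) n := by
  rw [← Set.ncard_image_of_injective _ NNReal.coe_injective,
    hw.image_coe_jumpTimes hd hh hn hbox,
    (injOn_switchTime (hw.isUnitPath hd) hh hbox hsingle).ncard_image,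
    Set.ncard_coe_finset, card_switches]

end JumpTimes

/-! ### The probability that a time step is crowded -/

section BadEvent

variable {Ω : Type*} [MeasurableSpace Ω] {P : Measure Ω} [IsProbabilityMeasure P] {d : ℕ}
  {N : Fin d → Ω → Measure (ℝ≥0 × ℝ≥0)}
  {x : ℝ≥0 → Ω → EuclideanSpace ℝ (Fin d) × EuclideanSpace ℝ (Fin d)}

theorem measurableSet_corner (t h : ℝ) : MeasurableSet (corner t h) :=
  (measurableSet_lt measurable_const measurable_fst).inter
    ((measurableSet_le measurable_fst measurable_const).inter
      (measurableSet_le measurable_snd measurable_const))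

theorem quadrant_corner_le (t : ℝ) {h : ℝ} (hh : 0 ≤ h) :
    quadrant (corner t h) ≤ ENNReal.ofReal (h ^ 2) := by
  have h1 : corner t h = Set.Ioc t (t + h) ×ˢ Set.Iic h := by
    ext p; simp [corner, and_assoc]
  rw [h1, quadrant, Measure.prod_prod, sq, ENNReal.ofReal_mul hh]
  gcongr
  · refine (Measure.restrict_apply_le _ _).trans ?_
    rw [Real.volume_Ioc, add_sub_cancel_left]
  · rw [Measure.restrict_apply measurableSet_Iic, Set.inter_comm, Set.Ici_inter_Iic,
      Real.volume_Icc, sub_zero]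

theorem IsStationaryInput.measure_one_le_corner {X : Ω → ℝ} {M : Ω → Measure (ℝ × ℝ)}
    (hI : IsStationaryInput P X M) (t : ℝ) {h : ℝ} (hh : 0 ≤ h) :
    P {ω | 1 ≤ M ω (corner t h)} ≤ ENNReal.ofReal (h ^ 2) := by
  have hq := quadrant_corner_le t hh
  have hq' := ENNReal.toReal_le_of_le_ofReal (sq_nonneg h) hq
  rw [hI.poisson.measure_one_le (measurableSet_corner t h) (ne_top_of_le_ne_top (by simp) hq)]
  apply ENNReal.ofReal_le_ofReal
  linarith [Real.add_one_le_exp (-(quadrant (corner t h)).toReal)]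

/-- The event that a coordinate may switch twice, or two coordinates switch, in the same step. -/
def crowded (h : ℝ) (n : ℕ) (X : Fin d → Ω → ℝ) (M : Fin d → Ω → Measure (ℝ × ℝ)) : Set Ω :=
  ⋃ k ∈ Finset.range n, ⋃ i : Fin d, {ω | 1 ≤ M i ω (corner (k * h) h)} ∪
    ⋃ j : Fin d, {ω | i ≠ j ∧ Fires (k * h) (chain h (X i ω) (M i ω) k) h (M i ω) ∧
      Fires (k * h) (chain h (X j ω) (M j ω) k) h (M j ω)}

/-- Union bound: n d corners of intensity at most h², and n d² pairs of coordinates, where distinct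
coordinates are independent and each fires with probability O(h). -/
theorem measure_crowded_le {X : Fin d → Ω → ℝ} {M : Fin d → Ω → Measure (ℝ × ℝ)}
    (hI : ∀ i, IsStationaryInput P (X i) (M i))
    (hindep : iIndepFun (fun i ω => (X i ω, M i ω)) P) {h T : ℝ} (hh : 0 ≤ h) {n : ℕ}
    (hn : n * h ≤ T) :
    P (crowded h n X M) ≤ n * (d * (ENNReal.ofReal (h ^ 2) +
      d * (ENNReal.ofReal h * absMoment T 1) ^ 2)) := by
  have hpair : ∀ k < n, ∀ i j, P {ω | i ≠ j ∧ Fires (k * h) (chain h (X i ω) (M i ω) k) h (M i ω) ∧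
      Fires (k * h) (chain h (X j ω) (M j ω) k) h (M j ω)} ≤
      (ENNReal.ofReal h * absMoment T 1) ^ 2 := by
    intro k hk i j
    by_cases hij : i = j
    · simp [hij]
    have hk' : ((k : ℝ) + 1) * h ≤ T := by
      refine le_trans ?_ hn
      gcongr
      exact_mod_cast hk
    have hm := measurableSet_fires_chain hh k
    have := (hindep.indepFun hij).measure_inter_preimage_eq_mul _ _ hm hm
    have he : {ω | i ≠ j ∧ Fires (k * h) (chain h (X i ω) (M i ω) k) h (M i ω) ∧
        Fires (k * h) (chain h (X j ω) (M j ω) k) h (M j ω)} =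
        (fun ω => (X i ω, M i ω)) ⁻¹' {p : ℝ × Measure (ℝ × ℝ) | Fires (k * h) (chain h p.1 p.2 k) h p.2} ∩
        (fun ω => (X j ω, M j ω)) ⁻¹' {p : ℝ × Measure (ℝ × ℝ) | Fires (k * h) (chain h p.1 p.2 k) h p.2} := by
      ext ω; simp [hij]
    rw [he, this, sq]
    exact mul_le_mul' ((hI i).measure_fires_chain_le hh hk') ((hI j).measure_fires_chain_le hh hk')
  calc P (crowded h n X M) ≤ ∑ k ∈ Finset.range n, ∑ i : Fin d, (ENNReal.ofReal (h ^ 2) +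
        ∑ j : Fin d, (ENNReal.ofReal h * absMoment T 1) ^ 2) := by
        refine (measure_biUnion_finset_le _ _).trans (Finset.sum_le_sum fun k hk => ?_)
        refine (measure_iUnion_fintype_le _ _).trans (Finset.sum_le_sum fun i _ => ?_)
        refine (measure_union_le _ _).trans (add_le_add ((hI i).measure_one_le_corner _ hh) ?_)
        exact (measure_iUnion_fintype_le _ _).trans
          (Finset.sum_le_sum fun j _ => hpair k (Finset.mem_range.1 hk) i j)
    _ = _ := by simp [mul_add]

theorem IsZigZagProcess.ae_of_not_crowded (hx : IsZigZagProcess P d gaussianRate N x)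
    (hd : 1 ≤ d) {T : ℝ≥0} {h : ℝ} (hh : 0 < h) {n : ℕ} (hn : n * h = T) :
    ∀ᵐ ω ∂P, ω ∉ crowded h n (initialMomentum x) (rescaledMeasure N) →
      (jumpTimes (angularMomentum fun t => x t ω) T).Finite ∧
      (jumpTimes (angularMomentum fun t => x t ω) T).ncard =
        ∑ i, switchCount h (initialMomentum x i ω) (rescaledMeasure N i ω) n := by
  classical
  filter_upwards [hx.ae_isZigZagPath hd] with ω hw hω
  simp only [crowded, Set.mem_iUnion, Set.mem_union, Set.mem_ofPred_eq, not_exists, not_or,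
    Finset.mem_range, not_and, not_le] at hω
  have hbox : ∀ i, ∀ k < n, (N i ω).map (rescale √(d : ℝ)) (corner (k * h) h) = 0 :=
    fun i k hk => (hw.isUnitPath hd i).eq_zero_of_lt_one (measurableSet_corner _ _) (hω k hk i).1
  refine ⟨hw.finite_jumpTimes hd hh hn hbox, ?_⟩
  have := hw.ncard_jumpTimes hd hh hn hbox
  simp only [unitVelocity_mul_unitPosition_zero] at this
  refine this fun i j k hk hi hj => ?_
  by_contra hij
  simp only [switches, Finset.mem_filter] at hi hj
  exact (hω k hk i).2 j hij hi.2 hj.2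

end BadEvent

/-! ### Chebyshev's inequality for the average count -/

section LawOfLargeNumbers

variable {Ω : Type*} [MeasurableSpace Ω] {P : Measure Ω} [IsProbabilityMeasure P] {d : ℕ}
  {X : Fin d → Ω → ℝ} {M : Fin d → Ω → Measure (ℝ × ℝ)}

theorem measure_crowded_le_div (hI : ∀ i, IsStationaryInput P (X i) (M i))
    (hindep : iIndepFun (fun i ω => (X i ω, M i ω)) P) {T : ℝ} (hT : 0 ≤ T) {n : ℕ} (hn : 0 < n) :
    P (crowded (T / n) n X M) ≤
      ENNReal.ofReal (d * (T ^ 2 + d * (T * (absMoment T 1).toReal) ^ 2) / n) := by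
  have hn' : (0 : ℝ) < n := by exact_mod_cast hn
  have hh : 0 ≤ T / n := by positivity
  refine (measure_crowded_le hI hindep hh (T := T) (mul_div_cancel₀ T hn'.ne').le).trans_eq ?_
  rw [← ENNReal.ofReal_toReal (absMoment_one_lt_top hT).ne, ENNReal.toReal_ofReal (by positivity),
    ← ENNReal.ofReal_mul hh, ← ENNReal.ofReal_pow (by positivity), ← ENNReal.ofReal_natCast d,
    ← ENNReal.ofReal_natCast n, ← ENNReal.ofReal_mul (by positivity),
    ← ENNReal.ofReal_add (by positivity) (by positivity), ← ENNReal.ofReal_mul (by positivity),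
    ← ENNReal.ofReal_mul (by positivity)]
  congr 1
  field_simp

theorem IsStationaryInput.memLp_switchCount {X : Ω → ℝ} {M : Ω → Measure (ℝ × ℝ)}
    (hI : IsStationaryInput P X M) {h : ℝ} (hh : 0 ≤ h) (n : ℕ) (p : ℝ≥0∞) :
    MemLp (fun ω => (switchCount h (X ω) (M ω) n : ℝ)) p P := by
  refine MemLp.of_bound (measurable_from_top.comp
    (hI.measurable_switchCount hh n)).aestronglyMeasurable n (Eventually.of_forall fun ω => ?_)
  rw [Real.norm_of_nonneg (Nat.cast_nonneg _)]
  exact_mod_cast switchCount_le _ _ _ _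

/-- A bound for the variance of the number of switches of a coordinate up to time `T`. -/
def varianceBound (T : ℝ) : ℝ :=
  (ENNReal.ofReal T * (2 * (ENNReal.ofReal T * absMoment T 2) + absMoment T 1)).toReal

theorem IsStationaryInput.variance_switchCount_le {X : Ω → ℝ} {M : Ω → Measure (ℝ × ℝ)}
    (hI : IsStationaryInput P X M) {T h : ℝ} (hT : 0 ≤ T) (hh : 0 ≤ h) {n : ℕ} (hn : n * h = T) :
    variance (fun ω => (switchCount h (X ω) (M ω) n : ℝ)) P ≤ varianceBound T := by
  have hm := (hI.memLp_switchCount hh n 2).aestronglyMeasurable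
  refine (variance_le_expectation_sq hm).trans ?_
  rw [integral_eq_lintegral_of_nonneg_ae
    (f := (fun ω => (switchCount h (X ω) (M ω) n : ℝ)) ^ 2)
    (Eventually.of_forall fun ω => sq_nonneg (switchCount h (X ω) (M ω) n : ℝ)) (hm.pow 2)]
  apply ENNReal.toReal_mono
  · have h1 := (absMoment_one_lt_top hT).ne
    have h2 := (absMoment_two_lt_top hT).ne
    finiteness
  · have h1 := hI.lintegral_switchCount_sq_le hh hn.le
    rw [← mul_assoc, ← ENNReal.ofReal_natCast, ← ENNReal.ofReal_mul (Nat.cast_nonneg n), hn] at h1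
    refine le_trans (le_of_eq ?_) h1
    refine lintegral_congr fun ω => ?_
    simp [ENNReal.ofReal_pow]

/-- Two errors meet: n² h³ = T² h from the drift of the chain away from N(0,1), and n h² = T h, up
to the moment constant, from linearising the switching probability. -/
theorem IsStationaryInput.abs_integral_switchCount_sub_limit_le {X : Ω → ℝ}
    {M : Ω → Measure (ℝ × ℝ)} (hI : IsStationaryInput P X M) {T h : ℝ} (hh : 0 ≤ h) (h1 : h ≤ 1)
    {n : ℕ} (hn : n * h = T) :
    |∫ ω, (switchCount h (X ω) (M ω) n : ℝ) ∂P - T / √(2 * Real.pi)| ≤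
      (T ^ 2 + T * ∫ x, (|x| + 1) ^ 2 ∂(gaussianReal 0 1)) * h := by
  have h2 := hI.abs_integral_switchCount_sub_le hh n
  have h3 := mul_le_mul_of_nonneg_left (abs_integral_switchProb_sub_le hh h1)
    (Nat.cast_nonneg (α := ℝ) n)
  rw [← abs_of_nonneg (Nat.cast_nonneg (α := ℝ) n), ← abs_mul,
    abs_of_nonneg (Nat.cast_nonneg (α := ℝ) n)] at h3
  calc _ = |(∫ ω, (switchCount h (X ω) (M ω) n : ℝ) ∂P -
          n * ∫ x, switchProb h x ∂(gaussianReal 0 1)) +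
          n * (∫ x, switchProb h x ∂(gaussianReal 0 1) - h * (√(2 * Real.pi))⁻¹)| := by
        rw [← hn]; congr 1; ring
    _ ≤ _ := abs_add_le _ _
    _ ≤ _ := add_le_add h2 h3
    _ = _ := by rw [← hn]; ring

/-- Chebyshev's inequality for the average number of switches of the coordinates. -/
theorem measure_average_switchCount_ge (hd : 1 ≤ d) (hI : ∀ i, IsStationaryInput P (X i) (M i))
    (hindep : iIndepFun (fun i ω => (X i ω, M i ω)) P) {T h ε : ℝ} (hT : 0 ≤ T) (hh : 0 ≤ h)
    (h1 : h ≤ 1) {n : ℕ} (hn : n * h = T) (hε : 0 < ε)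
    (hmean : (T ^ 2 + T * ∫ x, (|x| + 1) ^ 2 ∂(gaussianReal 0 1)) * h ≤ ε) :
    P {ω | 2 * ε ≤ |(d : ℝ)⁻¹ * ((∑ i, switchCount h (X i ω) (M i ω) n : ℕ) : ℝ) -
      T / √(2 * Real.pi)|} ≤ ENNReal.ofReal ((d : ℝ)⁻¹ * varianceBound T / ε ^ 2) := by
  have hd' : (0 : ℝ) < d := by exact_mod_cast hd
  let K : Fin d → Ω → ℝ := fun i ω => switchCount h (X i ω) (M i ω) n
  have hK : ∀ i, MemLp (K i) 2 P := fun i => (hI i).memLp_switchCount hh n 2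
  let S : Ω → ℝ := fun ω => (d : ℝ)⁻¹ * (∑ i, K i) ω
  have hS : MemLp S 2 P := (memLp_finsetSum' Finset.univ fun i _ => hK i).const_mul _
  have hvar : variance S P ≤ (d : ℝ)⁻¹ * varianceBound T := by
    rw [variance_const_mul, IndepFun.variance_sum (fun i _ => hK i)]
    · calc (d : ℝ)⁻¹ ^ 2 * ∑ i, variance (K i) P
          ≤ (d : ℝ)⁻¹ ^ 2 * ∑ i : Fin d, varianceBound T := by
            gcongr with i
            exact (hI i).variance_switchCount_le hT hh hn
        _ = _ := by
            simp only [Finset.sum_const, Finset.card_univ, Fintype.card_fin, nsmul_eq_mul]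
            field_simp
    · intro i _ j _ hij
      have hm : Measurable fun p : ℝ × Measure (ℝ × ℝ) => (switchCount h p.1 p.2 n : ℝ) :=
        measurable_from_top.comp (measurable_switchCount hh n)
      exact (hindep.indepFun hij).comp hm hm
  have hint : |P[S] - T / √(2 * Real.pi)| ≤ ε := by
    have h2 : P[S] - T / √(2 * Real.pi) =
        (d : ℝ)⁻¹ * ∑ i, (P[K i] - T / √(2 * Real.pi)) := by
      rw [integral_const_mul, Finset.sum_sub_distrib]
      simp only [Finset.sum_apply]
      rw [integral_finsetSum _ fun i _ => (hK i).integrable one_le_two]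
      simp only [Finset.sum_const, Finset.card_univ, Fintype.card_fin, nsmul_eq_mul]
      field_simp
    rw [h2, abs_mul, abs_of_nonneg (by positivity : (0 : ℝ) ≤ (d : ℝ)⁻¹)]
    calc (d : ℝ)⁻¹ * |∑ i, (P[K i] - T / √(2 * Real.pi))|
        ≤ (d : ℝ)⁻¹ * ∑ i : Fin d, ε := by
          gcongr
          refine (Finset.abs_sum_le_sum_abs _ _).trans (Finset.sum_le_sum fun i _ => ?_)
          exact ((hI i).abs_integral_switchCount_sub_limit_le hh h1 hn).trans hmean
      _ = ε := by
          simp only [Finset.sum_const, Finset.card_univ, Fintype.card_fin, nsmul_eq_mul]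
          field_simp
  have hsub : {ω | 2 * ε ≤ |(d : ℝ)⁻¹ * ((∑ i, switchCount h (X i ω) (M i ω) n : ℕ) : ℝ) -
      T / √(2 * Real.pi)|} ⊆ {ω | ε ≤ |S ω - P[S]|} := by
    intro ω hω
    have h2 : S ω = (d : ℝ)⁻¹ * ((∑ i, switchCount h (X i ω) (M i ω) n : ℕ) : ℝ) := by
      simp [S, K]
    rw [Set.mem_ofPred_eq, ← h2] at hω
    have h3 := abs_sub_le (S ω) P[S] (T / √(2 * Real.pi))
    change ε ≤ |S ω - P[S]|
    linarith
  refine (measure_mono hsub).trans ((meas_ge_le_variance_div_sq hS hε).trans ?_)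
  gcongr

end LawOfLargeNumbers

/-! ### Finiteness and the quantitative law of large numbers -/

section ZigZagProcess

variable {Ω : Type*} [MeasurableSpace Ω] {P : Measure Ω} [IsProbabilityMeasure P] {d : ℕ}
  {N : Fin d → Ω → Measure (ℝ≥0 × ℝ≥0)}
  {x : ℝ≥0 → Ω → EuclideanSpace ℝ (Fin d) × EuclideanSpace ℝ (Fin d)}

/-- Infinitely many jumps force crowding at every mesh size, up to a null set, and the probability
of crowding vanishes as n → ∞ for fixed d. -/
theorem IsZigZagProcess.ae_finite_jumpTimes (hx : IsZigZagProcess P d gaussianRate N x)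
    (hd : 1 ≤ d) (hstat : HasLaw (x 0) (stationaryLaw d) P) {T : ℝ≥0} (hT : 0 < T) :
    ∀ᵐ ω ∂P, (jumpTimes (angularMomentum fun t => x t ω) T).Finite := by
  have hle : ∀ n : ℕ, 0 < n →
      P {ω | ¬ (jumpTimes (angularMomentum fun t => x t ω) T).Finite} ≤
        ENNReal.ofReal (d * ((T : ℝ) ^ 2 + d * (T * (absMoment T 1).toReal) ^ 2) / n) := by
    intro n hn
    have hn' : (0 : ℝ) < n := by exact_mod_cast hn
    refine le_trans (measure_mono_ae ?_) (measure_crowded_le_div (hx.isStationaryInput hd hstat)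
      (hx.iIndepFun_input hd hstat) T.2 hn)
    filter_upwards [hx.ae_of_not_crowded hd (T := T) (h := T / n) (by positivity)
      (mul_div_cancel₀ _ hn'.ne')] with ω hω hω'
    by_contra hc
    exact hω' (hω hc).1
  have hlim : Tendsto (fun n : ℕ => ENNReal.ofReal
      (d * ((T : ℝ) ^ 2 + d * (T * (absMoment T 1).toReal) ^ 2) / n)) atTop (𝓝 0) := by
    rw [← ENNReal.ofReal_zero]
    exact ENNReal.tendsto_ofReal (tendsto_const_div_atTop_nhds_zero_nat _)
  exact le_antisymm (ge_of_tendsto hlim ((eventually_gt_atTop 0).mono hle)) zero_le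

/-- A quantitative law of large numbers for the number of switches. -/
theorem IsZigZagProcess.measure_ncard_jumpTimes_ge (hx : IsZigZagProcess P d gaussianRate N x)
    (hd : 1 ≤ d) (hstat : HasLaw (x 0) (stationaryLaw d) P) {T : ℝ≥0} (hT : 0 < T) {ε : ℝ}
    (hε : 0 < ε) {n : ℕ} (hn : 0 < n) (h1 : (T : ℝ) / n ≤ 1)
    (hmean : ((T : ℝ) ^ 2 + T * ∫ x, (|x| + 1) ^ 2 ∂(gaussianReal 0 1)) * (T / n) ≤ ε) :
    P {ω | 2 * ε ≤ |(d : ℝ)⁻¹ *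
        ((jumpTimes (angularMomentum fun t => x t ω) T).ncard : ℝ) - T / √(2 * Real.pi)|} ≤
      ENNReal.ofReal (d * ((T : ℝ) ^ 2 + d * (T * (absMoment T 1).toReal) ^ 2) / n) +
        ENNReal.ofReal ((d : ℝ)⁻¹ * varianceBound T / ε ^ 2) := by
  have hn' : (0 : ℝ) < n := by exact_mod_cast hn
  have hnh : (n : ℝ) * (T / n) = T := mul_div_cancel₀ _ hn'.ne'
  have hI := hx.isStationaryInput hd hstat
  have hindep := hx.iIndepFun_input hd hstat
  refine le_trans (measure_mono_ae (t := crowded (T / n) n (initialMomentum x) (rescaledMeasure N) ∪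
    {ω | 2 * ε ≤ |(d : ℝ)⁻¹ * ((∑ i, switchCount (T / n) (initialMomentum x i ω)
      (rescaledMeasure N i ω) n : ℕ) : ℝ) - T / √(2 * Real.pi)|}) ?_)
    ((measure_union_le _ _).trans (add_le_add (measure_crowded_le_div hI hindep T.2 hn)
      (measure_average_switchCount_ge hd hI hindep T.2 (by positivity) h1 hnh hε hmean)))
  filter_upwards [hx.ae_of_not_crowded hd (T := T) (h := T / n) (by positivity) hnh] with ω hω hω'
  by_cases hc : ω ∈ crowded (T / n) n (initialMomentum x) (rescaledMeasure N)
  · exact Or.inl hc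
  · right
    have h2 : 2 * ε ≤ |(d : ℝ)⁻¹ *
        ((jumpTimes (angularMomentum fun t => x t ω) T).ncard : ℝ) - T / √(2 * Real.pi)| := hω'
    rw [(hω hc).2] at h2
    exact h2

end ZigZagProcess

end ZigZag

end

/-! ### The limit in probability -/

theorem mainTheorem8 {Ω : ℕ → Type*} [∀ d, MeasurableSpace (Ω d)]
    (P : ∀ d, Measure (Ω d)) [∀ d, IsProbabilityMeasure (P d)]
    (N : ∀ d : ℕ, Fin d → Ω d → Measure (ℝ≥0 × ℝ≥0))
    (x : ∀ d : ℕ, ℝ≥0 → Ω d → EuclideanSpace ℝ (Fin d) × EuclideanSpace ℝ (Fin d))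
    (hx : ∀ d, 1 ≤ d → ZigZag.IsZigZagProcess (P d) d ZigZag.gaussianRate (N d) (x d))
    (hstat : ∀ d, 1 ≤ d → HasLaw (x d 0) (ZigZag.stationaryLaw d) (P d))
    (T : ℝ≥0) (hT : 0 < T) :
    (∀ d, 1 ≤ d → ∀ᵐ ω ∂(P d),
      (ZigZag.jumpTimes (ZigZag.angularMomentum (fun t => x d t ω)) T).Finite) ∧
    ∀ ε : ℝ, 0 < ε → Tendsto
      (fun d : ℕ => P d {ω | ε ≤
        |(d : ℝ)⁻¹ * ((ZigZag.jumpTimes (ZigZag.angularMomentum (fun t => x d t ω)) T).ncard : ℝ)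
          - (T : ℝ) / √(2 * Real.pi)|})
      atTop (𝓝 0) := by
  refine ⟨fun d hd => (hx d hd).ae_finite_jumpTimes hd (hstat d hd) hT, fun ε hε => ?_⟩
  have hinv : Tendsto (fun d : ℕ => ((d : ℝ))⁻¹) atTop (𝓝 0) := tendsto_inv_atTop_nhds_zero_nat
  have hbound : ∀ (c : ℝ) (d : ℕ), 1 ≤ d → 0 ≤ c → c / ((d ^ 3 : ℕ) : ℝ) ≤ c * (d : ℝ)⁻¹ := by
    intro c d hd hc
    rw [div_eq_mul_inv]
    gcongr
    exact le_self_pow₀ hd (by norm_num)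
  have hsmall : ∀ c δ : ℝ, 0 ≤ c → 0 < δ → ∀ᶠ d : ℕ in atTop, c / ((d ^ 3 : ℕ) : ℝ) ≤ δ := by
    intro c δ hc hδ
    have h1 := hinv.const_mul c
    rw [mul_zero] at h1
    filter_upwards [h1.eventually_le_const hδ, eventually_ge_atTop 1] with d h2 hd
    exact (hbound c d hd hc).trans h2
  have hlim : Tendsto (fun d : ℕ => ENNReal.ofReal (((T : ℝ) ^ 2 +
      (T * (ZigZag.absMoment T 1).toReal) ^ 2) * (d : ℝ)⁻¹) +
      ENNReal.ofReal ((d : ℝ)⁻¹ * ZigZag.varianceBound T / (ε / 2) ^ 2)) atTop (𝓝 0) := by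
    have h1 := ENNReal.tendsto_ofReal (hinv.const_mul ((T : ℝ) ^ 2 +
      (T * (ZigZag.absMoment T 1).toReal) ^ 2))
    have h2 := ENNReal.tendsto_ofReal ((hinv.mul_const (ZigZag.varianceBound T)).div_const
      ((ε / 2) ^ 2))
    simpa using h1.add h2
  refine tendsto_of_tendsto_of_tendsto_of_le_of_le' tendsto_const_nhds hlim
    (Eventually.of_forall fun _ => zero_le) ?_
  have hC : 0 ≤ ((T : ℝ) ^ 2 + T * ∫ x, (|x| + 1) ^ 2 ∂(gaussianReal 0 1)) * T := by
    have : 0 ≤ ∫ x, (|x| + 1) ^ 2 ∂(gaussianReal 0 1) := integral_nonneg fun x => by positivity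
    positivity
  filter_upwards [hsmall T 1 T.2 one_pos, hsmall _ (ε / 2) hC (by positivity),
    eventually_ge_atTop 1] with d h1 h2 hd
  have hd' : (1 : ℝ) ≤ d := by exact_mod_cast hd
  -- With n = d³ the crowding bound, of order d²/n, becomes O(1/d), and the mesh T/n tends to zero
  -- as the mean estimate requires. Half of ε is spent on the error of the mean, half on the
  -- deviation from it.
  have h3 := (hx d hd).measure_ncard_jumpTimes_ge hd (hstat d hd) hT (half_pos hε)
    (pow_pos (by omega : 0 < d) 3) h1 (by rwa [← mul_div_assoc])
  rw [mul_div_cancel₀ ε two_ne_zero] at h3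
  refine h3.trans (add_le_add (ENNReal.ofReal_le_ofReal ?_) le_rfl)
  have h4 : 0 ≤ (d : ℝ)⁻¹ := by positivity
  push_cast
  calc (d : ℝ) * ((T : ℝ) ^ 2 + d * (T * (ZigZag.absMoment T 1).toReal) ^ 2) / (d : ℝ) ^ 3
      ≤ d * (d * (T : ℝ) ^ 2 + d * (T * (ZigZag.absMoment T 1).toReal) ^ 2) / (d : ℝ) ^ 3 := by
        gcongr
        exact le_mul_of_one_le_left (by positivity) hd'
    _ = _ := by field_simp
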